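/- Consider the Filippov systems on $\mathbb{R}^2$ with switching manifold $\Sigma=\{y=0\}$ given by $X_\lambda(x,y)=(1,\;x-\lambda)$ for $y\ge 0$ and $Y_{\mu,\beta}(x,y)=\bigl(\tfrac{\mu}{2}x+\tfrac{\mu-2}{2}(y+\beta),\ \tfrac{\mu-2}{2}x+\tfrac{\mu}{2}(y+\beta)\bigr)$ for $y\le 0$, with $(\lambda,\beta)\in D=(-1,1)\times(-\tfrac{\sqrt3}{2},\tfrac{\sqrt3}{2})$. Write $Z_{\lambda,\mu,\beta}$ for this system. The field $X_\lambda$ has a visible fold at $d=(\lambda,0)$. The field $Y_{\mu,\beta}$ has a saddle at $S=(0,-\beta)$ and is tangent to $\Sigma$ exactly at the abscissa $t=\mu\beta/(2-\mu)$ (a visible fold if $\beta<0$, the saddle itself if $\beta=0$, an invisible fold if $\beta>0$). If $\beta>0$, the unstable and stable separatrices of $S$ meet $\Sigma$ at $(-\beta,0)$ and $(\beta,0)$. Two such systems are called $\Sigma$-equivalent (have the same phase portrait) if an orientation preserving homeomorphism of the plane sends $\Sigma$ onto $\Sigma$, and sends the oriented orbits of the two fields in their closed half-planes, and of the sliding vector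 field $Z^\Sigma$ on the escaping and sliding regions, onto those of the other system. A zero of $Z^\Sigma$ in these regions is called a pseudo equilibrium. It is a $\Sigma$-saddle if it is an attractor of $Z^\Sigma$ in the escaping region or a repeller in the sliding region, a $\Sigma$-repeller if it is a repeller in the escaping region, and a $\Sigma$-attractor if it is an attractor in the sliding region. Theorem. There are $\varepsilon_0>0$ and $\rho>0$ such that for every $\mu\in(-\varepsilon_0,0)$ the following hold. 1. $D$ is the disjoint union of the thirteen regions: $\beta<0$ with $\lambda<t$, $\lambda=t$, $\lambda>t$; $\beta=0$ with $\lambda<0$, $\lambda=0$, $\lambda>0$; $\beta>0$ with $\lambda<-\beta$, $\lambda=-\beta$, $-\beta<\lambda<t$, $\lambda=t$, $t<\lambda<\beta$, $\lambda=\beta$, $\lambda>\beta$. Each of them contains points of $D$ arbitrarily close to $(0,0)$. 2. Systems with parameters in two different regions of $D$ are never $\Sigma$-equivalent. Systems with parameters in the same region are $\Sigma$-equivalent if $|\lambda|<\rho$ and $|\beta|<\rho$ for both; in the seven regions with $\beta\le0$ or $\lambda=t$ they are $\Sigma$-equivalent on the whole of $D$. In particular, for $0<r\le\rho$, the bifurcation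 diagram on $D\cap\{|\lambda|<r,\ |\beta|<r\}$ has exactly $13$ distinct phase portraits. 3. For every $(\lambda,\beta)\in D$ the sliding, crossing and escaping regions are the parts of $\Sigma$ with $x<\min(\lambda,t)$, $\min(\lambda,t)<x<\max(\lambda,t)$ and $x>\max(\lambda,t)$. There is a $\Sigma$-saddle $Q=(q,0)$ with $q>\lambda$, $q>t$ and $q>0$, that is, to the right of the folds and of the saddle. It is the only pseudo equilibrium if $\beta\le0$ or $\lambda=t$. If $\beta>0$ there is exactly one further pseudo equilibrium when $\lambda\ne t$: a $\Sigma$-repeller if $\lambda<t$ and a $\Sigma$-attractor if $\lambda>t$. -/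

import Mathlib

open Set Filter Topology

/-- A planar Filippov system with switching manifold `{y = 0}`: the smooth field `X` acts on the
closed half-plane `y ≥ 0` and the smooth field `Y` on the closed half-plane `y ≤ 0`. -/
structure FilippovSystem where
  X : ℝ × ℝ → ℝ × ℝ
  Y : ℝ × ℝ → ℝ × ℝ

/-- The switching manifold `Σ`. -/
def switchingManifold : Set (ℝ × ℝ) := {z | z.2 = 0}

/-- The half-plane `Σ₊`. -/
def upperHalf : Set (ℝ × ℝ) := {z | 0 ≤ z.2}

/-- The half-plane `Σ₋`. -/
def lowerHalf : Set (ℝ × ℝ) := {z | z.2 ≤ 0}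

/-- `γ`, restricted to the interval `I`, is an integral curve of the vector field `W` that stays
in `C`.  (One-point intervals are allowed and only say that the point lies in `C`.) -/
def IsOrbitArc (W : ℝ × ℝ → ℝ × ℝ) (C : Set (ℝ × ℝ)) (I : Set ℝ) (γ : ℝ → ℝ × ℝ) : Prop :=
  I.OrdConnected ∧ ∀ t ∈ I, γ t ∈ C ∧ HasDerivWithinAt γ (W (γ t)) I t

namespace FilippovSystem

/-- The crossing region `Σ_c`; here `X.f` and `Y.f` are the second components of the fields. -/
def crossingRegion (Z : FilippovSystem) : Set (ℝ × ℝ) :=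
  {z | z ∈ switchingManifold ∧ 0 < (Z.X z).2 * (Z.Y z).2}

/-- The escaping region `Σ_e`. -/
def escapingRegion (Z : FilippovSystem) : Set (ℝ × ℝ) :=
  {z | z ∈ switchingManifold ∧ 0 < (Z.X z).2 ∧ (Z.Y z).2 < 0}

/-- The sliding region `Σ_s`. -/
def slidingRegion (Z : FilippovSystem) : Set (ℝ × ℝ) :=
  {z | z ∈ switchingManifold ∧ (Z.X z).2 < 0 ∧ 0 < (Z.Y z).2}

/-- The sliding vector field `Z^Σ`: the convex combination of `X` and `Y` that is tangent to `Σ`.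
Only its values on `Σ_e ∪ Σ_s`, where the denominator does not vanish, are used. -/
noncomputable def slidingField (Z : FilippovSystem) (z : ℝ × ℝ) : ℝ × ℝ :=
  ((Z.Y z).2 / ((Z.Y z).2 - (Z.X z).2)) • Z.X z - ((Z.X z).2 / ((Z.Y z).2 - (Z.X z).2)) • Z.Y z

/-- An arc of an orbit of `Z`: an arc of an orbit of `X` in `Σ₊` or of `Y` in `Σ₋`. -/
def IsArc (Z : FilippovSystem) (I : Set ℝ) (γ : ℝ → ℝ × ℝ) : Prop :=
  IsOrbitArc Z.X upperHalf I γ ∨ IsOrbitArc Z.Y lowerHalf I γ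

/-- An arc of an orbit of the sliding vector field `Z^Σ` in `Σ_e ∪ Σ_s`. -/
def IsSlidingArc (Z : FilippovSystem) (I : Set ℝ) (γ : ℝ → ℝ × ℝ) : Prop :=
  IsOrbitArc Z.slidingField (Z.escapingRegion ∪ Z.slidingRegion) I γ

/-- `q` is a pseudo equilibrium of `Z`. -/
def IsPseudoEquilibrium (Z : FilippovSystem) (q : ℝ × ℝ) : Prop :=
  q ∈ Z.escapingRegion ∪ Z.slidingRegion ∧ Z.slidingField q = 0

/-- `q` is an attractor (asymptotically stable) for `Z^Σ`. -/
def IsSlidingAttractor (Z : FilippovSystem) (q : ℝ × ℝ) : Prop :=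
  ∀ ε > 0, ∃ δ > 0, ∀ z ∈ switchingManifold, dist z q < δ →
    ∃ γ : ℝ → ℝ × ℝ, Z.IsSlidingArc (Ici 0) γ ∧ γ 0 = z ∧
      (∀ t ∈ Ici (0 : ℝ), dist (γ t) q < ε) ∧ Tendsto γ atTop (𝓝 q)

/-- `q` is a repeller (an attractor in backward time) for `Z^Σ`. -/
def IsSlidingRepeller (Z : FilippovSystem) (q : ℝ × ℝ) : Prop :=
  ∀ ε > 0, ∃ δ > 0, ∀ z ∈ switchingManifold, dist z q < δ →
    ∃ γ : ℝ → ℝ × ℝ, Z.IsSlidingArc (Iic 0) γ ∧ γ 0 = z ∧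
      (∀ t ∈ Iic (0 : ℝ), dist (γ t) q < ε) ∧ Tendsto γ atBot (𝓝 q)

/-- `q` is a `Σ`-saddle. -/
def IsSigmaSaddle (Z : FilippovSystem) (q : ℝ × ℝ) : Prop :=
  Z.IsPseudoEquilibrium q ∧
    ((q ∈ Z.escapingRegion ∧ Z.IsSlidingAttractor q) ∨
      (q ∈ Z.slidingRegion ∧ Z.IsSlidingRepeller q))

/-- `q` is a `Σ`-repeller. -/
def IsSigmaRepeller (Z : FilippovSystem) (q : ℝ × ℝ) : Prop :=
  Z.IsPseudoEquilibrium q ∧ q ∈ Z.escapingRegion ∧ Z.IsSlidingRepeller q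

/-- `q` is a `Σ`-attractor. -/
def IsSigmaAttractor (Z : FilippovSystem) (q : ℝ × ℝ) : Prop :=
  Z.IsPseudoEquilibrium q ∧ q ∈ Z.slidingRegion ∧ Z.IsSlidingAttractor q

end FilippovSystem

/-- The homeomorphism `h` of the plane preserves orientation: for every `p`, the image of the unit
circle around `p` (run counterclockwise) has winding number `1` around `h p`.  The functions `r`
and `φ` are the distance to `h p` and a continuous choice of the argument. -/
def PreservesOrientation (h : (ℝ × ℝ) ≃ₜ (ℝ × ℝ)) : Prop :=
  ∀ p : ℝ × ℝ, ∃ r φ : ℝ → ℝ, Continuous φ ∧ (∀ θ, 0 < r θ) ∧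
    (∀ θ, h (p + (Real.cos θ, Real.sin θ)) = h p + r θ • (Real.cos (φ θ), Real.sin (φ θ))) ∧
    ∀ θ, φ (θ + 2 * Real.pi) = φ θ + 2 * Real.pi

/-- `h` sends every arc of the first family to an arc of the second one, up to an increasing
continuous change of time (so that the orbits are sent into orbits, with their orientation). -/
def SendsArcs (h : ℝ × ℝ → ℝ × ℝ) (A B : Set ℝ → (ℝ → ℝ × ℝ) → Prop) : Prop :=
  ∀ I γ, A I γ → ∃ (s : ℝ → ℝ) (η : ℝ → ℝ × ℝ), StrictMonoOn s I ∧ ContinuousOn s I ∧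
    B (s '' I) η ∧ ∀ t ∈ I, h (γ t) = η (s t)

/-- `Σ`-equivalence of two Filippov systems on the plane: there is an orientation preserving
homeomorphism of the plane that sends `Σ` onto `Σ`, orbits of `Z` onto orbits of `Z'`, and orbits
of the sliding field of `Z` onto orbits of the sliding field of `Z'`. -/
def SigmaEquivalent (Z Z' : FilippovSystem) : Prop :=
  ∃ h : (ℝ × ℝ) ≃ₜ (ℝ × ℝ), PreservesOrientation h ∧
    h '' switchingManifold = switchingManifold ∧
    SendsArcs h Z.IsArc Z'.IsArc ∧ SendsArcs h.symm Z'.IsArc Z.IsArc ∧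
    SendsArcs h Z.IsSlidingArc Z'.IsSlidingArc ∧ SendsArcs h.symm Z'.IsSlidingArc Z.IsSlidingArc

/-- The type `τ` of the fold of `X`. -/
inductive FoldType
  | inv
  | vis

/-- The coefficient `α₁(τ)`. -/
def FoldType.coeffOne : FoldType → ℝ
  | .inv => -1
  | .vis => 1

/-- The coefficient `α₂(τ)`. -/
def FoldType.coeffTwo : FoldType → ℝ
  | .inv => 1
  | .vis => 0

/-- The three-parameter family; the parameters of the bifurcation diagram are `p = (lam, β)`. -/
noncomputable def foldSaddleFamily (τ : FoldType) (μ : ℝ) (p : ℝ × ℝ) : FilippovSystem where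
  X := fun z => (1, τ.coeffOne * (z.1 - p.1) + τ.coeffTwo * (z.1 - p.1) ^ 2)
  Y := fun z => (μ / 2 * z.1 + (μ - 2) / 2 * (z.2 + p.2), (μ - 2) / 2 * z.1 + μ / 2 * (z.2 + p.2))

/-- The range of the parameters `(lam, β)`. -/
noncomputable def parameterDomain : Set (ℝ × ℝ) :=
  {p | p.1 ∈ Ioo (-1 : ℝ) 1 ∧ p.2 ∈ Ioo (-(Real.sqrt 3 / 2)) (Real.sqrt 3 / 2)}

/-- The part of the parameter range with `|lam| < r` and `|β| < r`. -/
noncomputable def parameterSquare (r : ℝ) : Set (ℝ × ℝ) :=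
  {p | p ∈ parameterDomain ∧ |p.1| < r ∧ |p.2| < r}

/-- The abscissa `μβ/(2-μ)` of the point of `Σ` where `Y` is tangent to `Σ`: the visible fold `e` of
`Y` if `β < 0`, the saddle `S = (0,-β)` of `Y` if `β = 0`, the invisible fold `i` if `β > 0`. -/
noncomputable def tangencyY (μ β : ℝ) : ℝ := μ * β / (2 - μ)

/-- The thirteen regions of the `(lam, β)`-diagram.  The fold of `X` is `d = (lam, 0)`; if `β > 0`,
the unstable and stable separatrices of the saddle `(0,-β)` of `Y`, which lie on the lines
`y = -x - β` and `y = x - β`, meet `Σ` at `h = (-β, 0)` and `j = (β, 0)`. -/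
noncomputable def diagramRegion (μ : ℝ) : Fin 13 → Set (ℝ × ℝ) := ![
  {p | p.2 < 0 ∧ p.1 < tangencyY μ p.2},
  {p | p.2 < 0 ∧ p.1 = tangencyY μ p.2},
  {p | p.2 < 0 ∧ tangencyY μ p.2 < p.1},
  {p | p.2 = 0 ∧ p.1 < 0},
  {p | p.2 = 0 ∧ p.1 = 0},
  {p | p.2 = 0 ∧ 0 < p.1},
  {p | 0 < p.2 ∧ p.1 < -p.2},
  {p | 0 < p.2 ∧ p.1 = -p.2},
  {p | 0 < p.2 ∧ -p.2 < p.1 ∧ p.1 < tangencyY μ p.2},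
  {p | 0 < p.2 ∧ p.1 = tangencyY μ p.2},
  {p | 0 < p.2 ∧ tangencyY μ p.2 < p.1 ∧ p.1 < p.2},
  {p | 0 < p.2 ∧ p.1 = p.2},
  {p | 0 < p.2 ∧ p.2 < p.1}]

/-- The distinct phase portraits that occur for parameters in `R`: the classes of the parameters in
`R` modulo `Σ`-equivalence of the corresponding systems. -/
def phasePortraits (Z : ℝ × ℝ → FilippovSystem) (R : Set (ℝ × ℝ)) : Set (Set (ℝ × ℝ)) :=
  (fun p => {q | q ∈ R ∧ SigmaEquivalent (Z p) (Z q)}) '' R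

/-! In the coordinates `(u, v)` along its axes the saddle is `u' = u`, `v' = -c v` with `c = 1 - μ`.
Homotheties commute with this flow and carry `β` to `kβ`, so for a fixed sign of `β` only the order
of the marked points of `Σ` can matter. These are the fold `l` of `X`, the tangency `t` of `Y`, the
points `±β` of the separatrices and the two zeros `P < Q` of the sliding field.

A `Σ`-equivalence is built from its restriction `g` to `Σ`. In the upper half-plane an orbit of the
visible fold meets `Σ` at most once, and every increasing `g` with `g l = l'` extends
(`halfConj_upper`). In the lower half-plane points outside an interval that contains `t` and `±β`
can be moved freely (`saddleConj_stretchAfter`, with its mirror image `exists_leftMove`). For `β >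
0`, however, the orbits in the triangle between the separatrices join pairs of points of `Σ`, and
`g` has to respect this involution. Measured by the signed depth below the maximal level of the
first integral, the involution is `x ↦ -x`, so an odd map of the depths that is the identity near
the separatrices extends (`DepthShift.saddleConj`). Hence `l` and `P` can be moved together inside
the triangle if they stay on their sides of `t` and keep the order of their levels.

The numerator of the sliding field is a quadratic with small positive leading coefficient, negative
at `10`, so that `P < 10 < Q`. Its signs at `l` and `t` show that `P` is irrelevant if `β ≤ 0` or `l
= t`, because it then lies in neither the sliding nor the escaping region. Otherwise `t` separates
`P` from `l`. Near the origin `P` lies between the separatrices, and when `l` does too, `P` is less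
than half as far from `t`, which puts the level of `l` below that of `P`
(`SlideRoots.triangleLevel_lt`). This is what `ρ` is needed for.

Conversely, an equivalence acts on `Σ` by an increasing map (`exists_sigmaMatching`), because
escaping points cannot become sliding points. It preserves the ends of the crossing region, the fold
of `X`, the saddle if `β ≥ 0`, and the separatrices if `β > 0`. So the sign of `β` and the position
of `l` relative to `t` and `±β` are invariants, and these are the data that define the regions
(`mem_region_of_sigmaEquivalent`). -/

/-! ### Orientation of homeomorphisms of the plane that preserve a line. -/

/-- A continuous argument that lies over the upper half-plane on `(0, π)`, over the lower one on
`(π, 2π)`, over the positive axis at `0` and over the negative axis at `π` gains exactly `2π`. -/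
lemma argument_gain_of_half_turns {φ : ℝ → ℝ} (hφ : Continuous φ)
    (h0 : Real.cos (φ 0) = 1) (hπ : Real.cos (φ Real.pi) = -1)
    (h2 : Real.cos (φ (2 * Real.pi)) = 1)
    (hup : ∀ θ ∈ Ioo 0 Real.pi, 0 < Real.sin (φ θ))
    (hlow : ∀ θ ∈ Ioo Real.pi (2 * Real.pi), Real.sin (φ θ) < 0) :
    φ (2 * Real.pi) = φ 0 + 2 * Real.pi := by
  have pp := Real.pi_pos
  obtain ⟨n, hn⟩ := (Real.cos_eq_one_iff _).1 h0
  obtain ⟨j, hj⟩ : ∃ j : ℤ, (j : ℝ) * (2 * Real.pi) = φ Real.pi - Real.pi := by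
    rw [← Real.cos_eq_one_iff, Real.cos_sub_pi, hπ, neg_neg]
  obtain ⟨m, hm⟩ := (Real.cos_eq_one_iff _).1 h2
  -- Where the sine is positive the argument cannot pass `-π/2` modulo `2π`, and where it is
  -- negative it cannot pass `π/2`. By intermediate values each half turn then gains exactly `π`.
  have key1 : ∀ k : ℤ, ∀ θ ∈ Ioo 0 Real.pi, φ θ ≠ k * (2 * Real.pi) - Real.pi / 2 := by
    intro k θ hθ h
    have := hup θ hθ
    rw [h, show (k : ℝ) * (2 * Real.pi) - Real.pi / 2 = -(Real.pi / 2) + k * (2 * Real.pi) by ring,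
      Real.sin_add_int_mul_two_pi, Real.sin_neg, Real.sin_pi_div_two] at this
    linarith
  have key2 : ∀ k : ℤ, ∀ θ ∈ Ioo Real.pi (2 * Real.pi),
      φ θ ≠ k * (2 * Real.pi) + Real.pi / 2 := by
    intro k θ hθ h
    have := hlow θ hθ
    rw [h, add_comm, Real.sin_add_int_mul_two_pi, Real.sin_pi_div_two] at this
    linarith
  have ivt : ∀ a b c : ℝ, a < b → (φ a < c ∧ c < φ b ∨ φ b < c ∧ c < φ a) →
      ∃ θ ∈ Ioo a b, φ θ = c := by
    intro a b c hab h
    rcases h with h | h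
    · exact intermediate_value_Ioo hab.le hφ.continuousOn h
    · exact intermediate_value_Ioo' hab.le hφ.continuousOn h
  have hjn : j = n := by
    rcases lt_trichotomy j n with h | h | h
    · exfalso
      have h' : (j : ℝ) + 1 ≤ n := by exact_mod_cast h
      obtain ⟨θ, hθ, e⟩ := ivt 0 Real.pi (n * (2 * Real.pi) - Real.pi / 2) pp
        (Or.inr ⟨by nlinarith, by nlinarith⟩)
      exact key1 _ θ hθ e
    · exact h
    · exfalso
      have h' : (n : ℝ) + 1 ≤ j := by exact_mod_cast h
      obtain ⟨θ, hθ, e⟩ := ivt 0 Real.pi ((n + 1 : ℤ) * (2 * Real.pi) - Real.pi / 2) pp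
        (Or.inl ⟨by push_cast; nlinarith, by push_cast; nlinarith⟩)
      exact key1 _ θ hθ e
  subst hjn
  have hmj : m = j + 1 := by
    rcases lt_trichotomy m (j + 1) with h | h | h
    · exfalso
      have h' : (m : ℝ) ≤ j := by exact_mod_cast Int.lt_add_one_iff.1 h
      obtain ⟨θ, hθ, e⟩ := ivt Real.pi (2 * Real.pi) (j * (2 * Real.pi) + Real.pi / 2) (by linarith)
        (Or.inr ⟨by nlinarith, by nlinarith⟩)
      exact key2 _ θ hθ e
    · exact h
    · exfalso
      have h' : (j : ℝ) + 1 + 1 ≤ m := by exact_mod_cast h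
      obtain ⟨θ, hθ, e⟩ := ivt Real.pi (2 * Real.pi) ((j + 1 : ℤ) * (2 * Real.pi) + Real.pi / 2)
        (by linarith) (Or.inl ⟨by push_cast; nlinarith, by push_cast; nlinarith⟩)
      exact key2 _ θ hθ e
  subst hmj
  push_cast at hm
  linarith

/-- The point of `ℂ` with the given coordinates. -/
def toComplex (z : ℝ × ℝ) : ℂ := ⟨z.1, z.2⟩

lemma continuous_toComplex : Continuous toComplex := by
  have : toComplex = fun z : ℝ × ℝ => (z.1 : ℂ) + z.2 * Complex.I := by
    funext z
    exact Complex.mk_eq_add_mul_I _ _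
  rw [this]
  fun_prop

lemma toComplex_ne_zero {z : ℝ × ℝ} (hz : z ≠ 0) : toComplex z ≠ 0 := by
  intro h
  apply hz
  have h1 := congrArg Complex.re h
  have h2 := congrArg Complex.im h
  exact Prod.ext h1 h2

lemma polar_toComplex {z : ℝ × ℝ} (φ : ℝ)
    (h : (φ : Real.Angle) = (Complex.arg (toComplex z) : Real.Angle)) :
    z = ‖toComplex z‖ • (Real.cos φ, Real.sin φ) := by
  have hc : Real.cos φ = Real.cos (Complex.arg (toComplex z)) := by
    rw [← Real.Angle.cos_coe, h, Real.Angle.cos_coe]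
  have hs : Real.sin φ = Real.sin (Complex.arg (toComplex z)) := by
    rw [← Real.Angle.sin_coe, h, Real.Angle.sin_coe]
  ext
  · simp [hc, Complex.norm_mul_cos_arg, toComplex]
  · simp [hs, Complex.norm_mul_sin_arg, toComplex]

lemma circle_ne_zero (θ : ℝ) : ((Real.cos θ, Real.sin θ) : ℝ × ℝ) ≠ 0 := by
  intro h
  have h1 : Real.cos θ = 0 := congrArg Prod.fst h
  have h2 : Real.sin θ = 0 := congrArg Prod.snd h
  have := Real.sin_sq_add_cos_sq θ
  rw [h1, h2] at this
  norm_num at this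

/-- Simultaneous continuous arguments for the images of all unit circles. -/
lemma exists_argument (h : (ℝ × ℝ) ≃ₜ (ℝ × ℝ)) :
    ∃ Φ : (ℝ × ℝ) × ℝ → ℝ, Continuous Φ ∧ ∀ a, (Φ a : Real.Angle) =
      (Complex.arg (toComplex (h (a.1 + (Real.cos a.2, Real.sin a.2)) - h a.1)) : Real.Angle) := by
  have hne : ∀ a : (ℝ × ℝ) × ℝ,
      toComplex (h (a.1 + (Real.cos a.2, Real.sin a.2)) - h a.1) ≠ 0 := by
    intro a
    apply toComplex_ne_zero
    rw [sub_ne_zero]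
    intro e
    have := h.injective e
    exact circle_ne_zero a.2 (by simpa using this)
  have hcont : Continuous fun a : (ℝ × ℝ) × ℝ =>
      (Complex.arg (toComplex (h (a.1 + (Real.cos a.2, Real.sin a.2)) - h a.1)) : Real.Angle) := by
    rw [continuous_iff_continuousAt]
    intro a
    have h1 : ContinuousAt (fun a : (ℝ × ℝ) × ℝ =>
        toComplex (h (a.1 + (Real.cos a.2, Real.sin a.2)) - h a.1)) a := by
      apply Continuous.continuousAt
      apply continuous_toComplex.comp
      have := h.continuous
      fun_prop
    exact ContinuousAt.comp (f := fun a : (ℝ × ℝ) × ℝ =>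
        toComplex (h (a.1 + (Real.cos a.2, Real.sin a.2)) - h a.1))
      (Complex.continuousAt_arg_coe_angle (hne a)) h1
  -- The space of pairs (centre, angle) is simply connected, so the argument, a map to the circle,
  -- lifts to `ℝ` for all centres at once.
  let f : C((ℝ × ℝ) × ℝ, AddCircle (2 * Real.pi)) := ⟨_, hcont⟩
  have : SimplyConnectedSpace ((ℝ × ℝ) × ℝ) := inferInstance
  obtain ⟨Φ, hΦ, -⟩ := (AddCircle.isCoveringMap_coe (2 * Real.pi)).existsUnique_continuousMap_lifts
    f ((0, 0) : (ℝ × ℝ) × ℝ) (Complex.arg (toComplex (h ((0 : ℝ × ℝ) +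
      (Real.cos 0, Real.sin 0)) - h 0))) rfl
  exact ⟨Φ, Φ.continuous, fun a => congrFun hΦ.2 a⟩

/-- A homeomorphism of the plane that maps each of the closed half-planes into itself and is
increasing on `Σ` preserves orientation. -/
theorem preservesOrientation_of_halves (h : (ℝ × ℝ) ≃ₜ (ℝ × ℝ)) (g : ℝ → ℝ) (hg : StrictMono g)
    (h0 : ∀ x, h (x, 0) = (g x, 0)) (hup : ∀ z : ℝ × ℝ, 0 < z.2 → 0 < (h z).2)
    (hlow : ∀ z : ℝ × ℝ, z.2 < 0 → (h z).2 < 0) : PreservesOrientation h := by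
  obtain ⟨Φ, hΦ, hlift⟩ := exists_argument h
  have polar : ∀ a : (ℝ × ℝ) × ℝ, h (a.1 + (Real.cos a.2, Real.sin a.2)) - h a.1 =
      ‖toComplex (h (a.1 + (Real.cos a.2, Real.sin a.2)) - h a.1)‖ •
        (Real.cos (Φ a), Real.sin (Φ a)) := fun a => polar_toComplex _ (hlift a)
  have hpos : ∀ a : (ℝ × ℝ) × ℝ,
      0 < ‖toComplex (h (a.1 + (Real.cos a.2, Real.sin a.2)) - h a.1)‖ := by
    intro a
    rw [norm_pos_iff]
    apply toComplex_ne_zero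
    rw [sub_ne_zero]
    intro e
    exact circle_ne_zero a.2 (by simpa using h.injective e)
  have hper : (fun a : (ℝ × ℝ) × ℝ => Φ (a.1, a.2 + 2 * Real.pi)) =
      fun a => Φ a + 2 * Real.pi := by
    -- Both sides lift the same map to the circle, so they agree everywhere once they agree for the
    -- centre `0` and the angle `0`. There the half-turn argument applies, since `h` respects the
    -- half-planes.
    refine (AddCircle.isCoveringMap_coe (2 * Real.pi)).eq_of_comp_eq (by fun_prop) (by fun_prop)
      ?_ ((0 : ℝ × ℝ), (0 : ℝ)) ?_
    · ext a
      have h1 := hlift (a.1, a.2 + 2 * Real.pi)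
      have h2 := hlift a
      simp only [Real.cos_add_two_pi, Real.sin_add_two_pi] at h1
      have h3 : ((Φ a + 2 * Real.pi : ℝ) : Real.Angle) = (Φ a : Real.Angle) := by simp
      exact h1.trans (h2.symm.trans h3.symm)
    · have pol : ∀ θ, h (Real.cos θ, Real.sin θ) - h 0 =
          ‖toComplex (h (Real.cos θ, Real.sin θ) - h 0)‖ •
            (Real.cos (Φ (0, θ)), Real.sin (Φ (0, θ))) := by
        intro θ
        simpa using polar (0, θ)
      have pos' : ∀ θ, 0 < ‖toComplex (h (Real.cos θ, Real.sin θ) - h 0)‖ := by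
        intro θ
        simpa using hpos (0, θ)
      have c1 : ∀ θ, (h (Real.cos θ, Real.sin θ)).1 - (h 0).1 =
          ‖toComplex (h (Real.cos θ, Real.sin θ) - h 0)‖ * Real.cos (Φ (0, θ)) := by
        intro θ
        simpa using congrArg Prod.fst (pol θ)
      have c2 : ∀ θ, (h (Real.cos θ, Real.sin θ)).2 - (h 0).2 =
          ‖toComplex (h (Real.cos θ, Real.sin θ) - h 0)‖ * Real.sin (Φ (0, θ)) := by
        intro θ
        simpa using congrArg Prod.snd (pol θ)
      have h00 : h 0 = (g 0, 0) := h0 0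
      rw [h00] at c1 c2 pos'
      simp only [sub_zero] at c1 c2
      have axis : ∀ θ, Real.sin θ = 0 → Real.sin (Φ (0, θ)) = 0 := by
        intro θ hθ
        have := c2 θ
        rw [hθ, h0] at this
        rcases mul_eq_zero.1 this.symm with h | h
        · have := pos' θ
          rw [hθ, h0] at this
          exact absurd h this.ne'
        · exact h
      have cos1 : ∀ x, Real.sin x = 0 → 0 < Real.cos x → Real.cos x = 1 := by
        intro x h1 h2
        have := Real.sin_sq_add_cos_sq x
        rw [h1] at this
        nlinarith
      have cos2 : ∀ x, Real.sin x = 0 → Real.cos x < 0 → Real.cos x = -1 := by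
        intro x h1 h2
        have := Real.sin_sq_add_cos_sq x
        rw [h1] at this
        nlinarith
      have gain := argument_gain_of_half_turns (φ := fun θ => Φ (0, θ)) (by fun_prop) ?_ ?_ ?_ ?_ ?_
      · simpa using gain
      · apply cos1 _ (axis _ Real.sin_zero)
        have e := c1 0
        have p := pos' 0
        rw [Real.sin_zero, Real.cos_zero, h0] at e p
        have := hg (show (0 : ℝ) < 1 by norm_num)
        by_contra hneg
        have := mul_nonpos_of_nonneg_of_nonpos p.le (not_lt.1 hneg)
        simp only at e
        linarith
      · apply cos2 _ (axis _ Real.sin_pi)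
        have e := c1 Real.pi
        have p := pos' Real.pi
        rw [Real.sin_pi, Real.cos_pi, h0] at e p
        have := hg (show (-1 : ℝ) < 0 by norm_num)
        by_contra hneg
        have := mul_nonneg p.le (not_lt.1 hneg)
        simp only at e
        linarith
      · apply cos1 _ (axis _ Real.sin_two_pi)
        have e := c1 (2 * Real.pi)
        have p := pos' (2 * Real.pi)
        rw [Real.sin_two_pi, Real.cos_two_pi, h0] at e p
        have := hg (show (0 : ℝ) < 1 by norm_num)
        by_contra hneg
        have := mul_nonpos_of_nonneg_of_nonpos p.le (not_lt.1 hneg)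
        simp only at e
        linarith
      · intro θ hθ
        have := hup (Real.cos θ, Real.sin θ) (Real.sin_pos_of_mem_Ioo hθ)
        rw [c2 θ] at this
        exact (pos_iff_pos_of_mul_pos this).1 (pos' θ)
      · intro θ hθ
        have hs : Real.sin θ < 0 := by
          have := Real.sin_pos_of_mem_Ioo (x := θ - Real.pi) ⟨by linarith [hθ.1], by linarith [hθ.2]⟩
          rw [Real.sin_sub_pi] at this
          linarith
        have := hlow (Real.cos θ, Real.sin θ) hs
        rw [c2 θ] at this
        by_contra hneg
        have := mul_nonneg (pos' θ).le (not_lt.1 hneg)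
        linarith
  intro p
  refine ⟨fun θ => ‖toComplex (h (p + (Real.cos θ, Real.sin θ)) - h p)‖, fun θ => Φ (p, θ),
    by fun_prop, fun θ => hpos (p, θ), fun θ => ?_, fun θ => ?_⟩
  · have := polar (p, θ)
    rw [sub_eq_iff_eq_add'] at this
    exact this
  · exact congrFun hper (p, θ)

/-- An orientation preserving homeomorphism that is increasing on `Σ` does not exchange the two
open half-planes. -/
theorem not_preservesOrientation_of_swap (h : (ℝ × ℝ) ≃ₜ (ℝ × ℝ)) (g : ℝ → ℝ) (hg : StrictMono g)
    (h0 : ∀ x, h (x, 0) = (g x, 0)) (hup : ∀ z : ℝ × ℝ, 0 < z.2 → (h z).2 < 0)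
    (hlow : ∀ z : ℝ × ℝ, z.2 < 0 → 0 < (h z).2) : ¬ PreservesOrientation h := by
  intro hor
  obtain ⟨r, φ, hφ, hr, hpol, hper⟩ := hor 0
  have h00 : h 0 = (g 0, 0) := h0 0
  have c1 : ∀ θ, (h (Real.cos θ, Real.sin θ)).1 = g 0 + r θ * Real.cos (φ θ) := by
    intro θ
    simpa [h00] using congrArg Prod.fst (hpol θ)
  have c2 : ∀ θ, (h (Real.cos θ, Real.sin θ)).2 = r θ * Real.sin (φ θ) := by
    intro θ
    simpa [h00] using congrArg Prod.snd (hpol θ)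
  have axis : ∀ θ, Real.sin θ = 0 → Real.sin (φ θ) = 0 := by
    intro θ hθ
    have := c2 θ
    rw [hθ, h0] at this
    exact (mul_eq_zero.1 this.symm).resolve_left (hr θ).ne'
  have e0 : Real.cos (φ 0) = 1 := by
    have e := c1 0
    rw [Real.sin_zero, Real.cos_zero, h0] at e
    have := hg (show (0 : ℝ) < 1 by norm_num)
    have s := axis 0 Real.sin_zero
    have q := Real.sin_sq_add_cos_sq (φ 0)
    rw [s] at q
    have : 0 < Real.cos (φ 0) := by
      by_contra hneg
      have := mul_nonpos_of_nonneg_of_nonpos (hr 0).le (not_lt.1 hneg)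
      simp only at e
      linarith
    nlinarith
  have eπ : Real.cos (φ Real.pi) = -1 := by
    have e := c1 Real.pi
    rw [Real.sin_pi, Real.cos_pi, h0] at e
    have := hg (show (-1 : ℝ) < 0 by norm_num)
    have s := axis Real.pi Real.sin_pi
    have q := Real.sin_sq_add_cos_sq (φ Real.pi)
    rw [s] at q
    have : Real.cos (φ Real.pi) < 0 := by
      by_contra hneg
      have := mul_nonneg (hr Real.pi).le (not_lt.1 hneg)
      simp only at e
      linarith
    nlinarith
  -- If the half-planes are exchanged, it is `-φ` that makes the two half turns, so `φ` would lose
  -- `2π` instead of gaining it.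
  have gain := argument_gain_of_half_turns (φ := fun θ => -φ θ) (by fun_prop) (by simpa using e0)
    (by simpa using eπ) ?_ ?_ ?_
  · have := hper 0
    rw [zero_add] at this
    have pp := Real.pi_pos
    simp only [this] at gain
    linarith
  · have := hper 0
    rw [zero_add] at this
    simp only [Real.cos_neg, this, Real.cos_add_two_pi, e0]
  · intro θ hθ
    have := hup (Real.cos θ, Real.sin θ) (Real.sin_pos_of_mem_Ioo hθ)
    rw [c2 θ] at this
    rw [Real.sin_neg]
    have := neg_of_mul_neg_right this (hr θ).le
    linarith
  · intro θ hθ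
    have hs : Real.sin θ < 0 := by
      have := Real.sin_pos_of_mem_Ioo (x := θ - Real.pi) ⟨by linarith [hθ.1], by linarith [hθ.2]⟩
      rw [Real.sin_sub_pi] at this
      linarith
    have := hlow (Real.cos θ, Real.sin θ) hs
    rw [c2 θ] at this
    rw [Real.sin_neg]
    have := (pos_iff_pos_of_mul_pos this).1 (hr θ)
    linarith

/-! ### Changes of time and scalar differential equations. -/

/-- An order isomorphism between order connected sets is a homeomorphism for their order topologies.
This allows a change of time to be undone continuously. -/
lemma exists_continuousOn_inverse {s : ℝ → ℝ} {I : Set ℝ} (hI : I.OrdConnected)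
    (hs : StrictMonoOn s I) (hc : ContinuousOn s I) :
    ∃ σ : ℝ → ℝ, ContinuousOn σ (s '' I) ∧ (∀ t ∈ I, σ (s t) = t) ∧
      (s '' I).OrdConnected := by
  have hJ : (s '' I).OrdConnected :=
    (hI.isPreconnected.image s hc).ordConnected
  refine ⟨Function.invFunOn s I, ?_, fun t ht => hs.injOn.leftInvOn_invFunOn ht, hJ⟩
  have := hI
  have := hJ
  let e := StrictMonoOn.orderIso s I hs
  rw [continuousOn_iff_continuous_domRestrict]
  have h2 : (s '' I).domRestrict (Function.invFunOn s I) = fun x => ((e.symm x : I) : ℝ) := by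
    funext x
    obtain ⟨t, rfl⟩ := e.surjective x
    rw [e.symm_apply_apply]
    exact hs.injOn.leftInvOn_invFunOn t.2
  rw [h2]
  exact continuous_subtype_val.comp e.symm.continuous

/-- A strictly increasing curve in the region `f > 0` becomes a solution of `x' = f x` after a
change of time, the new time being given by an antiderivative of `1 / f`. -/
lemma exists_timeChange_of_pos {I : Set ℝ} (hI : I.OrdConnected) {w f τ : ℝ → ℝ}
    (hw : ContinuousOn w I) (hm : StrictMonoOn w I) (hf : ∀ t ∈ I, 0 < f (w t))
    (hτ : ∀ t ∈ I, HasDerivAt τ (f (w t))⁻¹ (w t)) :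
    ∃ η : ℝ → ℝ, StrictMonoOn (τ ∘ w) I ∧ ContinuousOn (τ ∘ w) I ∧
      (∀ t ∈ I, HasDerivWithinAt η (f (w t)) ((τ ∘ w) '' I) (τ (w t))) ∧
      ∀ t ∈ I, η (τ (w t)) = w t := by
  have hJ : (w '' I).OrdConnected := (hI.isPreconnected.image w hw).ordConnected
  have hτm : StrictMonoOn τ (w '' I) := by
    apply strictMonoOn_of_deriv_pos hJ.convex
    · rintro _ ⟨t, ht, rfl⟩
      exact (hτ t ht).continuousAt.continuousWithinAt
    · intro x hx
      obtain ⟨t, ht, rfl⟩ := interior_subset hx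
      rw [(hτ t ht).deriv]
      exact inv_pos.2 (hf t ht)
  have hsm : StrictMonoOn (τ ∘ w) I := hτm.comp hm (mapsTo_image w I)
  have hsc : ContinuousOn (τ ∘ w) I := fun t ht =>
    (hτ t ht).continuousAt.comp_continuousWithinAt (hw t ht)
  obtain ⟨σ, hσc, hσ, -⟩ := exists_continuousOn_inverse hI hsm hsc
  have hσ' : ∀ t ∈ I, σ (τ (w t)) = t := hσ
  refine ⟨w ∘ σ, hsm, hsc, ?_, fun t ht => by simp [hσ' t ht]⟩
  intro t ht
  have hval : (w ∘ σ) (τ (w t)) = w t := by simp [hσ' t ht]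
  have h1 : HasDerivAt τ (f (w t))⁻¹ ((w ∘ σ) (τ (w t))) := by rw [hval]; exact hτ t ht
  have h2 : ContinuousWithinAt (w ∘ σ) ((τ ∘ w) '' I) (τ (w t)) := by
    have hmaps : MapsTo σ ((τ ∘ w) '' I) I := by
      rintro _ ⟨t', ht', rfl⟩
      rw [hσ t' ht']; exact ht'
    exact (hw.comp hσc hmaps) _ ⟨t, ht, rfl⟩
  -- Differentiability is not inherited from `w`, which is only continuous. It comes from `τ`, of
  -- which `w ∘ σ` is a continuous right inverse on the new time interval.
  have h3 := HasFDerivWithinAt.of_local_left_inverse (t := univ)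
    (f' := ContinuousLinearEquiv.unitsEquivAut ℝ (Units.mk0 (f (w t))⁻¹ (inv_ne_zero (hf t ht).ne')))
    (g := w ∘ σ) (s := (τ ∘ w) '' I) (a := τ (w t)) (f := τ) (by rw [nhdsWithin_univ]; exact h2)
    (by
      rw [hasFDerivWithinAt_univ]
      refine HasFDerivAt.congr_fderiv h1.hasFDerivAt ?_
      ext; simp) ⟨t, ht, rfl⟩ (by
      filter_upwards [self_mem_nhdsWithin] with x hx
      obtain ⟨t', ht', rfl⟩ := hx
      simp [hσ' t' ht'])
  have h4 := h3.hasDerivWithinAt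
  refine h4.congr_deriv ?_
  simp

/-- The decreasing case becomes the increasing one under `x ↦ -x`. -/
lemma exists_timeChange {I : Set ℝ} (hI : I.OrdConnected) {w f τ : ℝ → ℝ}
    (hw : ContinuousOn w I)
    (hm : (StrictMonoOn w I ∧ ∀ t ∈ I, 0 < f (w t)) ∨ (StrictAntiOn w I ∧ ∀ t ∈ I, f (w t) < 0))
    (hτ : ∀ t ∈ I, HasDerivAt τ (f (w t))⁻¹ (w t)) :
    ∃ η : ℝ → ℝ, StrictMonoOn (τ ∘ w) I ∧ ContinuousOn (τ ∘ w) I ∧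
      (∀ t ∈ I, HasDerivWithinAt η (f (w t)) ((τ ∘ w) '' I) (τ (w t))) ∧
      ∀ t ∈ I, η (τ (w t)) = w t := by
  rcases hm with ⟨hm, hf⟩ | ⟨hm, hf⟩
  · exact exists_timeChange_of_pos hI hw hm hf hτ
  · have hcomp : ((fun x => τ (-x)) ∘ fun t => -w t) = τ ∘ w := by
      funext t; simp
    obtain ⟨η, h1, h2, h3, h4⟩ := exists_timeChange_of_pos hI (w := fun t => -w t)
      (f := fun x => -f (-x)) (τ := fun x => τ (-x)) hw.neg
      (fun a ha b hb hab => neg_lt_neg (hm ha hb hab))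
      (fun t ht => by simpa using hf t ht)
      (fun t ht => by
        have h1 : HasDerivAt τ (f (w t))⁻¹ (-(-w t)) := by simpa using hτ t ht
        have h2 : HasDerivAt (fun x => τ (-x)) ((f (w t))⁻¹ * -1) (-w t) :=
          h1.comp (-w t) (hasDerivAt_neg (-w t))
        simpa [inv_neg] using h2)
    rw [hcomp] at h1 h2
    refine ⟨fun s => -η s, h1, h2, fun t ht => ?_, fun t ht => ?_⟩
    · have h5 := (h3 t ht).neg
      rw [hcomp] at h5
      simp only [neg_neg] at h5
      exact h5
    · have := h4 t ht
      simp only [neg_neg] at this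
      simp [this]

/-- A solution of a linear equation `ψ' = ρ ψ` that vanishes once vanishes identically. -/
lemma eq_zero_of_linear_ode {I : Set ℝ} (hI : I.OrdConnected) {ψ ρ : ℝ → ℝ}
    (hρ : ContinuousOn ρ I) (hψ : ∀ t ∈ I, HasDerivWithinAt ψ (ρ t * ψ t) I t) {a : ℝ}
    (ha : a ∈ I) (h0 : ψ a = 0) : ∀ t ∈ I, ψ t = 0 := by
  -- Forward in time this is Grönwall's inequality on a compact interval, where `ρ` is bounded. The
  -- backward direction follows by reversing time.
  have forward : ∀ {I : Set ℝ}, I.OrdConnected → ∀ {ψ ρ : ℝ → ℝ}, ContinuousOn ρ I →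
      (∀ t ∈ I, HasDerivWithinAt ψ (ρ t * ψ t) I t) → ∀ {a : ℝ}, a ∈ I → ψ a = 0 →
      ∀ t ∈ I, a ≤ t → ψ t = 0 := by
    intro I hI ψ ρ hρ hψ a ha h0 t ht hat
    have hsub : Icc a t ⊆ I := hI.out ha ht
    obtain ⟨C, hC⟩ := isCompact_Icc.exists_bound_of_continuousOn (hρ.mono hsub)
    refine eq_zero_of_abs_deriv_le_mul_abs_self_of_eq_zero_right (f' := fun t => ρ t * ψ t)
      (K := C) (a := a) (b := t) (fun x hx => (hψ x (hsub hx)).continuousWithinAt.mono hsub)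
      (fun x hx => ?_) h0 (fun x hx => ?_) t (right_mem_Icc.2 hat)
    · have h1 := (hψ x (hsub ⟨hx.1, hx.2.le⟩)).mono hsub
      have h2 : Icc a t ∈ 𝓝[Ici x] x := by
        refine mem_of_superset (Icc_mem_nhdsGE hx.2) (Icc_subset_Icc_left hx.1)
      exact h1.mono_of_mem_nhdsWithin h2
    · rw [norm_mul]
      exact mul_le_mul_of_nonneg_right (hC x ⟨hx.1, hx.2.le⟩) (norm_nonneg _)
  intro t ht
  rcases le_total a t with h | h
  · exact forward hI hρ hψ ha h0 t ht h
  · have hI' : (Neg.neg ⁻¹' I).OrdConnected := by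
      constructor
      intro x hx y hy z hz
      exact hI.out hy hx ⟨neg_le_neg hz.2, neg_le_neg hz.1⟩
    have := forward hI' (ψ := fun t => ψ (-t)) (ρ := fun t => -ρ (-t)) (a := -a)
      ((hρ.comp continuousOn_neg (fun x hx => hx)).neg) (fun x hx => ?_) (by simpa using ha)
      (by simpa using h0) (-t) (by simpa using ht) (by linarith)
    · simpa using this
    · have h1 := HasDerivWithinAt.scomp x (h := Neg.neg) (s := Neg.neg ⁻¹' I) (hψ (-x) hx)
        (hasDerivAt_neg x).hasDerivWithinAt (mapsTo_preimage _ _)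
      refine HasDerivWithinAt.congr_deriv h1 ?_
      simp

lemma ne_zero_sign_const {I : Set ℝ} (hI : I.OrdConnected) {ψ : ℝ → ℝ} (hc : ContinuousOn ψ I)
    (h : ∀ t ∈ I, ψ t ≠ 0) : (∀ t ∈ I, 0 < ψ t) ∨ (∀ t ∈ I, ψ t < 0) := by
  by_contra! hcon
  obtain ⟨⟨a, ha, ha'⟩, b, hb, hb'⟩ := hcon
  obtain ⟨t, ht, h0⟩ := hI.isPreconnected.intermediate_value ha hb hc ⟨ha', hb'⟩
  exact h t ht h0

/-- Stability of a simple zero of a scalar equation `x' = (x - q) r x`, with `r < 0`. -/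
lemma exists_solution_to_attractor {f r : ℝ → ℝ} {q δ : ℝ}
    (hf : ∀ x, |x - q| < δ → f x = (x - q) * r x)
    (hr : ContinuousOn r {x | |x - q| < δ}) (hneg : ∀ x, |x - q| < δ → r x < 0) {z : ℝ}
    (hz : |z - q| < δ) :
    ∃ γ : ℝ → ℝ, (∀ t ∈ Ici (0 : ℝ), HasDerivAt γ (f (γ t)) t) ∧ γ 0 = z ∧
      (∀ t ∈ Ici (0 : ℝ), |γ t - q| ≤ |z - q|) ∧ Tendsto γ atTop (𝓝 q) := by
  have hδ : 0 < δ := (abs_nonneg _).trans_lt hz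
  -- The solution runs along `w`, which satisfies `w' = -(w - q)`, but in the time `s` with `s' = -1
  -- / r(w)`. Freezing `w` at `z` for negative times makes `s` a bijection of the whole line.
  set w : ℝ → ℝ := fun t => q + (z - q) * Real.exp (-t) with hwdef
  have hwq : ∀ t, 0 ≤ t → |w t - q| ≤ |z - q| := by
    intro t ht
    have : w t - q = (z - q) * Real.exp (-t) := by simp [w]
    rw [this, abs_mul, abs_of_pos (Real.exp_pos _)]
    exact mul_le_of_le_one_right (abs_nonneg _) (Real.exp_le_one_iff.2 (by linarith))
  have hwδ : ∀ t, |w (max t 0) - q| < δ := fun t => (hwq _ (le_max_right _ _)).trans_lt hz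
  have hwc : Continuous fun t => w (max t 0) := by fun_prop
  have hrc : Continuous fun t => r (w (max t 0)) := by
    rw [← continuousOn_univ]
    exact hr.comp hwc.continuousOn (fun t _ => hwδ t)
  set ρ : ℝ → ℝ := fun t => -(r (w (max t 0)))⁻¹ with hρdef
  have hρc : Continuous ρ := (hrc.inv₀ (fun t => (hneg _ (hwδ t)).ne)).neg
  have hρpos : ∀ t, 0 < ρ t := fun t => by
    simpa [ρ] using inv_lt_zero.2 (hneg _ (hwδ t))
  -- The positive lower bound of `s'` sends `s` to infinity, so the solution exists for all forward
  -- times.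
  obtain ⟨m, hm, hmρ⟩ : ∃ m > 0, ∀ t, m ≤ ρ t := by
    have hcpt : IsCompact (Icc (q - |z - q|) (q + |z - q|)) := isCompact_Icc
    have hsub : Icc (q - |z - q|) (q + |z - q|) ⊆ {x | |x - q| < δ} := by
      intro x hx
      have : |x - q| ≤ |z - q| := abs_le.2 ⟨by linarith [hx.1], by linarith [hx.2]⟩
      exact this.trans_lt hz
    obtain ⟨C, hC⟩ := hcpt.exists_bound_of_continuousOn (hr.mono hsub)
    have hC' : ∀ t, -r (w (max t 0)) ≤ C := fun t => by
      have h1 := abs_le.1 (hwq _ (le_max_right t 0))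
      exact (neg_le_abs _).trans (hC _ ⟨by linarith [h1.1], by linarith [h1.2]⟩)
    have hCpos : 0 < C := by
      have h1 := hneg _ (hwδ 0)
      have h2 := hC' 0
      linarith
    refine ⟨C⁻¹, inv_pos.2 hCpos, fun t => ?_⟩
    have h1 := hneg _ (hwδ t)
    simp only [ρ, ← inv_neg]
    exact inv_anti₀ (by linarith) (hC' t)
  set s : ℝ → ℝ := fun t => ∫ x in (0 : ℝ)..t, ρ x with hsdef
  have hs' : ∀ t, HasDerivAt s (ρ t) t := fun t =>
    intervalIntegral.integral_hasDerivAt_right (hρc.intervalIntegrable _ _)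
      (hρc.stronglyMeasurableAtFilter _ _) hρc.continuousAt
  have hsm : StrictMono s := strictMono_of_deriv_pos (fun t => by rw [(hs' t).deriv]; exact hρpos t)
  have hs0 : s 0 = 0 := by simp [s]
  have hlin : ∀ t, HasDerivAt (fun t => s t - m * t) (ρ t - m * 1) t := fun t =>
    (hs' t).sub ((hasDerivAt_id t).const_mul m)
  have hmono : Monotone fun t => s t - m * t := by
    apply monotone_of_deriv_nonneg
    · intro t; exact (hlin t).differentiableAt
    · intro t
      rw [(hlin t).deriv]
      linarith [hmρ t]
  have hsc : Continuous s := continuous_iff_continuousAt.2 fun t => (hs' t).continuousAt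
  have htop : Tendsto s atTop atTop := by
    refine tendsto_atTop_mono' atTop ?_ (tendsto_id.const_mul_atTop hm)
    filter_upwards [eventually_ge_atTop 0] with t ht
    have := hmono ht
    simp only [hs0, mul_zero, sub_zero] at this
    simp only [id]
    linarith
  have hbot : Tendsto s atBot atBot := by
    refine tendsto_atBot_mono' atBot ?_ (tendsto_id.const_mul_atBot hm)
    filter_upwards [eventually_le_atBot 0] with t ht
    have := hmono ht
    simp only [hs0, mul_zero, sub_zero] at this
    simp only [id]
    linarith
  let e := StrictMono.orderIsoOfSurjective s hsm (hsc.surjective htop hbot)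
  have he : ∀ t, s (e.symm t) = t := fun t => e.apply_symm_apply t
  have he0 : e.symm 0 = 0 := by
    rw [e.symm_apply_eq]; exact hs0.symm
  have hepos : ∀ t, 0 ≤ t → 0 ≤ e.symm t := by
    intro t ht
    rw [← he0]; exact e.symm.monotone ht
  refine ⟨fun t => w (e.symm t), ?_, ?_, ?_, ?_⟩
  · intro t ht
    have h1 : HasDerivAt e.symm (ρ (e.symm t))⁻¹ t :=
      HasDerivAt.of_local_left_inverse e.symm.continuous.continuousAt (hs' _) (hρpos _).ne'
        (Eventually.of_forall he)
    have h2 : HasDerivAt w (-((z - q) * Real.exp (-(e.symm t)))) (e.symm t) := by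
      have := (((hasDerivAt_neg (e.symm t)).exp).const_mul (z - q)).const_add q
      refine HasDerivAt.congr_deriv this ?_
      ring
    have h3 := h2.comp t h1
    refine h3.congr_deriv ?_
    have hp := hepos t ht
    rw [hf _ ((hwq _ hp).trans_lt hz)]
    have hmax : max (e.symm t) 0 = e.symm t := max_eq_left hp
    simp only [ρ, hmax, inv_neg, inv_inv]
    simp only [w]
    ring
  · simp [he0, w]
  · intro t ht
    exact hwq _ (hepos t ht)
  · have hwt : Tendsto w atTop (𝓝 q) := by
      have : Tendsto (fun t => q + (z - q) * Real.exp (-t)) atTop (𝓝 (q + (z - q) * 0)) :=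
        (Real.tendsto_exp_neg_atTop_nhds_zero.const_mul _).const_add _
      simpa using this
    exact hwt.comp e.symm.tendsto_atTop

/-! ### Gluing conjugacies of the two half-planes. -/

lemma SendsArcs.comp {h h' : ℝ × ℝ → ℝ × ℝ} {A B C : Set ℝ → (ℝ → ℝ × ℝ) → Prop}
    (h₂ : SendsArcs h' B C) (h₁ : SendsArcs h A B) : SendsArcs (h' ∘ h) A C := by
  intro I γ hγ
  obtain ⟨s, η, hs, hc, hη, e⟩ := h₁ I γ hγ
  obtain ⟨s', η', hs', hc', hη', e'⟩ := h₂ _ η hη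
  refine ⟨s' ∘ s, η', hs'.comp hs (mapsTo_image s I), hc'.comp hc (mapsTo_image s I), ?_, ?_⟩
  · rwa [image_comp]
  · intro t ht
    simp only [Function.comp]
    rw [e t ht, e' _ (mem_image_of_mem s ht)]

/-- A homeomorphism of the closed half-plane `C` that acts on `Σ` by `g` and sends the orbits of
`W` in `C` onto those of `W'`. -/
def HalfConj (C : Set (ℝ × ℝ)) (W W' : ℝ × ℝ → ℝ × ℝ) (g : ℝ ≃o ℝ) : Prop :=
  ∃ F G : ℝ × ℝ → ℝ × ℝ, ContinuousOn F C ∧ ContinuousOn G C ∧ MapsTo F C C ∧ MapsTo G C C ∧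
    LeftInvOn G F C ∧ LeftInvOn F G C ∧ (∀ x, F (x, 0) = (g x, 0)) ∧
    (∀ x, G (x, 0) = (g.symm x, 0)) ∧
    SendsArcs F (IsOrbitArc W C) (IsOrbitArc W' C) ∧
    SendsArcs G (IsOrbitArc W' C) (IsOrbitArc W C)

lemma isClosed_upperHalf : IsClosed upperHalf := isClosed_le continuous_const continuous_snd

lemma isClosed_lowerHalf : IsClosed lowerHalf := isClosed_le continuous_snd continuous_const

/-- The map given by `F` on the upper half-plane and by `G` on the lower one. -/
noncomputable def glueHalves (F G : ℝ × ℝ → ℝ × ℝ) (z : ℝ × ℝ) : ℝ × ℝ :=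
  open Classical in if 0 ≤ z.2 then F z else G z

lemma glueHalves_upper {F G : ℝ × ℝ → ℝ × ℝ} : EqOn (glueHalves F G) F upperHalf :=
  fun _ hz => if_pos hz

lemma glueHalves_lower {F G : ℝ × ℝ → ℝ × ℝ} (h : ∀ x, F (x, 0) = G (x, 0)) :
    EqOn (glueHalves F G) G lowerHalf := by
  rintro ⟨x, y⟩ hz
  by_cases h0 : 0 ≤ y
  · obtain rfl : y = 0 := le_antisymm hz h0
    rw [glueHalves, if_pos le_rfl, h]
  · exact if_neg h0

lemma continuous_glueHalves {F G : ℝ × ℝ → ℝ × ℝ} (hF : ContinuousOn F upperHalf)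
    (hG : ContinuousOn G lowerHalf) (h : ∀ x, F (x, 0) = G (x, 0)) :
    Continuous (glueHalves F G) := by
  rw [← continuousOn_univ, show (univ : Set (ℝ × ℝ)) = upperHalf ∪ lowerHalf by
    ext z; simpa [upperHalf, lowerHalf] using le_total 0 z.2]
  exact (hF.congr glueHalves_upper).union_of_isClosed (hG.congr (glueHalves_lower h))
    isClosed_upperHalf isClosed_lowerHalf

lemma SendsArcs.congr_orbit {h h' : ℝ × ℝ → ℝ × ℝ} {W W' : ℝ × ℝ → ℝ × ℝ} {C C' : Set (ℝ × ℝ)}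
    (hs : SendsArcs h (IsOrbitArc W C) (IsOrbitArc W' C')) (e : EqOn h' h C) :
    SendsArcs h' (IsOrbitArc W C) (IsOrbitArc W' C') := by
  intro I γ hγ
  obtain ⟨s, η, h1, h2, h3, h4⟩ := hs I γ hγ
  exact ⟨s, η, h1, h2, h3, fun t ht => by rw [e (hγ.2 t ht).1, h4 t ht]⟩

lemma SendsArcs.union {h : ℝ × ℝ → ℝ × ℝ} {Z Z' : FilippovSystem}
    (h₁ : SendsArcs h (IsOrbitArc Z.X upperHalf) (IsOrbitArc Z'.X upperHalf))
    (h₂ : SendsArcs h (IsOrbitArc Z.Y lowerHalf) (IsOrbitArc Z'.Y lowerHalf)) :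
    SendsArcs h Z.IsArc Z'.IsArc := by
  rintro I γ (hγ | hγ)
  · obtain ⟨s, η, h1, h2, h3, h4⟩ := h₁ I γ hγ
    exact ⟨s, η, h1, h2, Or.inl h3, h4⟩
  · obtain ⟨s, η, h1, h2, h3, h4⟩ := h₂ I γ hγ
    exact ⟨s, η, h1, h2, Or.inr h3, h4⟩

/-- The two half-plane maps agree with `g` on `Σ` and therefore glue. Sliding orbits only see the
action on `Σ`, hence the hypotheses about every map that restricts to `g` or to its inverse. -/
theorem sigmaEquivalent_of_halfConj {Z Z' : FilippovSystem} {g : ℝ ≃o ℝ}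
    (hU : HalfConj upperHalf Z.X Z'.X g) (hL : HalfConj lowerHalf Z.Y Z'.Y g)
    (hs : ∀ h : ℝ × ℝ → ℝ × ℝ, (∀ x, h (x, 0) = (g x, 0)) →
      SendsArcs h Z.IsSlidingArc Z'.IsSlidingArc)
    (hs' : ∀ h : ℝ × ℝ → ℝ × ℝ, (∀ x, h (x, 0) = (g.symm x, 0)) →
      SendsArcs h Z'.IsSlidingArc Z.IsSlidingArc) : SigmaEquivalent Z Z' := by
  obtain ⟨F, F', h1, h2, h3, h4, h5, h6, h7, h8, h9, h10⟩ := hU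
  obtain ⟨G, G', k1, k2, k3, k4, k5, k6, k7, k8, k9, k10⟩ := hL
  have b : ∀ x, F (x, 0) = G (x, 0) := fun x => by rw [h7, k7]
  have b' : ∀ x, F' (x, 0) = G' (x, 0) := fun x => by rw [h8, k8]
  have hinv : ∀ {F F' G G' : ℝ × ℝ → ℝ × ℝ}, (∀ x, F (x, 0) = G (x, 0)) →
      (∀ x, F' (x, 0) = G' (x, 0)) → MapsTo F upperHalf upperHalf → MapsTo G lowerHalf lowerHalf →
      LeftInvOn F' F upperHalf → LeftInvOn G' G lowerHalf →
      Function.LeftInverse (glueHalves F' G') (glueHalves F G) := by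
    intro F F' G G' b b' m m' l l' z
    rcases le_total 0 z.2 with hz | hz
    · rw [glueHalves_upper (show z ∈ upperHalf from hz), glueHalves_upper (m hz), l hz]
    · rw [glueHalves_lower b (show z ∈ lowerHalf from hz), glueHalves_lower b' (m' hz), l' hz]
  let h : (ℝ × ℝ) ≃ₜ (ℝ × ℝ) :=
    { toFun := glueHalves F G
      invFun := glueHalves F' G'
      left_inv := hinv b b' h3 k3 h5 k5
      right_inv := hinv b' b h4 k4 h6 k6
      continuous_toFun := continuous_glueHalves h1 k1 b
      continuous_invFun := continuous_glueHalves h2 k2 b' }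
  have hx : ∀ x, h (x, 0) = (g x, 0) := fun x =>
    (glueHalves_upper (show ((x, 0) : ℝ × ℝ) ∈ upperHalf from le_refl (0 : ℝ))).trans (h7 x)
  have hx' : ∀ x, h.symm (x, 0) = (g.symm x, 0) := fun x =>
    (glueHalves_upper (show ((x, 0) : ℝ × ℝ) ∈ upperHalf from le_refl (0 : ℝ))).trans (h8 x)
  have hup : ∀ z : ℝ × ℝ, 0 < z.2 → 0 < (h z).2 := by
    intro z hz
    have hz' : h z = F z := glueHalves_upper (show z ∈ upperHalf from hz.le)
    have : 0 ≤ (h z).2 := by rw [hz']; exact h3 (show z ∈ upperHalf from hz.le)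
    refine lt_of_le_of_ne this fun h0 => ?_
    have e : h z = h (g.symm (h z).1, 0) := by
      rw [hx, g.apply_symm_apply]; exact Prod.ext rfl h0.symm
    rw [h.injective e] at hz
    exact lt_irrefl _ hz
  have hlow : ∀ z : ℝ × ℝ, z.2 < 0 → (h z).2 < 0 := by
    intro z hz
    have hz' : h z = G z := glueHalves_lower b (show z ∈ lowerHalf from hz.le)
    have : (h z).2 ≤ 0 := by rw [hz']; exact k3 (show z ∈ lowerHalf from hz.le)
    refine lt_of_le_of_ne this fun h0 => ?_
    have e : h z = h (g.symm (h z).1, 0) := by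
      rw [hx, g.apply_symm_apply]; exact Prod.ext rfl h0
    rw [h.injective e] at hz
    exact lt_irrefl _ hz
  refine ⟨h, preservesOrientation_of_halves h g g.strictMono hx hup hlow, ?_,
    SendsArcs.union (h9.congr_orbit glueHalves_upper) (k9.congr_orbit (glueHalves_lower b)),
    SendsArcs.union (h10.congr_orbit glueHalves_upper) (k10.congr_orbit (glueHalves_lower b')),
    hs h hx, hs' _ hx'⟩
  ext ⟨x, y⟩
  constructor
  · rintro ⟨⟨x', y'⟩, hy', e⟩
    obtain rfl : y' = 0 := hy'
    rw [hx] at e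
    exact (congrArg Prod.snd e).symm
  · intro hy
    obtain rfl : y = 0 := hy
    exact ⟨(g.symm x, 0), rfl, by rw [hx, g.apply_symm_apply]⟩

/-! ### Orbits of the sliding field. -/

/-- An increasing homeomorphism of `Σ` that respects the direction of the sliding fields sends
sliding orbits to sliding orbits. -/
theorem sendsArcs_sliding {Z Z' : FilippovSystem} {S S' : Set ℝ} {f f' ρ τ : ℝ → ℝ} {P Q : ℝ}
    (hS : Z.escapingRegion ∪ Z.slidingRegion = {z | z.2 = 0 ∧ z.1 ∈ S})
    (hS' : Z'.escapingRegion ∪ Z'.slidingRegion = {z | z.2 = 0 ∧ z.1 ∈ S'})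
    (hf : ∀ x ∈ S, Z.slidingField (x, 0) = (f x, 0))
    (hf' : ∀ x ∈ S', Z'.slidingField (x, 0) = (f' x, 0))
    (hfac : ∀ x ∈ S, f x = (x - P) * (x - Q) * ρ x) (hρ : ContinuousOn ρ S)
    (hρ0 : ∀ x ∈ S, ρ x ≠ 0)
    (hτ : ∀ x ∈ S', f' x ≠ 0 → HasDerivAt τ (f' x)⁻¹ x)
    {g : ℝ → ℝ} (hg : StrictMono g) (hgc : Continuous g) (hgS : MapsTo g S S')
    (hsign : ∀ x ∈ S, SignType.sign (f x) = SignType.sign (f' (g x)))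
    {h : ℝ × ℝ → ℝ × ℝ} (hh : ∀ x, h (x, 0) = (g x, 0)) :
    SendsArcs h Z.IsSlidingArc Z'.IsSlidingArc := by
  rintro I γ ⟨hI, hγ⟩
  rw [hS] at hγ
  have hx : ∀ t ∈ I, (γ t).1 ∈ S := fun t ht => (hγ t ht).1.2
  have hγx : ∀ t ∈ I, γ t = ((γ t).1, 0) := fun t ht => Prod.ext rfl (hγ t ht).1.1
  set x : ℝ → ℝ := fun t => (γ t).1 with hxdef
  have hder : ∀ t ∈ I, HasDerivWithinAt x (f (x t)) I t := by
    intro t ht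
    have h1 := (hγ t ht).2
    rw [hγx t ht, hf _ (hx t ht)] at h1
    have := (hasFDerivAt_fst (𝕜 := ℝ) (p := γ t)).comp_hasDerivWithinAt t h1
    exact this
  have hxc : ContinuousOn x I := fun t ht => (hder t ht).continuousWithinAt
  have hρx : ContinuousOn (fun t => ρ (x t)) I := hρ.comp hxc hx
  -- Along a solution each of `x - P` and `x - Q` satisfies a linear equation, so it vanishes
  -- identically or nowhere. A sliding orbit is therefore at rest or strictly monotone.
  have main : (∀ t ∈ I, f (x t) = 0) ∨ (∀ t ∈ I, 0 < f (x t)) ∨ (∀ t ∈ I, f (x t) < 0) := by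
    have hzero : ∀ ρ' : ℝ → ℝ, ∀ c : ℝ, ContinuousOn ρ' I →
        (∀ t ∈ I, f (x t) = (x t - c) * ρ' t) →
        (∀ t ∈ I, x t - c = 0) ∨ (∀ t ∈ I, x t - c ≠ 0) := by
      intro ρ' c hc he
      by_contra! hcon
      obtain ⟨⟨a, ha, ha'⟩, b, hb, hb'⟩ := hcon
      refine ha' (eq_zero_of_linear_ode hI (ψ := fun t => x t - c) (ρ := ρ') hc (fun t ht => ?_)
        hb hb' a ha)
      have := (hder t ht).sub_const c
      rw [he t ht, mul_comm] at this
      exact this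
    have hP := hzero (fun t => (x t - Q) * ρ (x t)) P ((hxc.sub continuousOn_const).mul hρx)
      (fun t ht => by rw [hfac _ (hx t ht)]; ring)
    have hQ := hzero (fun t => (x t - P) * ρ (x t)) Q ((hxc.sub continuousOn_const).mul hρx)
      (fun t ht => by rw [hfac _ (hx t ht)]; ring)
    rcases hP with hP | hP
    · exact Or.inl fun t ht => by rw [hfac _ (hx t ht), hP t ht]; ring
    rcases hQ with hQ | hQ
    · exact Or.inl fun t ht => by rw [hfac _ (hx t ht), hQ t ht]; ring
    right
    have hcont : ContinuousOn (fun t => f (x t)) I := by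
      refine ContinuousOn.congr (f := fun t => (x t - P) * (x t - Q) * ρ (x t)) ?_
        (fun t ht => hfac _ (hx t ht))
      exact ((hxc.sub continuousOn_const).mul (hxc.sub continuousOn_const)).mul hρx
    refine ne_zero_sign_const hI hcont fun t ht => ?_
    rw [hfac _ (hx t ht)]
    exact mul_ne_zero (mul_ne_zero (hP t ht) (hQ t ht)) (hρ0 _ (hx t ht))
  have hhx : ∀ t ∈ I, h (γ t) = (g (x t), 0) := fun t ht => by rw [hγx t ht, hh]
  have hwc : ContinuousOn (fun t => g (x t)) I := hgc.comp_continuousOn hxc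
  rcases main with h0 | hsgn
  · refine ⟨id, fun t => h (γ t), strictMonoOn_id, continuousOn_id, ⟨by simpa using hI, ?_⟩,
      fun t _ => rfl⟩
    rw [hS', image_id]
    intro t ht
    have hconst : ∀ t' ∈ I, x t' = x t := by
      intro t' ht'
      have hd : ∀ s ∈ I, HasDerivWithinAt x 0 I s := fun s hs => by
        have := hder s hs
        rwa [h0 s hs] at this
      have hb := Convex.norm_image_sub_le_of_norm_hasDerivWithin_le (C := 0) hd
        (fun s _ => by simp) hI.convex ht ht'
      rw [zero_mul, norm_le_zero_iff, sub_eq_zero] at hb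
      exact hb
    have h0' : f' (g (x t)) = 0 := by
      have := hsign _ (hx t ht)
      rw [h0 t ht, sign_zero] at this
      exact sign_eq_zero_iff.1 this.symm
    beta_reduce
    refine ⟨by rw [hhx t ht]; exact ⟨rfl, hgS (hx t ht)⟩, ?_⟩
    rw [hhx t ht, hf' _ (hgS (hx t ht)), h0']
    refine (hasDerivWithinAt_const t I ((g (x t), 0) : ℝ × ℝ)).congr (fun t' ht' => ?_) (hhx t ht)
    rw [hhx t' ht', hconst t' ht']
  · have hm : (StrictMonoOn (fun t => g (x t)) I ∧ ∀ t ∈ I, 0 < f' (g (x t))) ∨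
        (StrictAntiOn (fun t => g (x t)) I ∧ ∀ t ∈ I, f' (g (x t)) < 0) := by
      have hint : ∀ t ∈ interior I, HasDerivAt x (f (x t)) t := fun t ht =>
        (hder t (interior_subset ht)).hasDerivAt (mem_interior_iff_mem_nhds.1 ht)
      rcases hsgn with hp | hn
      · refine Or.inl ⟨hg.comp_strictMonoOn ?_, fun t ht => ?_⟩
        · refine strictMonoOn_of_deriv_pos hI.convex hxc fun t ht => ?_
          rw [(hint t ht).deriv]
          exact hp t (interior_subset ht)
        · have := hsign _ (hx t ht)
          rw [sign_pos (hp t ht)] at this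
          exact sign_eq_one_iff.1 this.symm
      · refine Or.inr ⟨hg.comp_strictAntiOn ?_, fun t ht => ?_⟩
        · refine strictAntiOn_of_deriv_neg hI.convex hxc fun t ht => ?_
          rw [(hint t ht).deriv]
          exact hn t (interior_subset ht)
        · have := hsign _ (hx t ht)
          rw [sign_neg (hn t ht)] at this
          exact sign_eq_neg_one_iff.1 this.symm
    have hne : ∀ t ∈ I, f' (g (x t)) ≠ 0 := by
      rcases hm with hm | hm
      · exact fun t ht => (hm.2 t ht).ne'
      · exact fun t ht => (hm.2 t ht).ne
    obtain ⟨η, h1, h2, h3, h4⟩ := exists_timeChange hI hwc hm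
      (fun t ht => hτ _ (hgS (hx t ht)) (hne t ht))
    refine ⟨τ ∘ fun t => g (x t), fun s => (η s, 0), h1, h2,
      ⟨(hI.isPreconnected.image _ h2).ordConnected, ?_⟩, ?_⟩
    · rintro _ ⟨t, ht, rfl⟩
      rw [hS']
      simp only [Function.comp, h4 t ht]
      refine ⟨⟨rfl, hgS (hx t ht)⟩, ?_⟩
      rw [hf' _ (hgS (hx t ht))]
      exact (h3 t ht).prodMk (hasDerivWithinAt_const _ _ _)
    · intro t ht
      simp only [Function.comp]
      rw [hhx t ht, h4 t ht]

/-! ### The visible fold in the upper half-plane. -/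

/-- For `y ≥ 0`, the signed abscissa (relative to the fold) of the point where the orbit of the
visible fold through `(ξ, y)` meets `y = 0`; it is `0` on the orbits that do not cross `y = 0`. -/
noncomputable def foldBase (ξ y : ℝ) : ℝ :=
  max (min ξ (Real.sqrt (ξ ^ 2 - 2 * y))) (-Real.sqrt (ξ ^ 2 - 2 * y))

lemma continuous_foldBase : Continuous fun z : ℝ × ℝ => foldBase z.1 z.2 := by
  unfold foldBase
  fun_prop

lemma foldBase_of_nonpos {ξ y : ℝ} (h : ξ ^ 2 ≤ 2 * y) : foldBase ξ y = 0 := by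
  rw [foldBase, Real.sqrt_eq_zero_of_nonpos (by linarith)]
  simp

/-- Coordinates adapted to the orbits: `e` is the base point relative to the fold and `d` the signed
time elapsed since the base, as the horizontal speed is `1`. An orbit leaves `Σ` away from the fold,
so `d` and `e` do not have opposite signs. -/
lemma foldBase_eq {e d : ℝ} (h : 0 ≤ d * e) (h0 : e ≠ 0) :
    foldBase (e + d) (d * (d + 2 * e) / 2) = e := by
  have hs : (e + d) ^ 2 - 2 * (d * (d + 2 * e) / 2) = e ^ 2 := by ring
  rw [foldBase, hs, Real.sqrt_sq_eq_abs]
  rcases lt_or_gt_of_ne h0 with he | he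
  · have hd : d ≤ 0 := by
      by_contra hd
      have := mul_neg_of_pos_of_neg (not_le.1 hd) he
      linarith
    rw [abs_of_neg he, min_eq_left (by linarith), neg_neg, max_eq_right (by linarith)]
  · have hd : 0 ≤ d := by
      by_contra hd
      have := mul_neg_of_neg_of_pos (not_le.1 hd) he
      linarith
    rw [abs_of_pos he, min_eq_right (by linarith), max_eq_left (by linarith)]

lemma foldBase_spec {ξ y : ℝ} (hy : 0 ≤ y) (h : 2 * y < ξ ^ 2) :
    foldBase ξ y ≠ 0 ∧ 0 ≤ (ξ - foldBase ξ y) * foldBase ξ y ∧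
      y = (ξ - foldBase ξ y) * ((ξ - foldBase ξ y) + 2 * foldBase ξ y) / 2 := by
  set b := Real.sqrt (ξ ^ 2 - 2 * y) with hb
  have hbpos : 0 < b := Real.sqrt_pos.2 (by linarith)
  have hb2 : b ^ 2 = ξ ^ 2 - 2 * y := Real.sq_sqrt (by linarith)
  have habs : b ≤ |ξ| := by
    rw [← abs_of_pos hbpos, ← sq_le_sq]; linarith
  rcases le_total 0 ξ with hξ | hξ
  · rw [abs_of_nonneg hξ] at habs
    have e : foldBase ξ y = b := by
      rw [foldBase, ← hb, min_eq_right habs, max_eq_left (by linarith)]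
    rw [e]
    exact ⟨hbpos.ne', mul_nonneg (by linarith) hbpos.le, by nlinarith⟩
  · rw [abs_of_nonpos hξ] at habs
    have e : foldBase ξ y = -b := by
      rw [foldBase, ← hb, min_eq_left (by linarith), max_eq_right (by linarith)]
    rw [e]
    exact ⟨by linarith, by nlinarith, by nlinarith⟩

lemma foldBase_zero (ξ : ℝ) : foldBase ξ 0 = ξ := by
  rcases eq_or_ne ξ 0 with rfl | h
  · exact foldBase_of_nonpos (by simp)
  · simpa using foldBase_eq (e := ξ) (d := 0) (by simp) h

/-- The extension to `y ≥ 0` of the boundary map `g`, along the orbits of the visible fold. -/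
noncomputable def foldExt (l l' : ℝ) (g : ℝ → ℝ) (z : ℝ × ℝ) : ℝ × ℝ :=
  (l' + (z.1 - l) + (g (l + foldBase (z.1 - l) z.2) - l' - foldBase (z.1 - l) z.2),
    z.2 + (z.1 - l - foldBase (z.1 - l) z.2) *
      (g (l + foldBase (z.1 - l) z.2) - l' - foldBase (z.1 - l) z.2))

lemma continuous_foldExt {l l' : ℝ} {g : ℝ → ℝ} (hg : Continuous g) :
    Continuous (foldExt l l' g) := by
  have h1 : Continuous fun z : ℝ × ℝ => foldBase (z.1 - l) z.2 :=
    continuous_foldBase.comp (by fun_prop : Continuous fun z : ℝ × ℝ => (z.1 - l, z.2))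
  unfold foldExt
  fun_prop

/-- In the coordinates `(e, d)` the map keeps `d` and replaces `e` by `g (l + e) - l'`. Where the
base is `0` it is the translation by `l' - l`, because `g l = l'`. -/
lemma foldExt_spec {l l' : ℝ} {g : ℝ → ℝ} (hg : StrictMono g) (hgl : g l = l') {z : ℝ × ℝ}
    (hz : 0 ≤ z.2) : 0 ≤ (foldExt l l' g z).2 ∧
      foldBase ((foldExt l l' g z).1 - l') (foldExt l l' g z).2 =
        g (l + foldBase (z.1 - l) z.2) - l' := by
  rcases le_or_gt ((z.1 - l) ^ 2) (2 * z.2) with h | h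
  · have e : foldBase (z.1 - l) z.2 = 0 := foldBase_of_nonpos h
    have e1 : foldExt l l' g z = (l' + (z.1 - l), z.2) := by
      simp [foldExt, e, hgl]
    rw [e1, e]
    refine ⟨hz, ?_⟩
    simp only [add_sub_cancel_left, add_zero, hgl, sub_self]
    exact foldBase_of_nonpos h
  · obtain ⟨h0, hd, hy⟩ := foldBase_spec hz h
    set e := foldBase (z.1 - l) z.2 with he
    set d := z.1 - l - e with hdd
    set e' := g (l + e) - l' with he'
    have e1 : foldExt l l' g z = (l' + (e' + d), d * (d + 2 * e') / 2) := by
      rw [foldExt, ← he]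
      refine Prod.ext ?_ ?_
      · simp only [he', hdd]; ring
      · simp only
        rw [← he', ← hdd]
        linear_combination hy
    have hd' : 0 ≤ d * e' ∧ e' ≠ 0 := by
      rcases lt_or_gt_of_ne h0 with h1 | h1
      · have h2 : e' < 0 := by
          have := hg (show l + e < l by linarith)
          rw [hgl] at this; linarith
        have h3 : d ≤ 0 := by
          by_contra h3
          have := mul_neg_of_pos_of_neg (not_le.1 h3) h1
          linarith
        exact ⟨mul_nonneg_of_nonpos_of_nonpos h3 h2.le, h2.ne⟩
      · have h2 : 0 < e' := by
          have := hg (show l < l + e by linarith)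
          rw [hgl] at this; linarith
        have h3 : 0 ≤ d := by
          by_contra h3
          have := mul_neg_of_neg_of_pos (not_le.1 h3) h1
          linarith
        exact ⟨mul_nonneg h3 h2.le, h2.ne'⟩
    rw [e1]
    constructor
    · simp only
      nlinarith [sq_nonneg d]
    · simp only [add_sub_cancel_left]
      exact foldBase_eq hd'.1 hd'.2

lemma foldExt_leftInverse {l l' : ℝ} {g : ℝ ≃o ℝ} (hgl : g l = l') {z : ℝ × ℝ} (hz : 0 ≤ z.2) :
    foldExt l' l g.symm (foldExt l l' g z) = z := by
  obtain ⟨-, h2⟩ := foldExt_spec g.strictMono hgl hz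
  have h3 : g.symm (l' + foldBase ((foldExt l l' g z).1 - l') (foldExt l l' g z).2) =
      l + foldBase (z.1 - l) z.2 := by
    rw [h2, add_sub_cancel, g.symm_apply_apply]
  rw [foldExt, h3, h2]
  simp only [foldExt]
  refine Prod.ext ?_ ?_
  · simp only; ring
  · simp only; ring

lemma foldExt_boundary {l l' : ℝ} {g : ℝ → ℝ} (x : ℝ) : foldExt l l' g (x, 0) = (g x, 0) := by
  simp [foldExt, foldBase_zero]

/-- The base is constant along an arc, and for a fixed base the map carries orbits to orbits with
the same time. -/
lemma foldExt_sendsArcs {l l' : ℝ} {g : ℝ → ℝ} (hg : StrictMono g) (hgl : g l = l') :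
    SendsArcs (foldExt l l' g) (IsOrbitArc (fun z => (1, z.1 - l)) upperHalf)
      (IsOrbitArc (fun z => (1, z.1 - l')) upperHalf) := by
  rintro I γ ⟨hI, hγ⟩
  have hx : ∀ t ∈ I, HasDerivWithinAt (fun t => (γ t).1) 1 I t := fun t ht =>
    (hasFDerivAt_fst (𝕜 := ℝ) (p := γ t)).comp_hasDerivWithinAt t (hγ t ht).2
  have hy : ∀ t ∈ I, HasDerivWithinAt (fun t => (γ t).2) ((γ t).1 - l) I t := fun t ht =>
    (hasFDerivAt_snd (𝕜 := ℝ) (p := γ t)).comp_hasDerivWithinAt t (hγ t ht).2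
  have hconst : ∀ a ∈ I, ∀ b ∈ I, ((γ a).1 - l) ^ 2 - 2 * (γ a).2 =
      ((γ b).1 - l) ^ 2 - 2 * (γ b).2 := by
    intro a ha b hb
    have hd : ∀ t ∈ I, HasDerivWithinAt (fun t => ((γ t).1 - l) ^ 2 - 2 * (γ t).2) 0 I t := by
      intro t ht
      have := (((hx t ht).sub_const l).pow 2).sub ((hy t ht).const_mul 2)
      refine this.congr_deriv ?_
      push_cast; ring
    have hb' := Convex.norm_image_sub_le_of_norm_hasDerivWithin_le (C := 0) hd
      (fun s _ => by simp) hI.convex hb ha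
    rw [zero_mul, norm_le_zero_iff, sub_eq_zero] at hb'
    exact hb'
  have hbase : ∀ a ∈ I, ∀ b ∈ I, foldBase ((γ a).1 - l) (γ a).2 =
      foldBase ((γ b).1 - l) (γ b).2 := by
    intro a ha b hb
    rcases le_or_gt (((γ a).1 - l) ^ 2) (2 * (γ a).2) with h | h
    · rw [foldBase_of_nonpos h, foldBase_of_nonpos]
      linarith [hconst a ha b hb]
    -- Below the orbit of the fold an arc cannot cross the vertical line through the fold. It stays
    -- on one branch of its parabola, so the sign of the base is constant.
    · have hne : ∀ t ∈ I, (γ t).1 - l ≠ 0 := by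
        intro t ht h0
        have h1 := hconst a ha t ht
        have h2 : 0 ≤ (γ t).2 := (hγ t ht).1
        rw [h0] at h1
        nlinarith
      have hc : ContinuousOn (fun t => (γ t).1 - l) I := fun t ht =>
        ((hx t ht).sub_const l).continuousWithinAt
      simp only [foldBase, hconst a ha b hb]
      set s := Real.sqrt (((γ b).1 - l) ^ 2 - 2 * (γ b).2) with hs
      have hs0 : 0 ≤ s := Real.sqrt_nonneg _
      have hsabs : ∀ t ∈ I, s ≤ |(γ t).1 - l| := by
        intro t ht
        rw [hs, ← hconst t ht b hb]
        apply Real.sqrt_le_iff.2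
        have : 0 ≤ (γ t).2 := (hγ t ht).1
        exact ⟨abs_nonneg _, by rw [sq_abs]; linarith⟩
      have sa := hsabs a ha
      have sb := hsabs b hb
      rcases ne_zero_sign_const hI hc hne with hp | hn
      · have pa := hp a ha
        have pb := hp b hb
        rw [abs_of_pos pa] at sa
        rw [abs_of_pos pb] at sb
        rw [min_eq_right sa, min_eq_right sb]
      · have pa := hn a ha
        have pb := hn b hb
        rw [abs_of_neg pa] at sa
        rw [abs_of_neg pb] at sb
        rw [min_eq_left (by linarith), min_eq_left (by linarith), max_eq_right (by linarith),
          max_eq_right (by linarith)]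
  refine ⟨id, fun t => foldExt l l' g (γ t), strictMonoOn_id, continuousOn_id,
    ⟨by simpa using hI, ?_⟩, fun t _ => rfl⟩
  rw [image_id]
  intro t ht
  refine ⟨(foldExt_spec hg hgl (hγ t ht).1).1, ?_⟩
  set e := foldBase ((γ t).1 - l) (γ t).2 with he
  set k := g (l + e) - l' - e with hk
  have h1 : HasDerivWithinAt (fun t => ((l' + ((γ t).1 - l) + k,
      (γ t).2 + ((γ t).1 - l - e) * k) : ℝ × ℝ)) (1, (γ t).1 - l + 1 * k) I t :=
    ((((hx t ht).sub_const l).const_add l').add_const k).prodMk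
      ((hy t ht).add ((((hx t ht).sub_const l).sub_const e).mul_const k))
  have hval : ∀ t' ∈ I, foldExt l l' g (γ t') =
      (l' + ((γ t').1 - l) + k, (γ t').2 + ((γ t').1 - l - e) * k) := by
    intro t' ht'
    rw [foldExt, hbase t' ht' t ht]
  refine (h1.congr hval (hval t ht)).congr_deriv ?_
  beta_reduce
  rw [hval t ht]
  refine Prod.ext rfl ?_
  simp only
  ring

theorem halfConj_upper {μ l l' b b' : ℝ} {g : ℝ ≃o ℝ} (hgl : g l = l') :
    HalfConj upperHalf (foldSaddleFamily .vis μ (l, b)).X (foldSaddleFamily .vis μ (l', b')).X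
      g := by
  have hX : ∀ l b : ℝ, (foldSaddleFamily .vis μ (l, b)).X = fun z => (1, z.1 - l) := by
    intro l b
    funext z
    simp [foldSaddleFamily, FoldType.coeffOne, FoldType.coeffTwo]
  have hgl' : g.symm l' = l := by rw [← hgl, g.symm_apply_apply]
  rw [hX, hX]
  refine ⟨foldExt l l' g, foldExt l' l g.symm, (continuous_foldExt g.continuous).continuousOn,
    (continuous_foldExt g.symm.continuous).continuousOn,
    fun z hz => (foldExt_spec g.strictMono hgl hz).1,
    fun z hz => (foldExt_spec g.symm.strictMono hgl' hz).1,
    fun z hz => foldExt_leftInverse hgl hz,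
    fun z hz => ?_, foldExt_boundary, foldExt_boundary,
    foldExt_sendsArcs g.strictMono hgl, foldExt_sendsArcs g.symm.strictMono hgl'⟩
  simpa using foldExt_leftInverse (g := g.symm) hgl' hz

/-! ### The linear saddle in the coordinates along its axes. -/

/-- The half-plane `v - u ≤ β` in the coordinates `(u, v)` along the axes of the saddle. -/
def saddleHalf (β : ℝ) : Set (ℝ × ℝ) := {z | z.2 - z.1 ≤ β}

/-- The point of the boundary line `v - u = β` with `u + v = x`. -/
noncomputable def saddleBoundary (β x : ℝ) : ℝ × ℝ := ((x - β) / 2, (x + β) / 2)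

/-- The orbit `(u₀ e^t, v₀ e^{-ct})` of the linear saddle `(u, -cv)`. -/
noncomputable def saddleOrbit (c : ℝ) (z : ℝ × ℝ) (t : ℝ) : ℝ × ℝ :=
  (z.1 * Real.exp t, z.2 * Real.exp (-c * t))

/-- Arcs of orbits of the saddle `(u, -cv)` in the half-plane `v - u ≤ β`. -/
def IsSaddleArc (c β : ℝ) (I : Set ℝ) (γ : ℝ → ℝ × ℝ) : Prop :=
  I.OrdConnected ∧ ∃ z₀, ∀ t ∈ I, γ t = saddleOrbit c z₀ t ∧ γ t ∈ saddleHalf β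

/-- The analogue of `HalfConj` for linear saddles in the coordinates along their axes. -/
def SaddleConj (c β β' : ℝ) (g : ℝ ≃o ℝ) : Prop :=
  ∃ F G : ℝ × ℝ → ℝ × ℝ, ContinuousOn F (saddleHalf β) ∧ ContinuousOn G (saddleHalf β') ∧
    MapsTo F (saddleHalf β) (saddleHalf β') ∧ MapsTo G (saddleHalf β') (saddleHalf β) ∧
    LeftInvOn G F (saddleHalf β) ∧ LeftInvOn F G (saddleHalf β') ∧
    (∀ x, F (saddleBoundary β x) = saddleBoundary β' (g x)) ∧
    (∀ x, G (saddleBoundary β' x) = saddleBoundary β (g.symm x)) ∧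
    SendsArcs F (IsSaddleArc c β) (IsSaddleArc c β') ∧
    SendsArcs G (IsSaddleArc c β') (IsSaddleArc c β)

lemma SaddleConj.trans {c β β' β'' : ℝ} {g g' : ℝ ≃o ℝ} (h : SaddleConj c β β' g)
    (h' : SaddleConj c β' β'' g') : SaddleConj c β β'' (g.trans g') := by
  obtain ⟨F, G, h1, h2, h3, h4, h5, h6, h7, h8, h9, h10⟩ := h
  obtain ⟨F', G', k1, k2, k3, k4, k5, k6, k7, k8, k9, k10⟩ := h'
  refine ⟨F' ∘ F, G ∘ G', k1.comp h1 h3, h2.comp k2 k4, k3.comp h3, h4.comp k4, ?_, ?_, ?_, ?_,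
    k9.comp h9, h10.comp k10⟩
  · intro z hz
    simp only [Function.comp, k5 (h3 hz), h5 hz]
  · intro z hz
    simp only [Function.comp, h6 (k4 hz), k6 hz]
  · intro x; simp [h7, k7]
  · intro x; simp [h8, k8]

lemma SaddleConj.symm {c β β' : ℝ} {g : ℝ ≃o ℝ} (h : SaddleConj c β β' g) :
    SaddleConj c β' β g.symm := by
  obtain ⟨F, G, h1, h2, h3, h4, h5, h6, h7, h8, h9, h10⟩ := h
  exact ⟨G, F, h2, h1, h4, h3, h6, h5, h8, h7, h10, h9⟩

/-- A linear equation `ψ' = a ψ` has only the exponential solutions. -/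
lemma eq_exp_of_linear_ode {I : Set ℝ} (hI : I.OrdConnected) {ψ : ℝ → ℝ} {a : ℝ}
    (hψ : ∀ t ∈ I, HasDerivWithinAt ψ (a * ψ t) I t) : ∃ k, ∀ t ∈ I, ψ t = k * Real.exp (a * t) := by
  rcases I.eq_empty_or_nonempty with rfl | ⟨t₀, ht₀⟩
  · exact ⟨0, by simp⟩
  refine ⟨ψ t₀ * Real.exp (-(a * t₀)), fun t ht => ?_⟩
  have hd : ∀ s ∈ I, HasDerivWithinAt (fun s => ψ s * Real.exp (-(a * s))) 0 I s := by
    intro s hs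
    have h1 : HasDerivAt (fun s => Real.exp (-(a * s))) (Real.exp (-(a * s)) * -(a * 1)) s :=
      ((hasDerivAt_id s).const_mul a).neg.exp
    refine ((hψ s hs).mul h1.hasDerivWithinAt).congr_deriv ?_
    ring
  have hb := Convex.norm_image_sub_le_of_norm_hasDerivWithin_le (C := 0) hd
    (fun s _ => by simp) hI.convex ht₀ ht
  rw [zero_mul, norm_le_zero_iff, sub_eq_zero] at hb
  rw [← hb, mul_assoc, ← Real.exp_add]
  simp

lemma hasDerivAt_saddleOrbit (c : ℝ) (z : ℝ × ℝ) (t : ℝ) :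
    HasDerivAt (saddleOrbit c z) ((saddleOrbit c z t).1, -c * (saddleOrbit c z t).2) t := by
  have h1 : HasDerivAt (fun t => z.1 * Real.exp t) (z.1 * Real.exp t) t :=
    (Real.hasDerivAt_exp t).const_mul _
  have h2 : HasDerivAt (fun t => z.2 * Real.exp (-c * t))
      (z.2 * (Real.exp (-c * t) * (-c * 1))) t :=
    (((hasDerivAt_id t).const_mul (-c)).exp).const_mul _
  refine (h1.prodMk h2).congr_deriv (Prod.ext rfl ?_)
  simp only [saddleOrbit]
  ring

/-- The coordinates along the axes of the saddle `(0, -β)`. -/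
noncomputable def toSaddle (β : ℝ) (z : ℝ × ℝ) : ℝ × ℝ :=
  ((z.1 - z.2 - β) / 2, (z.1 + z.2 + β) / 2)

/-- The inverse of `toSaddle`. -/
noncomputable def ofSaddle (β : ℝ) (z : ℝ × ℝ) : ℝ × ℝ := (z.1 + z.2, z.2 - z.1 - β)

lemma ofSaddle_toSaddle (β : ℝ) (z : ℝ × ℝ) : ofSaddle β (toSaddle β z) = z := by
  refine Prod.ext ?_ ?_ <;> simp only [ofSaddle, toSaddle] <;> ring

lemma toSaddle_ofSaddle (β : ℝ) (z : ℝ × ℝ) : toSaddle β (ofSaddle β z) = z := by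
  refine Prod.ext ?_ ?_ <;> simp only [ofSaddle, toSaddle] <;> ring

lemma continuous_toSaddle (β : ℝ) : Continuous (toSaddle β) := by unfold toSaddle; fun_prop

lemma continuous_ofSaddle (β : ℝ) : Continuous (ofSaddle β) := by unfold ofSaddle; fun_prop

lemma toSaddle_mem {β : ℝ} {z : ℝ × ℝ} : toSaddle β z ∈ saddleHalf β ↔ z ∈ lowerHalf := by
  simp only [toSaddle, saddleHalf, lowerHalf, mem_ofPred_eq]
  constructor <;> intro h <;> linarith

lemma ofSaddle_mem {β : ℝ} {z : ℝ × ℝ} : ofSaddle β z ∈ lowerHalf ↔ z ∈ saddleHalf β := by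
  rw [← toSaddle_mem (β := β), toSaddle_ofSaddle]

lemma toSaddle_boundary (β x : ℝ) : toSaddle β (x, 0) = saddleBoundary β x := by
  simp [toSaddle, saddleBoundary]

lemma ofSaddle_boundary (β x : ℝ) : ofSaddle β (saddleBoundary β x) = (x, 0) := by
  rw [← toSaddle_boundary, ofSaddle_toSaddle]

/-- The new coordinates decouple the field, with eigenvalues `1` and `-(1 - μ)`, so that arcs become
explicit exponentials. -/
lemma isOrbitArc_lower_iff {μ l β : ℝ} {I : Set ℝ} {γ : ℝ → ℝ × ℝ} :
    IsOrbitArc (foldSaddleFamily .vis μ (l, β)).Y lowerHalf I γ ↔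
      IsSaddleArc (1 - μ) β I fun t => toSaddle β (γ t) := by
  constructor
  · rintro ⟨hI, hγ⟩
    have hx : ∀ t ∈ I, HasDerivWithinAt (fun t => (γ t).1)
        (μ / 2 * (γ t).1 + (μ - 2) / 2 * ((γ t).2 + β)) I t := fun t ht =>
      (hasFDerivAt_fst (𝕜 := ℝ) (p := γ t)).comp_hasDerivWithinAt t (hγ t ht).2
    have hy : ∀ t ∈ I, HasDerivWithinAt (fun t => (γ t).2)
        ((μ - 2) / 2 * (γ t).1 + μ / 2 * ((γ t).2 + β)) I t := fun t ht =>
      (hasFDerivAt_snd (𝕜 := ℝ) (p := γ t)).comp_hasDerivWithinAt t (hγ t ht).2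
    obtain ⟨u, hu⟩ := eq_exp_of_linear_ode hI (ψ := fun t => ((γ t).1 - (γ t).2 - β) / 2) (a := 1)
      (fun t ht => by
        refine ((((hx t ht).sub (hy t ht)).sub_const β).div_const 2).congr_deriv ?_
        ring)
    obtain ⟨v, hv⟩ := eq_exp_of_linear_ode hI (ψ := fun t => ((γ t).1 + (γ t).2 + β) / 2)
      (a := -(1 - μ))
      (fun t ht => by
        refine ((((hx t ht).add (hy t ht)).add_const β).div_const 2).congr_deriv ?_
        ring)
    refine ⟨hI, (u, v), fun t ht => ⟨?_, toSaddle_mem.2 (hγ t ht).1⟩⟩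
    have h1 := hu t ht
    have h2 := hv t ht
    rw [one_mul] at h1
    exact Prod.ext h1 h2
  · rintro ⟨hI, z₀, hz⟩
    have hval : ∀ t ∈ I, γ t = ofSaddle β (saddleOrbit (1 - μ) z₀ t) := fun t ht => by
      rw [← (hz t ht).1, ofSaddle_toSaddle]
    refine ⟨hI, fun t ht => ⟨toSaddle_mem.1 (hz t ht).2, ?_⟩⟩
    have h0 := (hasDerivAt_saddleOrbit (1 - μ) z₀ t).hasDerivWithinAt (s := I)
    have h1 : HasDerivWithinAt (fun t => (saddleOrbit (1 - μ) z₀ t).1) _ I t :=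
      (hasFDerivAt_fst (𝕜 := ℝ) (p := saddleOrbit (1 - μ) z₀ t)).comp_hasDerivWithinAt t h0
    have h2 : HasDerivWithinAt (fun t => (saddleOrbit (1 - μ) z₀ t).2) _ I t :=
      (hasFDerivAt_snd (𝕜 := ℝ) (p := saddleOrbit (1 - μ) z₀ t)).comp_hasDerivWithinAt t h0
    have h3 := (h1.add h2).prodMk ((h2.sub h1).sub_const β)
    refine (h3.congr hval (hval t ht)).congr_deriv ?_
    rw [hval t ht]
    refine Prod.ext ?_ ?_
    · simp [foldSaddleFamily, ofSaddle]; ring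
    · simp [foldSaddleFamily, ofSaddle]; ring

lemma SaddleConj.halfConj {μ l l' β β' : ℝ} {g : ℝ ≃o ℝ} (h : SaddleConj (1 - μ) β β' g) :
    HalfConj lowerHalf (foldSaddleFamily .vis μ (l, β)).Y (foldSaddleFamily .vis μ (l', β')).Y
      g := by
  have hsend : ∀ {l l' β β' : ℝ} {F : ℝ × ℝ → ℝ × ℝ},
      SendsArcs F (IsSaddleArc (1 - μ) β) (IsSaddleArc (1 - μ) β') →
      SendsArcs (fun z => ofSaddle β' (F (toSaddle β z)))
        (IsOrbitArc (foldSaddleFamily .vis μ (l, β)).Y lowerHalf)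
        (IsOrbitArc (foldSaddleFamily .vis μ (l', β')).Y lowerHalf) := by
    intro l l' β β' F hF I γ hγ
    obtain ⟨s, η, h1, h2, h3, h4⟩ := hF I _ (isOrbitArc_lower_iff.1 hγ)
    refine ⟨s, fun t => ofSaddle β' (η t), h1, h2, isOrbitArc_lower_iff.2 ?_, fun t ht => ?_⟩
    · simpa only [toSaddle_ofSaddle] using h3
    · beta_reduce
      rw [h4 t ht]
  obtain ⟨F, G, h1, h2, h3, h4, h5, h6, h7, h8, h9, h10⟩ := h
  refine ⟨fun z => ofSaddle β' (F (toSaddle β z)), fun z => ofSaddle β (G (toSaddle β' z)),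
    ?_, ?_, ?_, ?_, ?_, ?_, ?_, ?_, hsend h9, hsend h10⟩
  · exact (continuous_ofSaddle β').comp_continuousOn
      (h1.comp (continuous_toSaddle β).continuousOn fun z hz => toSaddle_mem.2 hz)
  · exact (continuous_ofSaddle β).comp_continuousOn
      (h2.comp (continuous_toSaddle β').continuousOn fun z hz => toSaddle_mem.2 hz)
  · exact fun z hz => ofSaddle_mem.2 (h3 (toSaddle_mem.2 hz))
  · exact fun z hz => ofSaddle_mem.2 (h4 (toSaddle_mem.2 hz))
  · intro z hz
    simp only [toSaddle_ofSaddle, h5 (toSaddle_mem.2 hz), ofSaddle_toSaddle]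
  · intro z hz
    simp only [toSaddle_ofSaddle, h6 (toSaddle_mem.2 hz), ofSaddle_toSaddle]
  · intro x
    simp only [toSaddle_boundary, h7, ofSaddle_boundary]
  · intro x
    simp only [toSaddle_boundary, h8, ofSaddle_boundary]

/-- A homothety commutes with the linear flow. It reduces the comparison of two values of `β` of the
same sign to a single half-plane. -/
lemma saddleConj_smul {c β k : ℝ} (hk : 0 < k) :
    SaddleConj c β (k * β) (OrderIso.mulLeft₀ k hk) := by
  have hmaps : ∀ {k β : ℝ}, 0 < k → MapsTo (fun z : ℝ × ℝ => k • z) (saddleHalf β)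
      (saddleHalf (k * β)) := by
    intro k β hk z hz
    have : z.2 - z.1 ≤ β := hz
    have := mul_le_mul_of_nonneg_left this hk.le
    simp only [saddleHalf, mem_ofPred_eq, Prod.smul_fst, Prod.smul_snd, smul_eq_mul]
    linarith
  have hsend : ∀ {k β : ℝ}, 0 < k → SendsArcs (fun z : ℝ × ℝ => k • z) (IsSaddleArc c β)
      (IsSaddleArc c (k * β)) := by
    rintro k β hk I γ ⟨hI, z₀, hz⟩
    refine ⟨id, fun t => k • γ t, strictMonoOn_id, continuousOn_id, ⟨by simpa using hI, k • z₀, ?_⟩,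
      fun t _ => rfl⟩
    rw [image_id]
    intro t ht
    refine ⟨?_, hmaps hk (hz t ht).2⟩
    beta_reduce
    rw [(hz t ht).1]
    refine Prod.ext ?_ ?_ <;> simp [saddleOrbit, mul_assoc]
  have hkb : k⁻¹ * (k * β) = β := by field_simp
  have e1 := hmaps (β := k * β) (inv_pos.2 hk)
  have e2 := hsend (β := k * β) (inv_pos.2 hk)
  rw [hkb] at e1 e2
  refine ⟨fun z => k • z, fun z => k⁻¹ • z, by fun_prop, by fun_prop, hmaps hk, e1, ?_, ?_, ?_, ?_,
    hsend hk, e2⟩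
  · intro z _; simp [smul_smul, hk.ne']
  · intro z _; simp [smul_smul, hk.ne']
  · intro x
    refine Prod.ext ?_ ?_ <;> simp [saddleBoundary] <;> ring
  · intro x
    have hs : (OrderIso.mulLeft₀ k hk).symm x = k⁻¹ * x := by
      rw [OrderIso.symm_apply_eq]; simp [hk.ne']
    rw [hs]
    refine Prod.ext ?_ ?_ <;> simp [saddleBoundary] <;> field_simp

/-- The order isomorphism `x ↦ -g (-x)`. -/
def negConj (g : ℝ ≃o ℝ) : ℝ ≃o ℝ where
  toFun x := -g (-x)
  invFun x := -g.symm (-x)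
  left_inv x := by simp
  right_inv x := by simp
  map_rel_iff' := by simp

@[simp] lemma negConj_apply (g : ℝ ≃o ℝ) (x : ℝ) : negConj g x = -g (-x) := rfl

@[simp] lemma negConj_symm_apply (g : ℝ ≃o ℝ) (x : ℝ) : (negConj g).symm x = -g.symm (-x) := rfl

/-- The reflection `(u, v) ↦ (-v, -u)` reverses time and exchanges the axes. -/
lemma SaddleConj.reflect {c β β' : ℝ} (hc : 0 < c) {g : ℝ ≃o ℝ} (h : SaddleConj c β β' g) :
    SaddleConj c⁻¹ β β' (negConj g) := by
  let R : ℝ × ℝ → ℝ × ℝ := fun z => (-z.2, -z.1)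
  have hRR : ∀ z, R (R z) = z := fun z => by simp [R]
  have hRc : Continuous R := by fun_prop
  have hRm : ∀ {β z}, R z ∈ saddleHalf β ↔ z ∈ saddleHalf β := by
    intro β z
    simp only [saddleHalf, R, mem_ofPred_eq]
    constructor <;> intro h <;> linarith
  have hRb : ∀ β x, R (saddleBoundary β x) = saddleBoundary β (-x) := by
    intro β x
    refine Prod.ext ?_ ?_ <;> simp only [R, saddleBoundary] <;> ring
  -- After the exchange of the axes the exponents are `a` and `-1`. The new time `-(a t)` brings
  -- them back to the normalized form, now with `a⁻¹` in place of `a`.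
  have hRo : ∀ {a : ℝ}, 0 < a → ∀ z t, R (saddleOrbit a z t) = saddleOrbit a⁻¹ (R z) (-(a * t)) := by
    intro a ha z t
    refine Prod.ext ?_ ?_
    · simp [R, saddleOrbit]
    · simp only [R, saddleOrbit]
      rw [show -a⁻¹ * -(a * t) = t by field_simp]
      ring
  have hmem : ∀ {a : ℝ}, 0 < a → ∀ {I : Set ℝ} {t : ℝ}, t ∈ (fun t => -(a * t)) '' I ↔
      -(a⁻¹ * t) ∈ I := by
    intro a ha I t
    constructor
    · rintro ⟨s, hs, rfl⟩
      have : -(a⁻¹ * -(a * s)) = s := by field_simp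
      simpa only [this] using hs
    · intro h
      refine ⟨_, h, ?_⟩
      simp only
      field_simp
  have harc : ∀ {a β : ℝ}, 0 < a → ∀ {I : Set ℝ} {γ : ℝ → ℝ × ℝ}, IsSaddleArc a β I γ →
      IsSaddleArc a⁻¹ β ((fun t => -(a * t)) '' I) fun t => R (γ (-(a⁻¹ * t))) := by
    rintro a β ha I γ ⟨hI, z₀, hz⟩
    refine ⟨?_, R z₀, ?_⟩
    · exact (hI.isPreconnected.image _ (by fun_prop)).ordConnected
    · intro t ht
      rw [hmem ha] at ht
      obtain ⟨h1, h2⟩ := hz _ ht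
      refine ⟨?_, hRm.2 h2⟩
      beta_reduce
      rw [h1, hRo ha]
      congr 1
      field_simp
  have hsend : ∀ {β β' : ℝ} {F : ℝ × ℝ → ℝ × ℝ}, SendsArcs F (IsSaddleArc c β) (IsSaddleArc c β') →
      SendsArcs (fun z => R (F (R z))) (IsSaddleArc c⁻¹ β) (IsSaddleArc c⁻¹ β') := by
    intro β β' F hF I γ hγ
    have hγ' := harc (inv_pos.2 hc) hγ
    rw [inv_inv] at hγ'
    obtain ⟨s, η, h1, h2, h3, h4⟩ := hF _ _ hγ'
    have hin : ∀ t ∈ I, -(c⁻¹ * t) ∈ (fun t => -(c⁻¹ * t)) '' I := fun t ht => mem_image_of_mem _ ht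
    refine ⟨fun t => -(c * s (-(c⁻¹ * t))), fun t => R (η (-(c⁻¹ * t))), ?_, ?_, ?_, ?_⟩
    · intro a ha b hb hab
      have hlt : -(c⁻¹ * b) < -(c⁻¹ * a) :=
        neg_lt_neg (mul_lt_mul_of_pos_left hab (inv_pos.2 hc))
      exact neg_lt_neg (mul_lt_mul_of_pos_left (h1 (hin b hb) (hin a ha) hlt) hc)
    · have : ContinuousOn (fun t => s (-(c⁻¹ * t))) I :=
        h2.comp (by fun_prop) (fun t ht => hin t ht)
      exact (continuousOn_const.mul this).neg
    · have := harc hc h3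
      rw [image_image, image_image] at this
      exact this
    · intro t ht
      have := h4 _ (hin t ht)
      beta_reduce at this
      rw [show -(c * -(c⁻¹ * t)) = t by field_simp] at this
      beta_reduce
      rw [this, show -(c⁻¹ * -(c * s (-(c⁻¹ * t)))) = s (-(c⁻¹ * t)) by field_simp]
  obtain ⟨F, G, h1, h2, h3, h4, h5, h6, h7, h8, h9, h10⟩ := h
  refine ⟨fun z => R (F (R z)), fun z => R (G (R z)), ?_, ?_, ?_, ?_, ?_, ?_, ?_, ?_,
    hsend h9, hsend h10⟩
  · exact hRc.comp_continuousOn (h1.comp hRc.continuousOn fun z hz => hRm.2 hz)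
  · exact hRc.comp_continuousOn (h2.comp hRc.continuousOn fun z hz => hRm.2 hz)
  · exact fun z hz => hRm.2 (h3 (hRm.2 hz))
  · exact fun z hz => hRm.2 (h4 (hRm.2 hz))
  · intro z hz
    simp only [hRR, h5 (hRm.2 hz)]
  · intro z hz
    simp only [hRR, h6 (hRm.2 hz)]
  · intro x
    simp only [hRb, h7, negConj_apply]
  · intro x
    simp only [hRb, h8, negConj_symm_apply]

/-! ### Moving the boundary points to the right of the fold and of the separatrices. -/

/-- The order isomorphism that fixes `(-∞, r]` and stretches `[r, ∞)` by the factor `k`. -/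
noncomputable def stretchAfter (r k : ℝ) (hk : 0 < k) : ℝ ≃o ℝ where
  toFun x := x + (k - 1) * max (x - r) 0
  invFun x := x + (k⁻¹ - 1) * max (x - r) 0
  left_inv x := by
    rcases le_total x r with h | h
    · simp [max_eq_right (sub_nonpos.2 h)]
    · beta_reduce
      rw [max_eq_left (sub_nonneg.2 h),
        show x + (k - 1) * (x - r) - r = k * (x - r) by ring,
        max_eq_left (mul_nonneg hk.le (sub_nonneg.2 h))]
      field_simp
      ring
  right_inv x := by
    rcases le_total x r with h | h
    · simp [max_eq_right (sub_nonpos.2 h)]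
    · beta_reduce
      rw [max_eq_left (sub_nonneg.2 h),
        show x + (k⁻¹ - 1) * (x - r) - r = k⁻¹ * (x - r) by ring,
        max_eq_left (mul_nonneg (inv_pos.2 hk).le (sub_nonneg.2 h))]
      field_simp
      ring
  map_rel_iff' {a b} := by
    have hm : StrictMono fun x => x + (k - 1) * max (x - r) 0 := by
      intro a b hab
      simp only
      rcases le_total a r with ha | ha <;> rcases le_total b r with hb | hb
      · simp [max_eq_right (sub_nonpos.2 ha), max_eq_right (sub_nonpos.2 hb), hab]
      · rw [max_eq_right (sub_nonpos.2 ha), max_eq_left (sub_nonneg.2 hb)]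
        rcases hb.eq_or_lt with rfl | hb
        · simpa using hab
        · nlinarith [mul_pos hk (sub_pos.2 hb)]
      · linarith
      · rw [max_eq_left (sub_nonneg.2 ha), max_eq_left (sub_nonneg.2 hb)]
        nlinarith [mul_pos hk (sub_pos.2 hab)]
    exact hm.le_iff_le

lemma stretchAfter_apply {r k : ℝ} (hk : 0 < k) (x : ℝ) :
    stretchAfter r k hk x = x + (k - 1) * max (x - r) 0 := rfl

lemma stretchAfter_of_le {r k x : ℝ} (hk : 0 < k) (h : x ≤ r) : stretchAfter r k hk x = x := by
  simp [stretchAfter_apply, max_eq_right (sub_nonpos.2 h)]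

lemma stretchAfter_of_ge {r k x : ℝ} (hk : 0 < k) (h : r ≤ x) :
    stretchAfter r k hk x = r + k * (x - r) := by
  rw [stretchAfter_apply, max_eq_left (sub_nonneg.2 h)]
  ring

lemma stretchAfter_symm {r k : ℝ} (hk : 0 < k) :
    (stretchAfter r k hk).symm = stretchAfter r k⁻¹ (inv_pos.2 hk) := by
  ext x; rfl

/-- The value of the first integral `v u^c` of the saddle at the boundary point over `x`. -/
noncomputable def saddleLevel (c β x : ℝ) : ℝ := (x + β) / 2 * ((x - β) / 2) ^ c

section RightMove

variable {c β r : ℝ}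

lemma continuous_saddleLevel (hc : 0 < c) : Continuous (saddleLevel c β) := by
  unfold saddleLevel
  have : Continuous fun x : ℝ => ((x - β) / 2) ^ c :=
    (by fun_prop : Continuous fun x : ℝ => (x - β) / 2).rpow_const fun _ => Or.inr hc.le
  fun_prop

/-- The derivative is `u^(c-1) ((1 + c) x - β (1 - c)) / 4` with `u = (x - β) / 2`, which changes
sign at the fold. The hypothesis `ht` says that `r` is not to the left of it. -/
lemma strictMonoOn_saddleLevel (hc : 0 < c) (hr : β < r) (ht : β * (1 - c) ≤ (1 + c) * r) :
    StrictMonoOn (saddleLevel c β) (Ici r) := by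
  refine strictMonoOn_of_deriv_pos (convex_Ici r) (continuous_saddleLevel hc).continuousOn ?_
  intro x hx
  rw [interior_Ici] at hx
  have hx : r < x := hx
  have hu : 0 < (x - β) / 2 := by linarith
  have h1 : HasDerivAt (fun x : ℝ => ((x - β) / 2) ^ c)
      (1 / 2 * c * ((x - β) / 2) ^ (c - 1)) x :=
    (((hasDerivAt_id x).sub_const β).div_const 2).rpow_const (Or.inl hu.ne')
  have h2 : HasDerivAt (fun x : ℝ => (x + β) / 2) (1 / 2) x :=
    ((hasDerivAt_id x).add_const β).div_const 2
  have h3 : HasDerivAt (saddleLevel c β) _ x := h2.mul h1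
  rw [h3.deriv]
  have h4 : ((x - β) / 2) ^ c = ((x - β) / 2) ^ (c - 1) * ((x - β) / 2) := by
    rw [← Real.rpow_add_one hu.ne']; congr 1; ring
  rw [h4]
  have h5 : 0 < ((x - β) / 2) ^ (c - 1) := Real.rpow_pos_of_pos hu _
  have h6 : 0 < (1 + c) * x - β * (1 - c) := by nlinarith
  have : 1 / 2 * (((x - β) / 2) ^ (c - 1) * ((x - β) / 2)) +
      (x + β) / 2 * (1 / 2 * c * ((x - β) / 2) ^ (c - 1)) =
      ((x - β) / 2) ^ (c - 1) * ((1 + c) * x - β * (1 - c)) / 4 := by ring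
  rw [this]
  positivity

/-- `saddleLevel` on `[r, ∞)`, continued affinely. -/
noncomputable def extendedLevel (c β r x : ℝ) : ℝ := saddleLevel c β (max x r) + min (x - r) 0

/-- The affine continuation to the left of `r` only serves to make the level an order isomorphism of
the line, so that the base of an orbit is read off from its level by `e.symm`. -/
lemma exists_extendedLevel_iso (hc : 0 < c) (hr : β < r) (ht : β * (1 - c) ≤ (1 + c) * r) :
    ∃ e : ℝ ≃o ℝ, ∀ x, e x = extendedLevel c β r x := by
  have hm := strictMonoOn_saddleLevel hc hr ht
  have hmono : StrictMono (extendedLevel c β r) := by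
    intro a b hab
    simp only [extendedLevel]
    rcases le_total b r with hb | hb
    · rw [max_eq_right hb, max_eq_right (hab.le.trans hb), min_eq_left (by linarith),
        min_eq_left (by linarith)]
      linarith
    · rw [max_eq_left hb, min_eq_right (show 0 ≤ b - r by linarith), add_zero]
      rcases le_total a r with ha | ha
      · rw [max_eq_right ha, min_eq_left (by linarith)]
        rcases hb.eq_or_lt with rfl | hb'
        · linarith
        · have := hm self_mem_Ici hb hb'
          linarith
      · rw [max_eq_left ha, min_eq_right (by linarith), add_zero]
        exact hm ha hb hab
  have hcont : Continuous (extendedLevel c β r) := by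
    have := continuous_saddleLevel (β := β) hc
    unfold extendedLevel
    fun_prop
  have htop : Tendsto (extendedLevel c β r) atTop atTop := by
    have h1 : Tendsto (fun x : ℝ => (x + β) / 2) atTop atTop :=
      (tendsto_atTop_add_const_right _ β tendsto_id).atTop_div_const (by norm_num)
    refine tendsto_atTop_mono' atTop ?_ h1
    filter_upwards [eventually_ge_atTop r, eventually_ge_atTop (β + 2), eventually_ge_atTop (-β)]
      with x h2 h3 h4
    rw [extendedLevel, max_eq_left h2, min_eq_right (by linarith), add_zero, saddleLevel]
    have h5 : 1 ≤ ((x - β) / 2) ^ c := Real.one_le_rpow (by linarith) hc.le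
    nlinarith
  have hbot : Tendsto (extendedLevel c β r) atBot atBot := by
    have h1 : Tendsto (fun x : ℝ => saddleLevel c β r + (x - r)) atBot atBot :=
      tendsto_atBot_add_const_left _ _ (tendsto_atBot_add_const_right _ (-r) tendsto_id)
    refine tendsto_atBot_mono' atBot ?_ h1
    filter_upwards [eventually_le_atBot r] with x h2
    rw [extendedLevel, max_eq_right h2, min_eq_left (by linarith)]
  exact ⟨hmono.orderIsoOfSurjective _ (hcont.surjective htop hbot), fun x => rfl⟩

lemma exp_time_mul_rpow {ρ : ℝ} (hρ : 0 ≤ ρ) (t : ℝ) :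
    (ρ * Real.exp t) ^ (-c) = ρ ^ (-c) * Real.exp (-c * t) := by
  rw [Real.mul_rpow hρ (Real.exp_pos t).le, ← Real.exp_mul, mul_comm t]

/-- Forward orbits that enter the half-plane at or after the fold and the separatrix stay in it. -/
lemma forward_mem_saddleHalf {u v ρ : ℝ} (hc : 0 < c) (hu : 0 < u) (huv : 0 ≤ u + c * v)
    (hρ : 1 ≤ ρ) : ρ ^ (-c) * v - ρ * u ≤ v - u := by
  have hρ0 : 0 < ρ := by linarith
  rcases le_total 0 v with hv | hv
  · have : ρ ^ (-c) ≤ 1 := Real.rpow_le_one_of_one_le_of_nonpos hρ (by linarith)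
    nlinarith
  -- The graph of the convex function `ρ ↦ ρ^(-c)` lies above its tangent at `1`. With `v ≤ 0`, the
  -- rest is the hypothesis `u + c v ≥ 0`, which places the entry point at or after the fold.
  · have h1 : 1 - c * (ρ - 1) ≤ ρ ^ (-c) := by
      rw [Real.rpow_def_of_pos hρ0]
      have h2 := Real.add_one_le_exp (Real.log ρ * -c)
      have h3 := Real.log_le_sub_one_of_pos hρ0
      nlinarith
    nlinarith [mul_le_mul_of_nonpos_right h1 hv, mul_nonneg (sub_nonneg.2 hρ) huv]

/-- The base function: the abscissa of the boundary point, at or to the right of `r`, whose orbit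
passes through `z`; it is at most `r` if there is no such point. -/
noncomputable def rightBase (c β r : ℝ) (e : ℝ ≃o ℝ) (z : ℝ × ℝ) : ℝ :=
  e.symm (z.2 * max z.1 ((r - β) / 2) ^ c)

/-- The map that moves the orbits entering the half-plane to the right of `r`. -/
noncomputable def rightMove (c β r k : ℝ) (e : ℝ ≃o ℝ) (z : ℝ × ℝ) : ℝ × ℝ :=
  z + ((k - 1) * max (rightBase c β r e z - r) 0 / 2) •
    (max 1 (z.1 / ((max (rightBase c β r e z) r - β) / 2)),
      max 1 (z.1 / ((max (rightBase c β r e z) r - β) / 2)) ^ (-c))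

variable {e : ℝ ≃o ℝ}

lemma continuous_rightBase (hc : 0 < c) : Continuous (rightBase c β r e) := by
  unfold rightBase
  have h1 : Continuous fun z : ℝ × ℝ => max z.1 ((r - β) / 2) ^ c :=
    (by fun_prop : Continuous fun z : ℝ × ℝ => max z.1 ((r - β) / 2)).rpow_const
      fun _ => Or.inr hc.le
  have h2 := e.symm.continuous
  fun_prop

lemma continuous_rightMove (hc : 0 < c) (hr : β < r) (k : ℝ) :
    Continuous (rightMove c β r k e) := by
  have h1 := continuous_rightBase (β := β) (r := r) (e := e) hc
  have hpos : ∀ z : ℝ × ℝ, 0 < (max (rightBase c β r e z) r - β) / 2 := by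
    intro z
    have := le_max_right (rightBase c β r e z) r
    linarith
  have h2 : Continuous fun z : ℝ × ℝ =>
      max 1 (z.1 / ((max (rightBase c β r e z) r - β) / 2)) := by
    refine continuous_const.max (continuous_fst.div ?_ fun z => (hpos z).ne')
    fun_prop
  have h3 : Continuous fun z : ℝ × ℝ =>
      max 1 (z.1 / ((max (rightBase c β r e z) r - β) / 2)) ^ (-c) :=
    h2.rpow_const fun z => Or.inl (by
      have := le_max_left 1 (z.1 / ((max (rightBase c β r e z) r - β) / 2))
      linarith)
  unfold rightMove
  fun_prop

lemma rightMove_of_base_le {k : ℝ} {z : ℝ × ℝ} (h : rightBase c β r e z ≤ r) :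
    rightMove c β r k e z = z := by
  simp [rightMove, max_eq_right (sub_nonpos.2 h)]

/-- The points reached from the boundary point over `x` after the time `log ρ` have the same level
`v u^c` as that point, and the truncation of `u` in the base is inactive there. -/
lemma rightBase_wedge (he : ∀ x, e x = extendedLevel c β r x)
    (hr : β < r) {x ρ : ℝ} (hx : r ≤ x) (hρ : 1 ≤ ρ) :
    rightBase c β r e (ρ * ((x - β) / 2), ρ ^ (-c) * ((x + β) / 2)) = x := by
  have hu : 0 < (x - β) / 2 := by linarith
  have h1 : (r - β) / 2 ≤ ρ * ((x - β) / 2) := by nlinarith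
  rw [rightBase, OrderIso.symm_apply_eq, he, extendedLevel, max_eq_left hx,
    min_eq_right (by linarith), add_zero, saddleLevel]
  simp only
  rw [max_eq_left h1, Real.mul_rpow (by linarith) hu.le, Real.rpow_neg (by linarith)]
  have : ρ ^ c ≠ 0 := (Real.rpow_pos_of_pos (by linarith) c).ne'
  field_simp

/-- In the half-plane `v ≤ u + β`, so for such `u` the coordinate `v` is at most that of the
boundary point over `r`. The truncated level then does not exceed the level of `r`. -/
lemma le_of_rightBase_lt (he : ∀ x, e x = extendedLevel c β r x)
    (hr : β < r) {z : ℝ × ℝ} (hz : z ∈ saddleHalf β)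
    (hu : z.1 ≤ (r - β) / 2) : rightBase c β r e z ≤ r := by
  have hz' : z.2 - z.1 ≤ β := hz
  have hur : 0 < (r - β) / 2 := by linarith
  rw [rightBase, max_eq_right hu, ← e.le_iff_le, e.apply_symm_apply, he, extendedLevel, max_self,
    sub_self, min_self, add_zero, saddleLevel]
  exact mul_le_mul_of_nonneg_right (by linarith) (Real.rpow_pos_of_pos hur c).le

lemma exists_wedge (he : ∀ x, e x = extendedLevel c β r x)
    (hc : 0 < c) (hr : β < r) (ht : β * (1 - c) ≤ (1 + c) * r) {z : ℝ × ℝ}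
    (hz : z ∈ saddleHalf β) (h : r < rightBase c β r e z) :
    ∃ x ρ, r < x ∧ 1 ≤ ρ ∧ z = (ρ * ((x - β) / 2), ρ ^ (-c) * ((x + β) / 2)) := by
  have hz' : z.2 - z.1 ≤ β := hz
  have hu : (r - β) / 2 < z.1 := by
    by_contra hu
    exact absurd (le_of_rightBase_lt he hr hz (not_lt.1 hu)) (not_le.2 h)
  have hur : 0 < (r - β) / 2 := by linarith
  set x := rightBase c β r e z with hx
  have hlev : z.2 * z.1 ^ c = saddleLevel c β x := by
    have : e x = z.2 * max z.1 ((r - β) / 2) ^ c := by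
      rw [hx, rightBase, e.apply_symm_apply]
    rw [he, extendedLevel, max_eq_left h.le, min_eq_right (by linarith), add_zero,
      max_eq_left hu.le] at this
    exact this.symm
  have hux : 0 < (x - β) / 2 := by linarith
  have hzu : 0 < z.1 := by linarith
  -- The boundary point with the same `u` as `z` has at least the level of `z`. By monotonicity it
  -- lies at or to the right of `x`, so `z` comes after the base point in time.
  have hle : (x - β) / 2 ≤ z.1 := by
    have h1 : saddleLevel c β x ≤ saddleLevel c β (2 * z.1 + β) := by
      rw [← hlev, saddleLevel, show (2 * z.1 + β - β) / 2 = z.1 by ring]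
      exact mul_le_mul_of_nonneg_right (by linarith) (Real.rpow_pos_of_pos hzu c).le
    have h2 := (strictMonoOn_saddleLevel hc hr ht).le_iff_le (show x ∈ Ici r from h.le)
      (show 2 * z.1 + β ∈ Ici r from by simp only [mem_Ici]; linarith)
    have := h2.1 h1
    linarith
  refine ⟨x, z.1 / ((x - β) / 2), h, (one_le_div hux).2 hle, Prod.ext ?_ ?_⟩
  · exact (div_mul_cancel₀ _ hux.ne').symm
  · simp only
    rw [Real.rpow_neg (div_pos hzu hux).le, Real.div_rpow hzu.le hux.le, inv_div]
    have : z.1 ^ c ≠ 0 := (Real.rpow_pos_of_pos hzu c).ne'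
    rw [saddleLevel] at hlev
    rw [div_mul_eq_mul_div, eq_div_iff this, hlev]
    ring

/-- Both coordinates of a boundary point change by half of the displacement of `x`. Keeping the time
`log ρ` therefore adds that half times `(ρ, ρ^(-c))`, which is the formula of `rightMove`. -/
lemma rightMove_wedge (he : ∀ x, e x = extendedLevel c β r x)
    (hr : β < r) {k : ℝ} (hk : 0 < k) {x ρ : ℝ} (hx : r ≤ x)
    (hρ : 1 ≤ ρ) : rightMove c β r k e (ρ * ((x - β) / 2), ρ ^ (-c) * ((x + β) / 2)) =
      (ρ * ((stretchAfter r k hk x - β) / 2), ρ ^ (-c) * ((stretchAfter r k hk x + β) / 2)) := by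
  have hu : 0 < (x - β) / 2 := by linarith
  rw [rightMove, rightBase_wedge he hr hx hρ, max_eq_left hx]
  simp only
  rw [mul_div_cancel_right₀ _ hu.ne', max_eq_right hρ, max_eq_left (sub_nonneg.2 hx),
    stretchAfter_of_ge hk hx]
  refine Prod.ext ?_ ?_
  · simp only [Prod.smul_mk, Prod.mk_add_mk, smul_eq_mul]; ring
  · simp only [Prod.smul_mk, Prod.mk_add_mk, smul_eq_mul]; ring

lemma rightMove_mem (he : ∀ x, e x = extendedLevel c β r x)
    (hc : 0 < c) (hr : β < r) (ht : β * (1 - c) ≤ (1 + c) * r) {k : ℝ}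
    (hk : 0 < k) {z : ℝ × ℝ} (hz : z ∈ saddleHalf β) : rightMove c β r k e z ∈ saddleHalf β := by
  rcases le_or_gt (rightBase c β r e z) r with h | h
  · rwa [rightMove_of_base_le h]
  · obtain ⟨x, ρ, hx, hρ, rfl⟩ := exists_wedge he hc hr ht hz h
    rw [rightMove_wedge he hr hk hx.le hρ]
    have hx' : r ≤ stretchAfter r k hk x := by
      rw [stretchAfter_of_ge hk hx.le]
      nlinarith
    set y := stretchAfter r k hk x
    have := forward_mem_saddleHalf (u := (y - β) / 2) (v := (y + β) / 2) hc (by linarith)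
      (by nlinarith) hρ
    simp only [saddleHalf, mem_ofPred_eq]
    linarith

lemma rightMove_leftInv (he : ∀ x, e x = extendedLevel c β r x)
    (hc : 0 < c) (hr : β < r) (ht : β * (1 - c) ≤ (1 + c) * r) {k : ℝ}
    (hk : 0 < k) {z : ℝ × ℝ} (hz : z ∈ saddleHalf β) :
    rightMove c β r k⁻¹ e (rightMove c β r k e z) = z := by
  rcases le_or_gt (rightBase c β r e z) r with h | h
  · rw [rightMove_of_base_le h, rightMove_of_base_le h]
  · obtain ⟨x, ρ, hx, hρ, rfl⟩ := exists_wedge he hc hr ht hz h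
    have hx' : r ≤ stretchAfter r k hk x := by
      rw [stretchAfter_of_ge hk hx.le]
      nlinarith
    rw [rightMove_wedge he hr hk hx.le hρ, rightMove_wedge he hr (inv_pos.2 hk) hx' hρ,
      ← stretchAfter_symm hk, OrderIso.symm_apply_apply]

lemma rightMove_boundary (he : ∀ x, e x = extendedLevel c β r x)
    (hr : β < r) {k : ℝ}
    (hk : 0 < k) (x : ℝ) : rightMove c β r k e (saddleBoundary β x) =
      saddleBoundary β (stretchAfter r k hk x) := by
  rcases le_or_gt x r with h | h
  · rw [stretchAfter_of_le hk h, rightMove_of_base_le]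
    refine le_of_rightBase_lt he hr ?_ (by simp only [saddleBoundary]; linarith)
    simp only [saddleHalf, saddleBoundary, mem_ofPred_eq]
    linarith
  · simpa [saddleBoundary] using rightMove_wedge he hr hk h.le (le_refl 1)

/-- An arc with one point in the moved wedge lies in it entirely. To leave, it would have to reach
`u = (r - β) / 2`, where no point of the half-plane has a level above that of `r`. -/
lemma rightBase_orbit_const (he : ∀ x, e x = extendedLevel c β r x)
    (hc : 0 < c) (hr : β < r)
    (ht : β * (1 - c) ≤ (1 + c) * r) {I : Set ℝ} (hI : I.OrdConnected) {z₀ : ℝ × ℝ}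
    (hz : ∀ t ∈ I, saddleOrbit c z₀ t ∈ saddleHalf β) {a : ℝ} (ha : a ∈ I)
    (hb : r < rightBase c β r e (saddleOrbit c z₀ a)) :
    ∃ x ρ, r < x ∧ 0 < ρ ∧ (∀ t ∈ I, 1 ≤ ρ * Real.exp t) ∧
      z₀ = (ρ * ((x - β) / 2), ρ ^ (-c) * ((x + β) / 2)) := by
  have hur : 0 < (r - β) / 2 := by linarith
  obtain ⟨x, σ, hx, hσ, e1⟩ := exists_wedge he hc hr ht (hz a ha) hb
  have hσ0 : 0 < σ := by linarith
  have hu : 0 < (x - β) / 2 := by linarith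
  have hz0 : z₀ = (σ * Real.exp (-a) * ((x - β) / 2),
      (σ * Real.exp (-a)) ^ (-c) * ((x + β) / 2)) := by
    have h1 : z₀.1 * Real.exp a = σ * ((x - β) / 2) := congrArg Prod.fst e1
    have h2 : z₀.2 * Real.exp (-c * a) = σ ^ (-c) * ((x + β) / 2) := congrArg Prod.snd e1
    refine Prod.ext ?_ ?_
    · simp only
      rw [mul_right_comm, ← h1, mul_assoc, ← Real.exp_add]
      simp
    · simp only
      rw [exp_time_mul_rpow hσ0.le, mul_right_comm, ← h2, mul_assoc, ← Real.exp_add]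
      simp
  refine ⟨x, σ * Real.exp (-a), hx, by positivity, ?_, hz0⟩
  set ρ := σ * Real.exp (-a) with hρ
  have hρ0 : 0 < ρ := by positivity
  have horb : ∀ t, saddleOrbit c z₀ t =
      (ρ * Real.exp t * ((x - β) / 2), (ρ * Real.exp t) ^ (-c) * ((x + β) / 2)) := by
    intro t
    rw [hz0, exp_time_mul_rpow hρ0.le, saddleOrbit]
    refine Prod.ext ?_ ?_ <;> simp only <;> ring
  have hpow : ∀ t, ((ρ * Real.exp t) ^ (-c) * ((x + β) / 2)) *
      (ρ * Real.exp t * ((x - β) / 2)) ^ c = saddleLevel c β x := by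
    intro t
    have h1 : 0 < ρ * Real.exp t := by positivity
    rw [Real.mul_rpow h1.le hu.le, Real.rpow_neg h1.le, saddleLevel]
    have : (ρ * Real.exp t) ^ c ≠ 0 := (Real.rpow_pos_of_pos h1 c).ne'
    field_simp
  have hlarge : ∀ t ∈ I, (r - β) / 2 < ρ * Real.exp t * ((x - β) / 2) := by
    intro t ht'
    by_contra hcon
    rw [not_lt] at hcon
    have hcona : (r - β) / 2 < ρ * Real.exp a * ((x - β) / 2) := by
      have : ρ * Real.exp a = σ := by
        rw [hρ, mul_assoc, ← Real.exp_add]; simp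
      rw [this]; nlinarith
    obtain ⟨τ, hτ, hτe⟩ := hI.isPreconnected.intermediate_value ht' ha
      (f := fun t => ρ * Real.exp t * ((x - β) / 2)) (by fun_prop) ⟨hcon, hcona.le⟩
    have h1 := hz τ hτ
    rw [horb] at h1
    have h2 := hpow τ
    simp only at hτe
    simp only [saddleHalf, mem_ofPred_eq] at h1
    rw [hτe] at h1 h2
    have h3 : saddleLevel c β x ≤ saddleLevel c β r := by
      rw [← h2, saddleLevel]
      exact mul_le_mul_of_nonneg_right (by linarith) (Real.rpow_pos_of_pos hur c).le
    exact absurd ((strictMonoOn_saddleLevel hc hr ht) self_mem_Ici hx.le hx) (not_lt.2 h3)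
  intro t ht'
  have h1 := hlarge t ht'
  have h2 := hz t ht'
  have h3 : r < rightBase c β r e (saddleOrbit c z₀ t) := by
    rw [← e.lt_iff_lt, rightBase, e.apply_symm_apply, horb]
    simp only
    rw [max_eq_left h1.le, hpow, he, extendedLevel, max_self, sub_self, min_self, add_zero]
    exact (strictMonoOn_saddleLevel hc hr ht) self_mem_Ici hx.le hx
  obtain ⟨y, θ, hy, hθ, e2⟩ := exists_wedge he hc hr ht h2 h3
  have hyx : y = x := by
    have h4 := rightBase_wedge he hr hy.le hθ
    rw [← e2] at h4
    have h5 : saddleLevel c β x = extendedLevel c β r y := by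
      rw [← h4, ← he, rightBase, e.apply_symm_apply, horb]
      simp only
      rw [max_eq_left h1.le, hpow]
    rw [extendedLevel, max_eq_left hy.le, min_eq_right (by linarith), add_zero] at h5
    exact ((strictMonoOn_saddleLevel hc hr ht).injOn hx.le hy.le h5).symm
  rw [horb, hyx] at e2
  have h6 : ρ * Real.exp t * ((x - β) / 2) = θ * ((x - β) / 2) := congrArg Prod.fst e2
  rw [mul_right_cancel₀ hu.ne' h6]
  exact hθ

lemma rightMove_sendsArcs (he : ∀ x, e x = extendedLevel c β r x)
    (hc : 0 < c) (hr : β < r) (ht : β * (1 - c) ≤ (1 + c) * r) {k : ℝ}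
    (hk : 0 < k) : SendsArcs (rightMove c β r k e) (IsSaddleArc c β) (IsSaddleArc c β) := by
  rintro I γ ⟨hI, z₀, hz⟩
  have hz' : ∀ t ∈ I, saddleOrbit c z₀ t ∈ saddleHalf β := fun t ht => by
    rw [← (hz t ht).1]; exact (hz t ht).2
  refine ⟨id, fun t => rightMove c β r k e (γ t), strictMonoOn_id, continuousOn_id,
    ⟨by simpa using hI, ?_⟩, fun t _ => rfl⟩
  rw [image_id]
  by_cases hcase : ∃ a ∈ I, r < rightBase c β r e (saddleOrbit c z₀ a)
  · obtain ⟨a, ha, hb⟩ := hcase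
    obtain ⟨x, ρ, hx, hρ, h1, rfl⟩ := rightBase_orbit_const he hc hr ht hI hz' ha hb
    refine ⟨(ρ * ((stretchAfter r k hk x - β) / 2), ρ ^ (-c) * ((stretchAfter r k hk x + β) / 2)),
      fun t ht' => ⟨?_, rightMove_mem he hc hr ht hk (hz t ht').2⟩⟩
    have horb : ∀ y, saddleOrbit c (ρ * ((y - β) / 2), ρ ^ (-c) * ((y + β) / 2)) t =
        (ρ * Real.exp t * ((y - β) / 2), (ρ * Real.exp t) ^ (-c) * ((y + β) / 2)) := by
      intro y
      rw [exp_time_mul_rpow hρ.le, saddleOrbit]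
      refine Prod.ext ?_ ?_ <;> simp only <;> ring
    beta_reduce
    rw [(hz t ht').1, horb, horb, rightMove_wedge he hr hk hx.le (h1 t ht')]
  · push Not at hcase
    refine ⟨z₀, fun t ht' => ⟨?_, rightMove_mem he hc hr ht hk (hz t ht').2⟩⟩
    beta_reduce
    rw [(hz t ht').1, rightMove_of_base_le (hcase t ht')]

end RightMove

/-- The boundary map that stretches `[r, ∞)` extends to the half-plane if `r` lies to the right of
the fold and of the unstable separatrix of the saddle. -/
theorem saddleConj_stretchAfter {c β r k : ℝ} (hc : 0 < c) (hr : β < r)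
    (ht : β * (1 - c) ≤ (1 + c) * r) (hk : 0 < k) :
    SaddleConj c β β (stretchAfter r k hk) := by
  obtain ⟨e, he⟩ := exists_extendedLevel_iso hc hr ht
  have hk' := inv_pos.2 hk
  refine ⟨rightMove c β r k e, rightMove c β r k⁻¹ e, (continuous_rightMove hc hr k).continuousOn,
    (continuous_rightMove hc hr k⁻¹).continuousOn, fun z hz => rightMove_mem he hc hr ht hk hz,
    fun z hz => rightMove_mem he hc hr ht hk' hz, fun z hz => rightMove_leftInv he hc hr ht hk hz,
    fun z hz => ?_, rightMove_boundary he hr hk, fun x => ?_,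
    rightMove_sendsArcs he hc hr ht hk, rightMove_sendsArcs he hc hr ht hk'⟩
  · have := rightMove_leftInv he hc hr ht hk' hz
    rwa [inv_inv] at this
  · rw [stretchAfter_symm]
    exact rightMove_boundary he hr hk' x

/-! ### Homeomorphisms of the line with prescribed values. -/

/-- An increasing homeomorphism of the line that moves `a` to `a'` inside `(lo, hi)`. -/
lemma exists_bump {lo hi a a' : ℝ} (ha : a ∈ Ioo lo hi) (ha' : a' ∈ Ioo lo hi) :
    ∃ f : ℝ ≃o ℝ, f a = a' ∧ ∀ x, x ≤ lo ∨ hi ≤ x → f x = x := by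
  have up : ∀ {a a' : ℝ}, a ∈ Ioo lo hi → a' ∈ Ioo lo hi → a ≤ a' →
      ∃ f : ℝ ≃o ℝ, f a = a' ∧ ∀ x, x ≤ lo ∨ hi ≤ x → f x = x := by
    intro a a' ha ha' haa
    have h1 : 0 < a - lo := sub_pos.2 ha.1
    have h2 : 0 < hi - a := sub_pos.2 ha.2
    set k := (a' - lo) / (a - lo) with hk
    set m := (hi - a') / (hi - a) with hm
    have hk1 : 1 ≤ k := (one_le_div h1).2 (by linarith)
    have hm0 : 0 < m := div_pos (sub_pos.2 ha'.2) h2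
    have hm1 : m ≤ 1 := (div_le_one h2).2 (by linarith)
    -- The lines of slope `k` through `(lo, lo)` and of slope `m` through `(hi, hi)` meet at `(a,
    -- a')`. Their minimum is at most the identity outside the interval, where the maximum restores
    -- the identity.
    let φ : ℝ → ℝ := fun x => max x (min (lo + k * (x - lo)) (hi + m * (x - hi)))
    have hφm : StrictMono φ := by
      intro x y hxy
      have e1 : lo + k * (x - lo) < lo + k * (y - lo) := by nlinarith
      have e2 : hi + m * (x - hi) < hi + m * (y - hi) := by nlinarith
      exact max_lt_max hxy (min_lt_min e1 e2)
    have hφlo : ∀ x, x ≤ lo → φ x = x := fun x hx =>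
      max_eq_left ((min_le_left _ _).trans (by nlinarith))
    have hφhi : ∀ x, hi ≤ x → φ x = x := fun x hx =>
      max_eq_left ((min_le_right _ _).trans (by nlinarith))
    have hφc : Continuous φ := by fun_prop
    have htop : Tendsto φ atTop atTop := tendsto_atTop_mono (fun x => le_max_left _ _) tendsto_id
    have hbot : Tendsto φ atBot atBot := by
      refine tendsto_id.congr' ?_
      filter_upwards [eventually_le_atBot lo] with x hx
      exact (hφlo x hx).symm
    refine ⟨hφm.orderIsoOfSurjective φ (hφc.surjective htop hbot), ?_, ?_⟩
    · change max a (min (lo + k * (a - lo)) (hi + m * (a - hi))) = a'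
      have e1 : lo + k * (a - lo) = a' := by rw [hk]; field_simp; ring
      have e2 : hi + m * (a - hi) = a' := by
        have : m * (hi - a) = hi - a' := div_mul_cancel₀ _ h2.ne'
        linarith
      rw [e1, e2, min_self, max_eq_right haa]
    · rintro x (hx | hx)
      · exact hφlo x hx
      · exact hφhi x hx
  rcases le_total a a' with h | h
  · exact up ha ha' h
  · obtain ⟨f, hf, hfix⟩ := up ha' ha h
    refine ⟨f.symm, by rw [OrderIso.symm_apply_eq, hf], fun x hx => ?_⟩
    rw [OrderIso.symm_apply_eq, hfix x hx]

/-- An odd increasing homeomorphism of the line with prescribed values at two points. -/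
lemma exists_odd_iso {a b a' b' M : ℝ} (ha : 0 < a) (hab : a < b) (hb : b < M) (ha' : 0 < a')
    (hab' : a' < b') (hb' : b' < M) : ∃ (θ : ℝ ≃o ℝ) (d : ℝ), 0 ≤ d ∧ d < M ∧ θ a = a' ∧ θ b = b' ∧
      (∀ x, θ (-x) = -θ x) ∧ ∀ x, d ≤ |x| → θ x = x := by
  obtain ⟨d, hd1, hd2⟩ := exists_between (max_lt hb hb')
  have hbd := (le_max_left b b').trans_lt hd1
  have hbd' := (le_max_right b b').trans_lt hd1
  -- The first bump places `a`. The second one acts only on `(a', d)`, so it corrects the image of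
  -- `b` without moving `a'`.
  obtain ⟨f₁, h1, h1'⟩ := exists_bump (lo := 0) (hi := d) (a := a) (a' := a')
    ⟨ha, by linarith⟩ ⟨ha', by linarith⟩
  have hf₁b : f₁ b ∈ Ioo a' d := by
    refine ⟨by rw [← h1]; exact f₁.strictMono hab, ?_⟩
    rw [← h1' d (Or.inr le_rfl)]
    exact f₁.strictMono hbd
  obtain ⟨f₂, h2, h2'⟩ := exists_bump hf₁b (⟨hab', hbd'⟩ : b' ∈ Ioo a' d)
  let f := f₁.trans f₂
  have hfa : f a = a' := by simp [f, h1, h2' a' (Or.inl le_rfl)]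
  have hfb : f b = b' := by simp [f, h2]
  have hneg : ∀ x, x ≤ 0 → f x = x := by
    intro x hx
    simp only [f, OrderIso.trans_apply, h1' x (Or.inl hx), h2' x (Or.inl (by linarith))]
  have hlarge : ∀ x, d ≤ x → f x = x := by
    intro x hx
    simp only [f, OrderIso.trans_apply, h1' x (Or.inr hx), h2' x (Or.inr hx)]
  -- `f` is the identity on negative numbers and its mirror image `negConj f` on positive ones, so
  -- the composite acts by each of them on one half-line and is odd.
  let θ := f.trans (negConj f)
  have hθpos : ∀ x, 0 ≤ x → θ x = f x := by
    intro x hx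
    have : 0 ≤ f x := by
      rw [← hneg 0 le_rfl]; exact f.monotone hx
    simp [θ, hneg (-f x) (by linarith)]
  have hθneg : ∀ x, 0 ≤ x → θ (-x) = -f x := by
    intro x hx
    simp [θ, hneg (-x) (by linarith)]
  have hodd : ∀ x, θ (-x) = -θ x := by
    intro x
    rcases le_total 0 x with h | h
    · rw [hθneg x h, hθpos x h]
    · obtain ⟨y, rfl⟩ : ∃ y, x = -y := ⟨-x, by simp⟩
      rw [neg_neg, hθneg y (by linarith), hθpos y (by linarith), neg_neg]
  refine ⟨θ, d, by linarith, hd2, by rw [hθpos a ha.le, hfa], by rw [hθpos b (by linarith), hfb], hodd, ?_⟩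
  intro x hx
  rcases le_total 0 x with h | h
  · rw [abs_of_nonneg h] at hx
    rw [hθpos x h, hlarge x hx]
  · rw [abs_of_nonpos h] at hx
    obtain ⟨y, rfl⟩ : ∃ y, x = -y := ⟨-x, by simp⟩
    rw [neg_neg] at hx
    rw [hodd, hθpos y (by linarith), hlarge y hx]

/-! ### The triangle between the separatrices. -/

/-- The value of the first integral `v (-u)^c` at the boundary point over `x ∈ [-β, β]`. -/
noncomputable def triangleLevel (c β x : ℝ) : ℝ := (β + x) / 2 * ((β - x) / 2) ^ c

/-- The abscissa of the fold of the saddle `(u, -cv)` on the line `v - u = β`. -/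
noncomputable def saddleFold (c β : ℝ) : ℝ := β * (1 - c) / (1 + c)

section Triangle

variable {c β : ℝ}

lemma continuous_triangleLevel (hc : 0 < c) : Continuous (triangleLevel c β) := by
  unfold triangleLevel
  have : Continuous fun x : ℝ => ((β - x) / 2) ^ c :=
    (by fun_prop : Continuous fun x : ℝ => (β - x) / 2).rpow_const fun _ => Or.inr hc.le
  fun_prop

lemma saddleFold_mem (hc : 0 < c) (hβ : 0 < β) : saddleFold c β ∈ Ioo (-β) β := by
  have h : 0 < 1 + c := by linarith
  constructor
  · rw [saddleFold, lt_div_iff₀ h]; nlinarith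
  · rw [saddleFold, div_lt_iff₀ h]; nlinarith

/-- The sign is that of `saddleFold c β - x`: the level rises up to the fold and falls after it, so
each lower positive level is taken at exactly two points, the ends of one orbit. -/
lemma deriv_triangleLevel (hc : 0 < c) {x : ℝ} (hx : x < β) :
    deriv (triangleLevel c β) x =
      ((β - x) / 2) ^ (c - 1) * ((1 + c) * (saddleFold c β - x)) / 4 := by
  have hu : 0 < (β - x) / 2 := by linarith
  have h1 : HasDerivAt (fun x : ℝ => ((β - x) / 2) ^ c)
      (-1 / 2 * c * ((β - x) / 2) ^ (c - 1)) x :=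
    (((hasDerivAt_id x).const_sub β).div_const 2).rpow_const (Or.inl hu.ne')
  have h2 : HasDerivAt (fun x : ℝ => (β + x) / 2) (1 / 2) x :=
    ((hasDerivAt_id x).const_add β).div_const 2
  have h3 : HasDerivAt (triangleLevel c β) _ x := h2.mul h1
  rw [h3.deriv]
  have h4 : ((β - x) / 2) ^ c = ((β - x) / 2) ^ (c - 1) * ((β - x) / 2) := by
    rw [← Real.rpow_add_one hu.ne']; congr 1; ring
  have h5 : (1 + c) * (saddleFold c β - x) = β * (1 - c) - (1 + c) * x := by
    have : 1 + c ≠ 0 := by linarith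
    rw [saddleFold]; field_simp
  rw [h4, h5]
  ring

lemma strictMonoOn_triangleLevel (hc : 0 < c) (hβ : 0 < β) :
    StrictMonoOn (triangleLevel c β) (Icc (-β) (saddleFold c β)) := by
  refine strictMonoOn_of_deriv_pos (convex_Icc _ _) (continuous_triangleLevel hc).continuousOn ?_
  intro x hx
  rw [interior_Icc] at hx
  have hx1 : x < β := hx.2.trans (saddleFold_mem hc hβ).2
  rw [deriv_triangleLevel hc hx1]
  have := Real.rpow_pos_of_pos (show 0 < (β - x) / 2 by linarith) (c - 1)
  have := sub_pos.2 hx.2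
  positivity

lemma strictAntiOn_triangleLevel (hc : 0 < c) :
    StrictAntiOn (triangleLevel c β) (Icc (saddleFold c β) β) := by
  refine strictAntiOn_of_deriv_neg (convex_Icc _ _) (continuous_triangleLevel hc).continuousOn ?_
  intro x hx
  rw [interior_Icc] at hx
  rw [deriv_triangleLevel hc hx.2]
  have h1 := Real.rpow_pos_of_pos (show 0 < (β - x) / 2 by linarith [hx.2]) (c - 1)
  have h2 : (1 + c) * (saddleFold c β - x) < 0 :=
    mul_neg_of_pos_of_neg (by linarith) (sub_neg.2 hx.1)
  have := mul_neg_of_pos_of_neg h1 h2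
  linarith

lemma triangleLevel_pos {x : ℝ} (hx : x ∈ Ioo (-β) β) : 0 < triangleLevel c β x :=
  mul_pos (by linarith [hx.1]) (Real.rpow_pos_of_pos (by linarith [hx.2]) _)

lemma triangleLevel_left : triangleLevel c β (-β) = 0 := by simp [triangleLevel]

lemma triangleLevel_right (hc : 0 < c) : triangleLevel c β β = 0 := by
  simp [triangleLevel, Real.zero_rpow hc.ne']

lemma triangleLevel_le (hc : 0 < c) (hβ : 0 < β) {x : ℝ} (hx : x ∈ Icc (-β) β) :
    triangleLevel c β x ≤ triangleLevel c β (saddleFold c β) := by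
  have hf := saddleFold_mem hc hβ
  rcases le_total x (saddleFold c β) with h | h
  · exact (strictMonoOn_triangleLevel hc hβ).monotoneOn ⟨hx.1, h⟩ ⟨hf.1.le, le_rfl⟩ h
  · exact (strictAntiOn_triangleLevel hc).antitoneOn ⟨le_rfl, hf.2.le⟩ ⟨h, hx.2⟩ h

/-- The signed depth of the level of `x` below the maximal level, continued affinely. -/
noncomputable def saddleDepth (c β x : ℝ) : ℝ :=
  triangleLevel c β (min (max x (-β)) (saddleFold c β)) -
    triangleLevel c β (max (min x β) (saddleFold c β)) + (min (x + β) 0 + max (x - β) 0)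

lemma saddleDepth_of_le_fold {x : ℝ} (hβ : 0 < β) (hc : 0 < c) (h1 : -β ≤ x)
    (h2 : x ≤ saddleFold c β) :
    saddleDepth c β x = triangleLevel c β x - triangleLevel c β (saddleFold c β) := by
  have hf := saddleFold_mem hc hβ
  rw [saddleDepth, max_eq_left h1, min_eq_left h2, min_eq_left (by linarith [hf.2]),
    max_eq_right h2, min_eq_right (by linarith), max_eq_right (by linarith [hf.2])]
  ring

lemma saddleDepth_of_fold_le {x : ℝ} (hβ : 0 < β) (hc : 0 < c) (h1 : saddleFold c β ≤ x)
    (h2 : x ≤ β) :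
    saddleDepth c β x = triangleLevel c β (saddleFold c β) - triangleLevel c β x := by
  have hf := saddleFold_mem hc hβ
  rw [saddleDepth, max_eq_left (by linarith [hf.1]), min_eq_right h1, min_eq_left h2,
    max_eq_left h1, min_eq_right (by linarith [hf.1]), max_eq_right (by linarith)]
  ring

lemma saddleDepth_of_le {x : ℝ} (hβ : 0 < β) (hc : 0 < c) (h : x ≤ -β) :
    saddleDepth c β x = x + β - triangleLevel c β (saddleFold c β) := by
  have hf := saddleFold_mem hc hβ
  rw [saddleDepth, max_eq_right h, min_eq_left hf.1.le, min_eq_left (by linarith),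
    max_eq_right (by linarith [hf.1]), min_eq_left (by linarith), max_eq_right (by linarith),
    triangleLevel_left]
  ring

lemma saddleDepth_of_ge {x : ℝ} (hβ : 0 < β) (hc : 0 < c) (h : β ≤ x) :
    saddleDepth c β x = x - β + triangleLevel c β (saddleFold c β) := by
  have hf := saddleFold_mem hc hβ
  rw [saddleDepth, max_eq_left (by linarith), min_eq_right (by linarith [hf.2]), min_eq_right h,
    max_eq_left hf.2.le, min_eq_right (by linarith), max_eq_left (by linarith),
    triangleLevel_right hc]
  ring

lemma exists_saddleDepth_iso (hc : 0 < c) (hβ : 0 < β) :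
    ∃ e : ℝ ≃o ℝ, ∀ x, e x = saddleDepth c β x := by
  have hf := saddleFold_mem hc hβ
  have m1 : StrictMonoOn (saddleDepth c β) (Iic (-β)) := by
    intro x hx y hy hxy
    rw [saddleDepth_of_le hβ hc hx, saddleDepth_of_le hβ hc hy]
    linarith
  have m2 : StrictMonoOn (saddleDepth c β) (Icc (-β) (saddleFold c β)) := by
    intro x hx y hy hxy
    rw [saddleDepth_of_le_fold hβ hc hx.1 hx.2, saddleDepth_of_le_fold hβ hc hy.1 hy.2]
    linarith [strictMonoOn_triangleLevel hc hβ hx hy hxy]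
  have m3 : StrictMonoOn (saddleDepth c β) (Icc (saddleFold c β) β) := by
    intro x hx y hy hxy
    rw [saddleDepth_of_fold_le hβ hc hx.1 hx.2, saddleDepth_of_fold_le hβ hc hy.1 hy.2]
    linarith [strictAntiOn_triangleLevel hc hx hy hxy]
  have m4 : StrictMonoOn (saddleDepth c β) (Ici β) := by
    intro x hx y hy hxy
    rw [saddleDepth_of_ge hβ hc hx, saddleDepth_of_ge hβ hc hy]
    linarith
  have m12 : StrictMonoOn (saddleDepth c β) (Iic (saddleFold c β)) := by
    have := m1.union m2 isGreatest_Iic (isLeast_Icc hf.1.le)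
    rwa [Iic_union_Icc_eq_Iic hf.1.le] at this
  have m34 : StrictMonoOn (saddleDepth c β) (Ici (saddleFold c β)) := by
    have := m3.union m4 (isGreatest_Icc hf.2.le) isLeast_Ici
    rwa [Icc_union_Ici_eq_Ici hf.2.le] at this
  have hm : StrictMono (saddleDepth c β) := m12.Iic_union_Ici m34
  have hcont : Continuous (saddleDepth c β) := by
    have := continuous_triangleLevel (β := β) hc
    unfold saddleDepth
    fun_prop
  have htop : Tendsto (saddleDepth c β) atTop atTop := by
    have h1 : Tendsto (fun x => x + (triangleLevel c β (saddleFold c β) - β)) atTop atTop :=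
      tendsto_atTop_add_const_right _ _ tendsto_id
    refine h1.congr' ?_
    filter_upwards [eventually_ge_atTop β] with x hx
    rw [saddleDepth_of_ge hβ hc hx]; ring
  have hbot : Tendsto (saddleDepth c β) atBot atBot := by
    have h1 : Tendsto (fun x => x + (β - triangleLevel c β (saddleFold c β))) atBot atBot :=
      tendsto_atBot_add_const_right _ _ tendsto_id
    refine h1.congr' ?_
    filter_upwards [eventually_le_atBot (-β)] with x hx
    rw [saddleDepth_of_le hβ hc hx]; ring
  exact ⟨hm.orderIsoOfSurjective _ (hcont.surjective htop hbot), fun x => rfl⟩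

/-- In the segment between the separatrices, the level is the maximal one minus the depth. -/
lemma triangleLevel_eq (hc : 0 < c) (hβ : 0 < β) {x : ℝ} (hx : x ∈ Icc (-β) β) :
    triangleLevel c β x = triangleLevel c β (saddleFold c β) - |saddleDepth c β x| := by
  have hle := triangleLevel_le hc hβ hx
  rcases le_total x (saddleFold c β) with h | h
  · rw [saddleDepth_of_le_fold hβ hc hx.1 h, abs_of_nonpos (by linarith)]; ring
  · rw [saddleDepth_of_fold_le hβ hc h hx.2, abs_of_nonneg (by linarith)]; ring

end Triangle

/-- `θ` is an odd homeomorphism of the depths that is the identity near the separatrices. -/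
structure DepthShift (c β : ℝ) (e θ : ℝ ≃o ℝ) (d : ℝ) : Prop where
  hc : 0 < c
  hβ : 0 < β
  he : ∀ x, e x = saddleDepth c β x
  odd : ∀ x, θ (-x) = -θ x
  hd0 : 0 ≤ d
  hd : d < triangleLevel c β (saddleFold c β)
  fix : ∀ x, d ≤ |x| → θ x = x

/-- The boundary map with depth shift `θ`. -/
def depthConj (e θ : ℝ ≃o ℝ) : ℝ ≃o ℝ := e.trans (θ.trans e.symm)

lemma apply_depthConj (e θ : ℝ ≃o ℝ) (x : ℝ) : e (depthConj e θ x) = θ (e x) := by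
  simp [depthConj]

lemma depthConj_symm (e θ : ℝ ≃o ℝ) : (depthConj e θ).symm = depthConj e θ.symm := rfl

/-- The induced map of the levels of the first integral. -/
noncomputable def levelShift (c β : ℝ) (θ : ℝ ≃o ℝ) (k : ℝ) : ℝ :=
  triangleLevel c β (saddleFold c β) - θ (triangleLevel c β (saddleFold c β) - k)

/-- The abscissa of the boundary point on the ray from the saddle through `z`. -/
noncomputable def rayBase (β : ℝ) (z : ℝ × ℝ) : ℝ := β * (z.1 + z.2) / (z.2 - z.1)

/-- The point at relative distance `r` on the ray from the saddle to the boundary point over `x`. -/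
noncomputable def rayPoint (β r x : ℝ) : ℝ × ℝ := (r * ((x - β) / 2), r * ((x + β) / 2))

/-- The map of the triangle between the separatrices that sends rays to rays and levels to
levels, continued by the identity. -/
noncomputable def triangleMove (c β : ℝ) (e θ : ℝ ≃o ℝ) (z : ℝ × ℝ) : ℝ × ℝ :=
  open Classical in
  if z.1 < 0 ∧ 0 < z.2 then
    rayPoint β ((levelShift c β θ (z.2 * (-z.1) ^ c) /
      levelShift c β θ (triangleLevel c β (rayBase β z))) ^ (1 / (1 + c)))
      (depthConj e θ (rayBase β z))
  else z

lemma exists_rayPoint {β : ℝ} (hβ : 0 < β) {z : ℝ × ℝ} (h1 : z.1 < 0) (h2 : 0 < z.2) :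
    ∃ r x, 0 < r ∧ x ∈ Ioo (-β) β ∧ z = rayPoint β r x ∧ r = (z.2 - z.1) / β := by
  have hm : 0 < z.2 - z.1 := by linarith
  refine ⟨(z.2 - z.1) / β, rayBase β z, div_pos hm hβ, ⟨?_, ?_⟩, Prod.ext ?_ ?_, rfl⟩
  · rw [rayBase, lt_div_iff₀ hm]; nlinarith
  · rw [rayBase, div_lt_iff₀ hm]; nlinarith
  · simp only [rayPoint, rayBase]; field_simp; ring
  · simp only [rayPoint, rayBase]; field_simp; ring

lemma rayPoint_neg_pos {β r x : ℝ} (hr : 0 < r) (hx : x ∈ Ioo (-β) β) :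
    (rayPoint β r x).1 < 0 ∧ 0 < (rayPoint β r x).2 :=
  ⟨mul_neg_of_pos_of_neg hr (by linarith [hx.2]), mul_pos hr (by linarith [hx.1])⟩

lemma rayBase_rayPoint {β r x : ℝ} (hβ : 0 < β) (hr : 0 < r) : rayBase β (rayPoint β r x) = x := by
  have : r * ((x + β) / 2) - r * ((x - β) / 2) = r * β := by ring
  simp only [rayBase, rayPoint]
  rw [this]
  field_simp
  ring

/-- The first integral is homogeneous of degree `1 + c`. This is the source of the exponent `1 / (1
+ c)` in `triangleMove`. -/
lemma level_rayPoint {c β r x : ℝ} (hr : 0 < r) (hx : x ∈ Ioo (-β) β) :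
    (rayPoint β r x).2 * (-(rayPoint β r x).1) ^ c = r ^ (1 + c) * triangleLevel c β x := by
  have h1 : -(rayPoint β r x).1 = r * ((β - x) / 2) := by simp only [rayPoint]; ring
  rw [h1, Real.mul_rpow hr.le (by linarith [hx.2]), Real.rpow_add hr, Real.rpow_one,
    triangleLevel]
  simp only [rayPoint]
  ring

lemma rayPoint_mem {β r x : ℝ} (hβ : 0 < β) : rayPoint β r x ∈ saddleHalf β ↔ r ≤ 1 := by
  simp only [rayPoint, saddleHalf, mem_ofPred_eq]
  rw [show r * ((x + β) / 2) - r * ((x - β) / 2) = r * β by ring]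
  exact mul_le_iff_le_one_left hβ

lemma rayPoint_one (β x : ℝ) : rayPoint β 1 x = saddleBoundary β x := by
  simp [rayPoint, saddleBoundary]

namespace DepthShift

variable {c β d : ℝ} {e θ : ℝ ≃o ℝ}

lemma symm (h : DepthShift c β e θ d) : DepthShift c β e θ.symm d where
  hc := h.hc
  hβ := h.hβ
  he := h.he
  odd x := by rw [OrderIso.symm_apply_eq, h.odd, OrderIso.apply_symm_apply]
  hd0 := h.hd0
  hd := h.hd
  fix x hx := by rw [OrderIso.symm_apply_eq, h.fix x hx]

lemma one_add_pos (h : DepthShift c β e θ d) : 0 < 1 + c := by linarith [h.hc]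

lemma depthConj_of_le (h : DepthShift c β e θ d) {x : ℝ} (hx : d ≤ |e x|) :
    depthConj e θ x = x := by
  apply e.injective
  rw [apply_depthConj, h.fix _ hx]

lemma depthConj_outside (h : DepthShift c β e θ d) {x : ℝ} (hx : x ≤ -β ∨ β ≤ x) :
    depthConj e θ x = x := by
  apply h.depthConj_of_le
  rw [h.he]
  have := h.hd
  rcases hx with hx | hx
  · rw [saddleDepth_of_le h.hβ h.hc hx, le_abs]
    right; linarith
  · rw [saddleDepth_of_ge h.hβ h.hc hx, le_abs]
    left; linarith

lemma depthConj_mem (h : DepthShift c β e θ d) {x : ℝ} (hx : x ∈ Ioo (-β) β) :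
    depthConj e θ x ∈ Ioo (-β) β := by
  constructor
  · rw [← h.depthConj_outside (Or.inl le_rfl)]
    exact (depthConj e θ).strictMono hx.1
  · rw [← h.depthConj_outside (Or.inr le_rfl)]
    exact (depthConj e θ).strictMono hx.2

lemma abs_apply (h : DepthShift c β e θ d) (x : ℝ) : |θ x| = θ |x| := by
  have h0 : θ 0 = 0 := by
    have := h.odd 0
    rw [neg_zero] at this
    linarith
  have hpos : ∀ x, 0 ≤ x → 0 ≤ θ x := fun x hx => by
    rw [← h0]; exact θ.monotone hx
  rcases le_total 0 x with hx | hx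
  · rw [abs_of_nonneg hx, abs_of_nonneg (hpos x hx)]
  · obtain ⟨y, rfl⟩ : ∃ y, x = -y := ⟨-x, by simp⟩
    have hy : 0 ≤ y := by linarith
    rw [h.odd, abs_neg, abs_neg, abs_of_nonneg hy, abs_of_nonneg (hpos y hy)]

/-- The level depends only on the absolute value of the depth, and `θ` is odd. So the boundary map
acts on the levels, and the two ends of an orbit remain the ends of one orbit. -/
lemma levelShift_level (h : DepthShift c β e θ d) {x : ℝ} (hx : x ∈ Ioo (-β) β) :
    levelShift c β θ (triangleLevel c β x) = triangleLevel c β (depthConj e θ x) := by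
  rw [triangleLevel_eq h.hc h.hβ (Ioo_subset_Icc_self hx),
    triangleLevel_eq h.hc h.hβ (Ioo_subset_Icc_self (h.depthConj_mem hx)), levelShift, ← h.he,
    ← h.he, apply_depthConj, h.abs_apply]
  simp

lemma levelShift_of_le (h : DepthShift c β e θ d) {k : ℝ}
    (hk : k ≤ triangleLevel c β (saddleFold c β) - d) : levelShift c β θ k = k := by
  rw [levelShift, h.fix _ (le_abs.2 (Or.inl (by linarith)))]
  ring

lemma levelShift_strictMono (c β : ℝ) (θ : ℝ ≃o ℝ) : StrictMono (levelShift c β θ) := by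
  intro a b hab
  have := θ.strictMono (show triangleLevel c β (saddleFold c β) - b <
    triangleLevel c β (saddleFold c β) - a by linarith)
  simp only [levelShift]
  linarith

lemma levelShift_pos (h : DepthShift c β e θ d) {k : ℝ} (hk : 0 < k) : 0 < levelShift c β θ k := by
  have := levelShift_strictMono c β θ hk
  rwa [h.levelShift_of_le (k := 0) (by linarith [h.hd])] at this

lemma levelShift_symm (c β : ℝ) (θ : ℝ ≃o ℝ) (k : ℝ) :
    levelShift c β θ.symm (levelShift c β θ k) = k := by
  simp [levelShift]

lemma continuous_levelShift (c β : ℝ) (θ : ℝ ≃o ℝ) : Continuous (levelShift c β θ) := by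
  have := θ.continuous
  unfold levelShift
  fun_prop

/-- The factor of the ray coordinate under `triangleMove`. -/
lemma triangleMove_rayPoint (h : DepthShift c β e θ d) {r x : ℝ} (hr : 0 < r)
    (hx : x ∈ Ioo (-β) β) : ∃ r', 0 < r' ∧ (r ≤ 1 → r' ≤ 1) ∧ (r = 1 → r' = 1) ∧
      r' ^ (1 + c) * triangleLevel c β (depthConj e θ x) =
        levelShift c β θ (r ^ (1 + c) * triangleLevel c β x) ∧
      triangleMove c β e θ (rayPoint β r x) = rayPoint β r' (depthConj e θ x) := by
  have hk := triangleLevel_pos (c := c) hx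
  have hk' := triangleLevel_pos (c := c) (h.depthConj_mem hx)
  have hrc : 0 < r ^ (1 + c) := Real.rpow_pos_of_pos hr _
  have hq := div_pos (h.levelShift_pos (mul_pos hrc hk)) hk'
  have h1c := h.one_add_pos
  refine ⟨(levelShift c β θ (r ^ (1 + c) * triangleLevel c β x) /
    triangleLevel c β (depthConj e θ x)) ^ (1 / (1 + c)), Real.rpow_pos_of_pos hq _, ?_, ?_, ?_, ?_⟩
  · intro hr1
    refine Real.rpow_le_one hq.le ?_ (by positivity)
    rw [div_le_one hk', ← h.levelShift_level hx]
    refine (levelShift_strictMono c β θ).monotone ?_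
    exact mul_le_of_le_one_left hk.le (Real.rpow_le_one hr.le hr1 h1c.le)
  · rintro rfl
    rw [Real.one_rpow, one_mul, h.levelShift_level hx, div_self hk'.ne', Real.one_rpow]
  · rw [← Real.rpow_mul hq.le, one_div_mul_cancel h1c.ne', Real.rpow_one, div_mul_cancel₀ _ hk'.ne']
  · rw [triangleMove, if_pos (rayPoint_neg_pos hr hx), level_rayPoint hr hx,
      rayBase_rayPoint h.hβ hr, h.levelShift_level hx]

lemma triangleMove_mem (h : DepthShift c β e θ d) {z : ℝ × ℝ} (hz : z ∈ saddleHalf β) :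
    triangleMove c β e θ z ∈ saddleHalf β := by
  by_cases hq : z.1 < 0 ∧ 0 < z.2
  · obtain ⟨r, x, hr, hx, rfl, -⟩ := exists_rayPoint h.hβ hq.1 hq.2
    obtain ⟨r', -, h1, -, -, h2⟩ := h.triangleMove_rayPoint hr hx
    rw [h2, rayPoint_mem h.hβ]
    exact h1 ((rayPoint_mem h.hβ).1 hz)
  · rwa [triangleMove, if_neg hq]

lemma triangleMove_leftInv (h : DepthShift c β e θ d) (z : ℝ × ℝ) :
    triangleMove c β e θ.symm (triangleMove c β e θ z) = z := by
  by_cases hq : z.1 < 0 ∧ 0 < z.2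
  · obtain ⟨r, x, hr, hx, rfl, -⟩ := exists_rayPoint h.hβ hq.1 hq.2
    obtain ⟨r', hr', -, -, h1, h2⟩ := h.triangleMove_rayPoint hr hx
    obtain ⟨r'', hr'', -, -, h3, h4⟩ := h.symm.triangleMove_rayPoint hr' (h.depthConj_mem hx)
    have hx' : depthConj e θ.symm (depthConj e θ x) = x := by
      rw [← depthConj_symm, OrderIso.symm_apply_apply]
    rw [h2, h4, hx']
    rw [hx', h1, levelShift_symm] at h3
    have h5 := mul_right_cancel₀ (triangleLevel_pos hx).ne' h3
    have h6 : r'' = r := by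
      have h1c := h.one_add_pos
      rw [← Real.rpow_rpow_inv hr''.le h1c.ne', h5, Real.rpow_rpow_inv hr.le h1c.ne']
    rw [h6]
  · rw [triangleMove, triangleMove, if_neg hq, if_neg hq]

lemma triangleMove_boundary (h : DepthShift c β e θ d) (x : ℝ) :
    triangleMove c β e θ (saddleBoundary β x) = saddleBoundary β (depthConj e θ x) := by
  by_cases hx : x ∈ Ioo (-β) β
  · obtain ⟨r', -, -, h1, -, h2⟩ := h.triangleMove_rayPoint one_pos hx
    rw [h1 rfl, rayPoint_one, rayPoint_one] at h2
    exact h2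
  · have hx' : x ≤ -β ∨ β ≤ x := by
      by_contra! hcon
      exact hx hcon
    rw [h.depthConj_outside hx', triangleMove, if_neg]
    simp only [saddleBoundary]
    rintro ⟨h1, h2⟩
    rcases hx' with h3 | h3 <;> linarith

/-- The image of an orbit stays on one level curve but is run at another speed. The correct time is
the logarithm of `p`, the absolute value of the `u`-coordinate of the image, so the point is that
`p` increases. -/
lemma triangleMove_sendsArcs (h : DepthShift c β e θ d)
    (hF : ContinuousOn (triangleMove c β e θ) (saddleHalf β)) :
    SendsArcs (triangleMove c β e θ) (IsSaddleArc c β) (IsSaddleArc c β) := by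
  rintro I γ ⟨hI, z₀, hz⟩
  have hc := h.hc
  have hβ := h.hβ
  by_cases hq : z₀.1 < 0 ∧ 0 < z₀.2
  · have hquad : ∀ t, (saddleOrbit c z₀ t).1 < 0 ∧ 0 < (saddleOrbit c z₀ t).2 := fun t =>
      ⟨mul_neg_of_neg_of_pos hq.1 (Real.exp_pos _), mul_pos hq.2 (Real.exp_pos _)⟩
    have hlev : ∀ t, (saddleOrbit c z₀ t).2 * (-(saddleOrbit c z₀ t).1) ^ c =
        z₀.2 * (-z₀.1) ^ c := by
      intro t
      simp only [saddleOrbit]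
      rw [← neg_mul, Real.mul_rpow (by linarith) (Real.exp_pos t).le, ← Real.exp_mul]
      have : Real.exp (-c * t) * Real.exp (t * c) = 1 := by
        rw [← Real.exp_add]; simp [mul_comm]
      linear_combination (z₀.2 * (-z₀.1) ^ c) * this
    have hpt : ∀ t, ∃ r x r', 0 < r ∧ x ∈ Ioo (-β) β ∧ 0 < r' ∧
        saddleOrbit c z₀ t = rayPoint β r x ∧
        r' ^ (1 + c) * triangleLevel c β (depthConj e θ x) =
          levelShift c β θ (z₀.2 * (-z₀.1) ^ c) ∧
        triangleMove c β e θ (saddleOrbit c z₀ t) = rayPoint β r' (depthConj e θ x) := by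
      intro t
      obtain ⟨r, x, hr, hx, e1, -⟩ := exists_rayPoint hβ (hquad t).1 (hquad t).2
      obtain ⟨r', hr', -, -, h1, h2⟩ := h.triangleMove_rayPoint hr hx
      refine ⟨r, x, r', hr, hx, hr', e1, ?_, by rw [e1, h2]⟩
      rw [h1, ← level_rayPoint hr hx, ← e1, hlev]
    set k' := levelShift c β θ (z₀.2 * (-z₀.1) ^ c) with hk'
    set p : ℝ → ℝ := fun t => -(triangleMove c β e θ (saddleOrbit c z₀ t)).1 with hp
    set q : ℝ → ℝ := fun t => (triangleMove c β e θ (saddleOrbit c z₀ t)).2 with hqd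
    have hp0 : ∀ t, 0 < p t := by
      intro t
      obtain ⟨r, x, r', hr, hx, hr', e1, e2, e3⟩ := hpt t
      simp only [hp, e3]
      linarith [(rayPoint_neg_pos hr' (h.depthConj_mem hx)).1]
    have hq0 : ∀ t, 0 < q t := by
      intro t
      obtain ⟨r, x, r', hr, hx, hr', e1, e2, e3⟩ := hpt t
      simp only [hqd, e3]
      exact (rayPoint_neg_pos hr' (h.depthConj_mem hx)).2
    have hpq : ∀ t, q t * p t ^ c = k' := by
      intro t
      obtain ⟨r, x, r', hr, hx, hr', e1, e2, e3⟩ := hpt t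
      simp only [hp, hqd, e3]
      rw [level_rayPoint hr' (h.depthConj_mem hx), e2]
    -- Along the orbit the base of the ray moves to the left, and `depthConj` keeps this order. On a
    -- level curve `q p^c = k'` a decrease of `p` would turn the ray the other way.
    have hmono : ∀ a b, a < b → p a < p b := by
      intro a b hab
      by_contra hcon
      rw [not_lt] at hcon
      have hqab : q a ≤ q b := by
        have h1 : p b ^ c ≤ p a ^ c := Real.rpow_le_rpow (hp0 b).le hcon hc.le
        have h2 : q a * p a ^ c = q b * p b ^ c := by rw [hpq, hpq]
        by_contra h3
        rw [not_le] at h3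
        have h4 := Real.rpow_pos_of_pos (hp0 b) c
        nlinarith [hq0 a]
      obtain ⟨r, x, r', hr, hx, hr', e1, e2, e3⟩ := hpt a
      obtain ⟨s, y, s', hs, hy, hs', f1, f2, f3⟩ := hpt b
      have hyx : y < x := by
        rw [← rayBase_rayPoint (x := y) hβ hs, ← f1, ← rayBase_rayPoint (x := x) hβ hr, ← e1]
        have ha := hquad a
        have hb := hquad b
        simp only [rayBase]
        rw [div_lt_div_iff₀ (by linarith) (by linarith)]
        have h1 : (saddleOrbit c z₀ b).1 < (saddleOrbit c z₀ a).1 := by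
          simp only [saddleOrbit]
          exact mul_lt_mul_of_neg_left (Real.exp_lt_exp.2 hab) hq.1
        have h2 : (saddleOrbit c z₀ b).2 < (saddleOrbit c z₀ a).2 := by
          simp only [saddleOrbit]
          refine mul_lt_mul_of_pos_left (Real.exp_lt_exp.2 ?_) hq.2
          nlinarith
        have h3 : -(saddleOrbit c z₀ a).1 * (saddleOrbit c z₀ b).2 <
            -(saddleOrbit c z₀ b).1 * (saddleOrbit c z₀ a).2 :=
          mul_lt_mul'' (by linarith) h2 (by linarith [ha.1]) hb.2.le
        nlinarith
      have hg : depthConj e θ y < depthConj e θ x := (depthConj e θ).strictMono hyx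
      have gx := h.depthConj_mem hx
      have gy := h.depthConj_mem hy
      simp only [hp, hqd, e3, f3, rayPoint] at hcon hqab
      have i1 : s' * (β - depthConj e θ y) ≤ r' * (β - depthConj e θ x) := by linarith
      have i2 : r' * (β + depthConj e θ x) ≤ s' * (β + depthConj e θ y) := by linarith
      have i3 : s' * (β - depthConj e θ y) * (r' * (β + depthConj e θ x)) ≤
          r' * (β - depthConj e θ x) * (s' * (β + depthConj e θ y)) :=
        mul_le_mul i1 i2 (mul_nonneg hr'.le (by linarith [gx.1]))
          (mul_nonneg hr'.le (by linarith [gx.2]))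
      have i4 : 0 < r' * s' := mul_pos hr' hs'
      have i5 : r' * s' * (2 * β * (depthConj e θ x - depthConj e θ y)) ≤ 0 := by nlinarith
      have i6 : 0 < r' * s' * (2 * β * (depthConj e θ x - depthConj e θ y)) :=
        mul_pos i4 (mul_pos (by linarith) (by linarith))
      linarith
    have hpc : ContinuousOn p I := by
      have h1 : ContinuousOn (fun t => triangleMove c β e θ (saddleOrbit c z₀ t)) I := by
        refine hF.comp (fun t _ => (hasDerivAt_saddleOrbit c z₀ t).continuousAt.continuousWithinAt)
          fun t ht => ?_
        rw [← (hz t ht).1]; exact (hz t ht).2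
      exact (continuous_fst.comp_continuousOn h1).neg
    have hsc : ContinuousOn (fun t => Real.log (p t)) I := hpc.log fun t _ => (hp0 t).ne'
    have hval : ∀ t, saddleOrbit c (-1, k') (Real.log (p t)) =
        triangleMove c β e θ (saddleOrbit c z₀ t) := by
      intro t
      have h1 : saddleOrbit c (-1, k') (Real.log (p t)) = (-p t, q t) := by
        refine Prod.ext ?_ ?_
        · simp only [saddleOrbit, Real.exp_log (hp0 t)]; ring
        · simp only [saddleOrbit]
          rw [mul_comm (-c), ← Real.rpow_def_of_pos (hp0 t), Real.rpow_neg (hp0 t).le, ← hpq t,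
            mul_inv_cancel_right₀ (Real.rpow_pos_of_pos (hp0 t) c).ne']
      rw [h1]
      exact Prod.ext (neg_neg _) rfl
    refine ⟨fun t => Real.log (p t), saddleOrbit c (-1, k'), ?_, hsc,
      ⟨(hI.isPreconnected.image _ hsc).ordConnected, (-1, k'), ?_⟩, ?_⟩
    · intro a _ b _ hab
      exact Real.log_lt_log (hp0 a) (hmono a b hab)
    · rintro _ ⟨t, ht, rfl⟩
      refine ⟨rfl, ?_⟩
      beta_reduce
      rw [hval]
      refine h.triangleMove_mem ?_
      rw [← (hz t ht).1]; exact (hz t ht).2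
    · intro t ht
      rw [(hz t ht).1, hval]
  · have hid : ∀ t, triangleMove c β e θ (saddleOrbit c z₀ t) = saddleOrbit c z₀ t := by
      intro t
      rw [triangleMove, if_neg]
      rintro ⟨h1, h2⟩
      exact hq ⟨neg_of_mul_neg_left h1 (Real.exp_pos _).le, (pos_iff_pos_of_mul_pos h2).2 (Real.exp_pos _)⟩
    refine ⟨id, γ, strictMonoOn_id, continuousOn_id, ⟨by simpa using hI, z₀, ?_⟩, fun t ht => ?_⟩
    · rw [image_id]; exact hz
    · rw [(hz t ht).1, hid, id, (hz t ht).1]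

/-- A ray whose base has a low level is fixed. Inside the half-plane its points have at most that
level, and such levels are fixed too. This gives continuity at the half-axes away from the saddle.
-/
lemma triangleMove_of_level_le (h : DepthShift c β e θ d) {z : ℝ × ℝ} (hz : z ∈ saddleHalf β)
    (hk : triangleLevel c β (rayBase β z) ≤ triangleLevel c β (saddleFold c β) - d) :
    triangleMove c β e θ z = z := by
  by_cases hq : z.1 < 0 ∧ 0 < z.2
  · obtain ⟨r, x, hr, hx, rfl, -⟩ := exists_rayPoint h.hβ hq.1 hq.2
    obtain ⟨r', hr', -, -, h1, h2⟩ := h.triangleMove_rayPoint hr hx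
    have h1c := h.one_add_pos
    have hk0 := triangleLevel_pos (c := c) hx
    rw [rayBase_rayPoint h.hβ hr] at hk
    have hgx : depthConj e θ x = x := by
      apply h.depthConj_of_le
      have := triangleLevel_eq h.hc h.hβ (Ioo_subset_Icc_self hx)
      rw [h.he]
      linarith
    have hr1 : r ^ (1 + c) ≤ 1 := Real.rpow_le_one hr.le ((rayPoint_mem h.hβ).1 hz) h1c.le
    rw [hgx, h.levelShift_of_le (by nlinarith)] at h1
    have h5 := mul_right_cancel₀ hk0.ne' h1
    have h6 : r' = r := by
      rw [← Real.rpow_rpow_inv hr'.le h1c.ne', h5, Real.rpow_rpow_inv hr.le h1c.ne']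
    rw [h2, hgx, h6]
  · rw [triangleMove, if_neg hq]

lemma continuousAt_triangleMove (h : DepthShift c β e θ d) {z : ℝ × ℝ} (h1 : z.1 < 0)
    (h2 : 0 < z.2) : ContinuousAt (triangleMove c β e θ) z := by
  have hopen : ∀ᶠ w : ℝ × ℝ in 𝓝 z, w.1 < 0 ∧ 0 < w.2 :=
    (continuous_fst.continuousAt.eventually_lt continuousAt_const h1).and
      (continuousAt_const.eventually_lt continuous_snd.continuousAt h2)
  have hray : ContinuousAt (rayBase β) z := by
    unfold rayBase
    refine ContinuousAt.div (by fun_prop) (by fun_prop) ?_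
    linarith
  obtain ⟨r, x, hr, hx, hzr, -⟩ := exists_rayPoint h.hβ h1 h2
  have hden : levelShift c β θ (triangleLevel c β (rayBase β z)) ≠ 0 := by
    rw [hzr, rayBase_rayPoint h.hβ hr]
    exact (h.levelShift_pos (triangleLevel_pos hx)).ne'
  have hpow : Continuous fun w : ℝ × ℝ => (-w.1) ^ c :=
    (by fun_prop : Continuous fun w : ℝ × ℝ => -w.1).rpow_const fun _ => Or.inr h.hc.le
  have hls := continuous_levelShift c β θ
  have hnum : Continuous fun w : ℝ × ℝ => levelShift c β θ (w.2 * (-w.1) ^ c) := by fun_prop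
  have hlev : ContinuousAt (fun w => levelShift c β θ (triangleLevel c β (rayBase β w))) z :=
    (hls.comp (continuous_triangleLevel h.hc)).continuousAt.comp hray
  have hr' := (hnum.continuousAt.div hlev hden).rpow_const (p := 1 / (1 + c))
    (Or.inr (by have := h.one_add_pos; positivity))
  have hg : ContinuousAt (fun w => depthConj e θ (rayBase β w)) z :=
    (depthConj e θ).continuous.continuousAt.comp hray
  have hF : ContinuousAt (fun w => rayPoint β ((levelShift c β θ (w.2 * (-w.1) ^ c) /
      levelShift c β θ (triangleLevel c β (rayBase β w))) ^ (1 / (1 + c)))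
      (depthConj e θ (rayBase β w))) z :=
    (hr'.mul ((hg.sub continuousAt_const).div_const 2)).prodMk
      (hr'.mul ((hg.add continuousAt_const).div_const 2))
  refine hF.congr ?_
  filter_upwards [hopen] with w hw
  rw [triangleMove, if_pos hw]

/-- This gives continuity at the saddle. There all the levels are small and unchanged while the rays
turn, so the radius changes at most by the factor that compares the levels of the old and the new
base. -/
lemma norm_triangleMove_le (h : DepthShift c β e θ d) {z : ℝ × ℝ}
    (hsmall : |(z.2 - z.1) / β| ^ (1 + c) * triangleLevel c β (saddleFold c β) ≤
      triangleLevel c β (saddleFold c β) - d) :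
    ‖triangleMove c β e θ z‖ ≤ ‖z‖ + (triangleLevel c β (saddleFold c β) /
      (triangleLevel c β (saddleFold c β) - d)) ^ (1 + c)⁻¹ * |z.2 - z.1| := by
  set M := triangleLevel c β (saddleFold c β) with hM
  have hMd : 0 < M - d := sub_pos.2 h.hd
  have hM0 : 0 < M := by linarith [h.hd0]
  have hB : 0 < M / (M - d) := div_pos hM0 hMd
  by_cases hq : z.1 < 0 ∧ 0 < z.2
  · have hm : 0 < z.2 - z.1 := by linarith
    obtain ⟨r, x, hr, hx, e1, hre⟩ := exists_rayPoint h.hβ hq.1 hq.2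
    obtain ⟨r', hr', -, -, h1, h2⟩ := h.triangleMove_rayPoint hr hx
    have h1c := h.one_add_pos
    have hk0 := triangleLevel_pos (c := c) hx
    have hg := h.depthConj_mem hx
    have hkg := triangleLevel_pos (c := c) hg
    rw [← hre, abs_of_pos hr] at hsmall
    have hkM : triangleLevel c β x ≤ M := triangleLevel_le h.hc h.hβ (Ioo_subset_Icc_self hx)
    have hrc : 0 < r ^ (1 + c) := Real.rpow_pos_of_pos hr _
    rw [h.levelShift_of_le (by nlinarith)] at h1
    -- Levels up to `M - d` are fixed. Higher ones are at most `M` and have images of at least `M -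
    -- d`.
    have hcomp : triangleLevel c β x * (M - d) ≤ M * triangleLevel c β (depthConj e θ x) := by
      rw [← h.levelShift_level hx]
      rcases le_total (triangleLevel c β x) (M - d) with h3 | h3
      · rw [h.levelShift_of_le h3]
        nlinarith [h.hd0]
      · have h4 := (levelShift_strictMono c β θ).monotone h3
        rw [h.levelShift_of_le (le_refl (M - d))] at h4
        exact mul_le_mul hkM h4 hMd.le hM0.le
    have hpow : r' ^ (1 + c) ≤ M / (M - d) * r ^ (1 + c) := by
      rw [div_mul_eq_mul_div, le_div_iff₀ hMd]
      have h5 : r' ^ (1 + c) * (M - d) * triangleLevel c β (depthConj e θ x) ≤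
          M * r ^ (1 + c) * triangleLevel c β (depthConj e θ x) := by
        calc r' ^ (1 + c) * (M - d) * triangleLevel c β (depthConj e θ x)
            = r ^ (1 + c) * (triangleLevel c β x * (M - d)) := by linear_combination (M - d) * h1
          _ ≤ r ^ (1 + c) * (M * triangleLevel c β (depthConj e θ x)) :=
              mul_le_mul_of_nonneg_left hcomp hrc.le
          _ = _ := by ring
      exact le_of_mul_le_mul_right h5 hkg
    have hle : r' ≤ (M / (M - d)) ^ (1 + c)⁻¹ * r := by
      have h6 := Real.rpow_le_rpow (Real.rpow_pos_of_pos hr' _).le hpow (inv_pos.2 h1c).le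
      rwa [Real.rpow_rpow_inv hr'.le h1c.ne', Real.mul_rpow hB.le hrc.le,
        Real.rpow_rpow_inv hr.le h1c.ne'] at h6
    have hnorm : ‖rayPoint β r' (depthConj e θ x)‖ ≤ r' * β := by
      rw [Prod.norm_def, max_le_iff, Real.norm_eq_abs, Real.norm_eq_abs, abs_le, abs_le]
      simp only [rayPoint]
      have := hg.1
      have := hg.2
      refine ⟨⟨?_, ?_⟩, ?_, ?_⟩ <;> nlinarith
    rw [e1] at hm ⊢
    rw [h2, ← e1]
    rw [← e1] at hm
    have hrβ : r * β = z.2 - z.1 := by rw [hre, div_mul_cancel₀ _ h.hβ.ne']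
    rw [abs_of_pos hm]
    calc ‖rayPoint β r' (depthConj e θ x)‖ ≤ r' * β := hnorm
      _ ≤ (M / (M - d)) ^ (1 + c)⁻¹ * r * β := mul_le_mul_of_nonneg_right hle h.hβ.le
      _ = (M / (M - d)) ^ (1 + c)⁻¹ * (z.2 - z.1) := by rw [mul_assoc, hrβ]
      _ ≤ _ := le_add_of_nonneg_left (norm_nonneg z)
  · rw [triangleMove, if_neg hq]
    exact le_add_of_nonneg_right (mul_nonneg (Real.rpow_pos_of_pos hB _).le (abs_nonneg _))

lemma continuousOn_triangleMove (h : DepthShift c β e θ d) :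
    ContinuousOn (triangleMove c β e θ) (saddleHalf β) := by
  intro z hz
  by_cases hq : z.1 < 0 ∧ 0 < z.2
  · exact (h.continuousAt_triangleMove hq.1 hq.2).continuousWithinAt
  have hFz : triangleMove c β e θ z = z := by rw [triangleMove, if_neg hq]
  by_cases hout : 0 < z.1 ∨ z.2 < 0
  · refine ContinuousAt.continuousWithinAt (continuousAt_id.congr ?_)
    have hev : ∀ᶠ w : ℝ × ℝ in 𝓝 z, 0 < w.1 ∨ w.2 < 0 := by
      rcases hout with h1 | h1
      · filter_upwards [continuousAt_const.eventually_lt continuous_fst.continuousAt h1] with w hw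
        exact Or.inl hw
      · filter_upwards [continuous_snd.continuousAt.eventually_lt continuousAt_const h1] with w hw
        exact Or.inr hw
    filter_upwards [hev] with w hw
    rw [triangleMove, if_neg]
    · rfl
    · rintro ⟨h1, h2⟩
      rcases hw with h3 | h3 <;> linarith
  push Not at hout hq
  have hMd : 0 < triangleLevel c β (saddleFold c β) - d := sub_pos.2 h.hd
  -- What remains is the boundary of the quadrant. At its corner the norm estimate applies, and on
  -- the open half-axes the level of the base of the ray is `0`, so nearby points of the half-plane
  -- are fixed.
  rcases (show 0 ≤ z.2 - z.1 by linarith [hout.1, hout.2]).eq_or_lt with hm | hm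
  · have hz0 : z = 0 := Prod.ext (by simp only [Prod.fst_zero]; linarith [hout.1, hout.2])
      (by simp only [Prod.snd_zero]; linarith [hout.1, hout.2])
    subst hz0
    have hev : ∀ᶠ w : ℝ × ℝ in 𝓝 0, |(w.2 - w.1) / β| ^ (1 + c) *
        triangleLevel c β (saddleFold c β) < triangleLevel c β (saddleFold c β) - d := by
      have hc1 : Continuous fun w : ℝ × ℝ => |(w.2 - w.1) / β| ^ (1 + c) *
          triangleLevel c β (saddleFold c β) :=
        ((by fun_prop : Continuous fun w : ℝ × ℝ => |(w.2 - w.1) / β|).rpow_const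
          fun _ => Or.inr h.one_add_pos.le).mul continuous_const
      refine hc1.continuousAt.eventually_lt continuousAt_const ?_
      simpa [Real.zero_rpow h.one_add_pos.ne'] using h.hd
    rw [ContinuousWithinAt, hFz]
    refine tendsto_nhdsWithin_of_tendsto_nhds ?_
    refine squeeze_zero_norm' (hev.mono fun w hw => h.norm_triangleMove_le hw.le) ?_
    have hc2 : Continuous fun w : ℝ × ℝ => ‖w‖ + (triangleLevel c β (saddleFold c β) /
      (triangleLevel c β (saddleFold c β) - d)) ^ (1 + c)⁻¹ * |w.2 - w.1| := by fun_prop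
    simpa using hc2.tendsto 0
  · have hray : ContinuousAt (rayBase β) z := by
      unfold rayBase
      exact ContinuousAt.div (by fun_prop) (by fun_prop) hm.ne'
    have hk0 : triangleLevel c β (rayBase β z) = 0 := by
      rcases hout.1.eq_or_lt with h1 | h1
      · have : rayBase β z = β := by
          rw [h1, sub_zero] at hm
          rw [rayBase, h1, zero_add, sub_zero]
          exact mul_div_cancel_right₀ _ hm.ne'
        rw [this, triangleLevel_right h.hc]
      · have h2 : z.2 = 0 := le_antisymm (hq h1) hout.2
        have : rayBase β z = -β := by
          rw [rayBase, h2]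
          rw [zero_sub, add_zero, div_neg, mul_div_cancel_right₀ _ h1.ne]
        rw [this, triangleLevel_left]
    have hev : ∀ᶠ w in 𝓝 z, triangleLevel c β (rayBase β w) <
        triangleLevel c β (saddleFold c β) - d := by
      have hc1 : ContinuousAt (fun w => triangleLevel c β (rayBase β w)) z :=
        (continuous_triangleLevel h.hc).continuousAt.comp hray
      refine hc1.eventually_lt continuousAt_const ?_
      rwa [hk0]
    refine continuousWithinAt_id.congr_of_eventuallyEq ?_ hFz
    filter_upwards [mem_nhdsWithin_of_mem_nhds hev, self_mem_nhdsWithin] with w hw hwL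
    exact h.triangleMove_of_level_le hwL hw.le

/-- The boundary map with depth shift `θ` extends to the half-plane. -/
theorem saddleConj (h : DepthShift c β e θ d) : SaddleConj c β β (depthConj e θ) := by
  refine ⟨triangleMove c β e θ, triangleMove c β e θ.symm, h.continuousOn_triangleMove,
    h.symm.continuousOn_triangleMove, fun z hz => h.triangleMove_mem hz,
    fun z hz => h.symm.triangleMove_mem hz, fun z _ => h.triangleMove_leftInv z,
    fun z _ => h.symm.triangleMove_leftInv z, h.triangleMove_boundary,
    fun x => by rw [depthConj_symm]; exact h.symm.triangleMove_boundary x,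
    h.triangleMove_sendsArcs h.continuousOn_triangleMove,
    h.symm.triangleMove_sendsArcs h.symm.continuousOn_triangleMove⟩

end DepthShift

/-! ### The sliding field and the pseudo equilibria. -/

/-- A small negative `μ` and parameters in (a box around) the parameter domain. -/
structure SmallParams (μ l β : ℝ) : Prop where
  hμ : -(1 / 1000) < μ
  hμ0 : μ < 0
  hl : |l| < 1
  hβ : |β| < 867 / 1000

lemma smallParams_of_mem {μ : ℝ} (hμ : -(1 / 1000) < μ) (hμ0 : μ < 0) {p : ℝ × ℝ}
    (hp : p ∈ parameterDomain) : SmallParams μ p.1 p.2 := by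
  -- A rational upper bound of `√3 / 2` that leaves room below `1` for the estimate at `x = 10`.
  have hs : Real.sqrt 3 / 2 < 867 / 1000 := by
    have : Real.sqrt 3 < 1734 / 1000 := by
      rw [Real.sqrt_lt' (by norm_num)]; norm_num
    linarith
  exact ⟨hμ, hμ0, abs_lt.2 hp.1, abs_lt.2 ⟨by linarith [hp.2.1], hp.2.2.trans hs⟩⟩

/-- The numerator of the sliding field. -/
noncomputable def slideNum (μ l β x : ℝ) : ℝ :=
  (μ - 2) / 2 * x + μ / 2 * β - (x - l) * (μ / 2 * x + (μ - 2) / 2 * β)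

/-- The denominator of the sliding field. -/
noncomputable def slideDen (μ l β x : ℝ) : ℝ := (μ - 2) / 2 * x + μ / 2 * β - (x - l)

/-- A point where a quadratic with positive leading coefficient is negative separates its two roots.
-/
lemma exists_quadratic_roots {a b c x₀ : ℝ} (ha : 0 < a) (h : a * x₀ ^ 2 + b * x₀ + c < 0) :
    ∃ P Q, P < x₀ ∧ x₀ < Q ∧ ∀ x, a * x ^ 2 + b * x + c = a * ((x - P) * (x - Q)) := by
  have hd : (2 * a * x₀ + b) ^ 2 < b ^ 2 - 4 * a * c := by nlinarith
  have hd0 : 0 ≤ b ^ 2 - 4 * a * c := (sq_nonneg _).trans hd.le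
  obtain ⟨h1, h2⟩ := abs_lt.1 (Real.lt_sqrt_of_sq_lt (by rwa [sq_abs]) :
    |2 * a * x₀ + b| < Real.sqrt (b ^ 2 - 4 * a * c))
  set s := Real.sqrt (b ^ 2 - 4 * a * c) with hs
  have hs2 : s ^ 2 = b ^ 2 - 4 * a * c := Real.sq_sqrt hd0
  refine ⟨(-b - s) / (2 * a), (-b + s) / (2 * a), ?_, ?_, fun x => ?_⟩
  · rw [div_lt_iff₀ (by linarith)]; linarith
  · rw [lt_div_iff₀ (by linarith)]; linarith
  · field_simp
    linear_combination hs2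

/-- The zeros of the numerator of the sliding field. -/
structure SlideRoots (μ l β P Q : ℝ) : Prop extends SmallParams μ l β where
  num_eq : ∀ x, slideNum μ l β x = -μ / 2 * ((x - P) * (x - Q))
  hP : P < 10
  hQ : 10 < Q

lemma SmallParams.exists_roots {μ l β : ℝ} (h : SmallParams μ l β) :
    ∃ P Q, SlideRoots μ l β P Q := by
  obtain ⟨h1, h2⟩ := abs_lt.1 h.hl
  obtain ⟨h3, h4⟩ := abs_lt.1 h.hβ
  have hμ := h.hμ
  have hμ0 := h.hμ0
  -- For `μ = 0` the value at `10` is `-10 (1 - β) - l β`, which is below `-0.46` because `1 - β >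
  -- 0.133` and `|l β| ≤ 0.867`. The terms with `μ` contribute less than `0.1`.
  have hneg : -μ / 2 * 10 ^ 2 + ((μ - 2) / 2 + l * μ / 2 - (μ - 2) / 2 * β) * 10 +
      (μ / 2 * β + l * ((μ - 2) / 2 * β)) < 0 := by
    have e1 : |l * β| ≤ 867 / 1000 := by
      rw [abs_mul]
      nlinarith [abs_nonneg l, abs_nonneg β, h.hl, h.hβ]
    obtain ⟨e2, e3⟩ := abs_le.1 e1
    have e4 : |μ * l| ≤ 1 / 1000 := by
      rw [abs_mul, abs_of_neg hμ0]; nlinarith [abs_nonneg l, h.hl]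
    have e5 : |μ * β| ≤ 1 / 1000 := by
      rw [abs_mul, abs_of_neg hμ0]; nlinarith [abs_nonneg β, h.hβ]
    have e6 : |μ * (l * β)| ≤ 1 / 1000 := by
      rw [abs_mul, abs_of_neg hμ0]; nlinarith [abs_nonneg (l * β)]
    obtain ⟨e7, e8⟩ := abs_le.1 e4
    obtain ⟨e9, e10⟩ := abs_le.1 e5
    obtain ⟨e11, e12⟩ := abs_le.1 e6
    nlinarith
  obtain ⟨P, Q, hP, hQ, hfac⟩ := exists_quadratic_roots (by linarith : 0 < -μ / 2) hneg
  refine ⟨P, Q, h, fun x => ?_, hP, hQ⟩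
  rw [← hfac, slideNum]
  ring

/-- The numerator is `X₁ Y₂ - X₂ Y₁`. At the fold of `X` only `Y₂` is left, and at the tangency of
`Y` only `-X₂ Y₁`. These two signs locate the smaller root. -/
lemma slideNum_fold (μ l β : ℝ) (hμ : μ < 0) :
    slideNum μ l β l = -((2 - μ) / 2 * (l - tangencyY μ β)) := by
  have : 2 - μ ≠ 0 := by linarith
  rw [slideNum, tangencyY]
  field_simp
  ring

lemma slideNum_tangency (μ l β : ℝ) (hμ : μ < 0) :
    slideNum μ l β (tangencyY μ β) = 2 * (1 - μ) / (2 - μ) * (β * (tangencyY μ β - l)) := by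
  have : 2 - μ ≠ 0 := by linarith
  rw [slideNum, tangencyY]
  field_simp
  ring

lemma SmallParams.abs_tangency_le {μ l β : ℝ} (h : SmallParams μ l β) :
    |tangencyY μ β| ≤ 1 / 1000 := by
  have hμ0 := h.hμ0
  rw [tangencyY, abs_div, abs_mul, abs_of_neg hμ0, abs_of_pos (by linarith : 0 < 2 - μ),
    div_le_iff₀ (by linarith)]
  nlinarith [h.hμ, h.hβ, abs_nonneg β]

namespace SlideRoots

variable {μ l β P Q : ℝ}

/-- To the left of `10`, hence of `Q`, the numerator is positive exactly to the left of `P`, so its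
sign at a test point tells on which side `P` lies. -/
lemma lt_P (h : SlideRoots μ l β P Q) {x : ℝ} (hx : x < 10) (hn : 0 < slideNum μ l β x) :
    x < P := by
  rw [h.num_eq] at hn
  by_contra hcon
  have h1 := mul_nonneg (sub_nonneg.2 (not_lt.1 hcon)) (show 0 ≤ Q - x by linarith [h.hQ])
  nlinarith [h.hμ0, mul_nonneg (show 0 ≤ -μ by linarith [h.hμ0]) h1]

lemma P_lt (h : SlideRoots μ l β P Q) {x : ℝ} (hx : x < 10) (hn : slideNum μ l β x < 0) :
    P < x := by
  rw [h.num_eq] at hn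
  by_contra hcon
  have h1 := mul_nonneg (sub_nonneg.2 (not_lt.1 hcon)) (show 0 ≤ Q - x by linarith [h.hQ])
  nlinarith [h.hμ0, mul_nonneg (show 0 ≤ -μ by linarith [h.hμ0]) h1]

lemma eq_P (h : SlideRoots μ l β P Q) {x : ℝ} (hx : x < 10) (hn : slideNum μ l β x = 0) :
    x = P := by
  rw [h.num_eq] at hn
  have h1 : -μ / 2 ≠ 0 := by linarith [h.hμ0]
  rcases mul_eq_zero.1 ((mul_eq_zero.1 hn).resolve_left h1) with h2 | h2
  · linarith
  · linarith [h.hQ]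

lemma l_lt (h : SlideRoots μ l β P Q) : l < 1 := (abs_lt.1 h.hl).2

lemma t_lt (h : SlideRoots μ l β P Q) : tangencyY μ β < 1 := by
  have := (abs_le.1 h.toSmallParams.abs_tangency_le).2
  linarith

/-- If `β ≤ 0` or the folds coincide, the smaller zero is not in the sliding or escaping region. -/
lemma P_mem_crossing (h : SlideRoots μ l β P Q) (hb : β ≤ 0 ∨ l = tangencyY μ β) :
    min l (tangencyY μ β) ≤ P ∧ P ≤ max l (tangencyY μ β) := by
  have hμ0 := h.hμ0
  have hl := slideNum_fold μ l β hμ0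
  have ht := slideNum_tangency μ l β hμ0
  have ll := h.l_lt
  have tl := h.t_lt
  have hk : 0 < 2 * (1 - μ) / (2 - μ) := div_pos (by linarith) (by linarith)
  rcases lt_trichotomy l (tangencyY μ β) with h1 | h1 | h1
  · have hb : β ≤ 0 := hb.resolve_right h1.ne
    rw [min_eq_left h1.le, max_eq_right h1.le]
    refine ⟨(h.lt_P (by linarith) (by rw [hl]; nlinarith)).le, ?_⟩
    by_contra hcon
    have h2 : slideNum μ l β (tangencyY μ β) ≤ 0 := by
      rw [ht]
      exact mul_nonpos_of_nonneg_of_nonpos hk.le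
        (mul_nonpos_of_nonpos_of_nonneg hb (by linarith))
    rcases h2.eq_or_lt with h3 | h3
    · exact hcon (h.eq_P (by linarith) h3).ge
    · exact hcon (h.P_lt (by linarith) h3).le
  · have : l = P := h.eq_P (by linarith) (by rw [hl, h1]; ring)
    rw [← h1, this, min_self, max_self]
    exact ⟨le_rfl, le_rfl⟩
  · have hb : β ≤ 0 := hb.resolve_right h1.ne'
    rw [min_eq_right h1.le, max_eq_left h1.le]
    refine ⟨?_, (h.P_lt (by linarith) (by rw [hl]; nlinarith)).le⟩
    by_contra hcon
    have h2 : 0 ≤ slideNum μ l β (tangencyY μ β) := by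
      rw [ht]
      exact mul_nonneg hk.le (mul_nonneg_of_nonpos_of_nonpos hb (by linarith))
    rcases h2.eq_or_lt with h3 | h3
    · exact hcon (h.eq_P (by linarith) h3.symm).le
    · exact hcon (h.lt_P (by linarith) h3).le

lemma t_lt_P (h : SlideRoots μ l β P Q) (hβ : 0 < β) (hl : l < tangencyY μ β) :
    tangencyY μ β < P := by
  have tl := h.t_lt
  refine h.lt_P (by linarith) ?_
  rw [slideNum_tangency μ l β h.hμ0]
  exact mul_pos (div_pos (by linarith [h.hμ0]) (by linarith [h.hμ0]))
    (mul_pos hβ (by linarith))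

lemma P_lt_t (h : SlideRoots μ l β P Q) (hβ : 0 < β) (hl : tangencyY μ β < l) :
    P < tangencyY μ β := by
  have tl := h.t_lt
  refine h.P_lt (by linarith) ?_
  rw [slideNum_tangency μ l β h.hμ0]
  exact mul_neg_of_pos_of_neg (div_pos (by linarith [h.hμ0]) (by linarith [h.hμ0]))
    (mul_neg_of_pos_of_neg hβ (by linarith))

end SlideRoots

lemma vis_X (μ l β : ℝ) (z : ℝ × ℝ) : (foldSaddleFamily .vis μ (l, β)).X z = (1, z.1 - l) := by
  simp [foldSaddleFamily, FoldType.coeffOne, FoldType.coeffTwo]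

lemma vis_Y_snd {μ : ℝ} (hμ : μ < 0) (l β : ℝ) {z : ℝ × ℝ} (hz : z.2 = 0) :
    ((foldSaddleFamily .vis μ (l, β)).Y z).2 = -((2 - μ) / 2 * (z.1 - tangencyY μ β)) := by
  have : 2 - μ ≠ 0 := by linarith
  simp only [foldSaddleFamily, hz, tangencyY]
  field_simp
  ring

/-- The abscissas of the sliding and escaping points. -/
def slideSet (μ l β : ℝ) : Set ℝ := {x | x < min l (tangencyY μ β) ∨ max l (tangencyY μ β) < x}

lemma isOpen_slideSet (μ l β : ℝ) : IsOpen (slideSet μ l β) := isOpen_Iio.union isOpen_Ioi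

section Regions

variable {μ : ℝ} (l β : ℝ)

lemma slidingRegion_eq (hμ : μ < 0) : (foldSaddleFamily .vis μ (l, β)).slidingRegion =
    {z | z.2 = 0 ∧ z.1 < min l (tangencyY μ β)} := by
  ext z
  simp only [FilippovSystem.slidingRegion, switchingManifold, mem_ofPred_eq]
  refine and_congr_right fun hz => ?_
  rw [vis_X, vis_Y_snd hμ l β hz, lt_min_iff]
  have h2 : 0 < (2 - μ) / 2 := by linarith
  refine and_congr (by simp) ?_
  constructor <;> intro h3 <;> nlinarith

lemma escapingRegion_eq (hμ : μ < 0) : (foldSaddleFamily .vis μ (l, β)).escapingRegion =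
    {z | z.2 = 0 ∧ max l (tangencyY μ β) < z.1} := by
  ext z
  simp only [FilippovSystem.escapingRegion, switchingManifold, mem_ofPred_eq]
  refine and_congr_right fun hz => ?_
  rw [vis_X, vis_Y_snd hμ l β hz, max_lt_iff]
  have h2 : 0 < (2 - μ) / 2 := by linarith
  refine and_congr (by simp) ?_
  rw [neg_lt_zero, mul_pos_iff_of_pos_left h2, sub_pos]

lemma crossingRegion_eq (hμ : μ < 0) : (foldSaddleFamily .vis μ (l, β)).crossingRegion =
    {z | z.2 = 0 ∧ min l (tangencyY μ β) < z.1 ∧ z.1 < max l (tangencyY μ β)} := by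
  ext z
  simp only [FilippovSystem.crossingRegion, switchingManifold, mem_ofPred_eq]
  refine and_congr_right fun hz => ?_
  rw [vis_X, vis_Y_snd hμ l β hz, min_lt_iff, lt_max_iff]
  have h2 : 0 < (2 - μ) / 2 := by linarith
  have e : (1, z.1 - l).2 * -((2 - μ) / 2 * (z.1 - tangencyY μ β)) =
      (2 - μ) / 2 * ((z.1 - l) * (tangencyY μ β - z.1)) := by simp only; ring
  rw [e, mul_pos_iff_of_pos_left h2, mul_pos_iff, sub_pos, sub_pos, sub_neg, sub_neg]
  constructor
  · rintro (⟨h3, h4⟩ | ⟨h3, h4⟩)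
    · exact ⟨Or.inl h3, Or.inr h4⟩
    · exact ⟨Or.inr h4, Or.inl h3⟩
  · rintro ⟨h3 | h3, h4 | h4⟩
    · exact absurd h3 h4.not_gt
    · exact Or.inl ⟨h3, h4⟩
    · exact Or.inr ⟨h4, h3⟩
    · exact absurd h3 h4.not_gt

lemma slide_union_eq (hμ : μ < 0) : (foldSaddleFamily .vis μ (l, β)).escapingRegion ∪
    (foldSaddleFamily .vis μ (l, β)).slidingRegion = {z | z.2 = 0 ∧ z.1 ∈ slideSet μ l β} := by
  rw [escapingRegion_eq l β hμ, slidingRegion_eq l β hμ]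
  ext z
  simp only [slideSet, mem_union, mem_ofPred_eq]
  tauto

lemma slidingField_eq (x : ℝ) : (foldSaddleFamily .vis μ (l, β)).slidingField (x, 0) =
    (slideNum μ l β x / slideDen μ l β x, 0) := by
  rw [FilippovSystem.slidingField, vis_X]
  refine Prod.ext ?_ ?_
  · simp only [foldSaddleFamily, slideNum, slideDen, Prod.fst_sub, Prod.smul_fst, smul_eq_mul]
    ring
  · simp only [foldSaddleFamily, Prod.snd_sub, Prod.smul_snd, smul_eq_mul]
    ring

lemma slideDen_eq (hμ : μ < 0) (x : ℝ) :
    slideDen μ l β x = -((2 - μ) / 2 * (x - tangencyY μ β)) - (x - l) := by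
  have : 2 - μ ≠ 0 := by linarith
  rw [slideDen, tangencyY]
  field_simp
  ring

lemma slideDen_neg (hμ : μ < 0) {x : ℝ} (hx : max l (tangencyY μ β) < x) :
    slideDen μ l β x < 0 := by
  rw [max_lt_iff] at hx
  rw [slideDen_eq l β hμ]
  nlinarith [hx.1, hx.2]

lemma slideDen_pos (hμ : μ < 0) {x : ℝ} (hx : x < min l (tangencyY μ β)) :
    0 < slideDen μ l β x := by
  rw [lt_min_iff] at hx
  rw [slideDen_eq l β hμ]
  nlinarith [hx.1, hx.2]

lemma slideDen_ne_zero (hμ : μ < 0) {x : ℝ} (hx : x ∈ slideSet μ l β) : slideDen μ l β x ≠ 0 := by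
  rcases hx with hx | hx
  · exact (slideDen_pos l β hμ hx).ne'
  · exact (slideDen_neg l β hμ hx).ne

lemma continuous_slideDen : Continuous (slideDen μ l β) := by
  unfold slideDen; fun_prop

end Regions

/-- The sign of `r` near the simple zero decides. A repeller is an attractor of `-f` with time
reversed. -/
lemma isSlidingAttractor_of_factor {Z : FilippovSystem} {S : Set ℝ} {f r : ℝ → ℝ} {q : ℝ}
    (hS : Z.escapingRegion ∪ Z.slidingRegion = {z | z.2 = 0 ∧ z.1 ∈ S})
    (hf : ∀ x ∈ S, Z.slidingField (x, 0) = (f x, 0)) (hopen : IsOpen S) (hq : q ∈ S)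
    (hfac : ∀ x ∈ S, f x = (x - q) * r x) (hr : ContinuousOn r S) :
    (r q < 0 → Z.IsSlidingAttractor (q, 0)) ∧ (0 < r q → Z.IsSlidingRepeller (q, 0)) := by
  have hdist : ∀ z ∈ switchingManifold, dist z ((q, 0) : ℝ × ℝ) = |z.1 - q| := by
    rintro ⟨x, y⟩ hz
    obtain rfl : y = 0 := hz
    simp [Prod.dist_eq, Real.dist_eq]
  have hnhd : ∀ r' : ℝ → ℝ, ContinuousOn r' S → r' q < 0 → ∃ δ > 0, ∀ x, |x - q| < δ →
      x ∈ S ∧ r' x < 0 := by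
    intro r' hr' hneg
    have h1 : ∀ᶠ x in 𝓝 q, x ∈ S ∧ r' x < 0 :=
      Filter.Eventually.and (hopen.mem_nhds hq)
        (((hr'.continuousAt (hopen.mem_nhds hq))).eventually_lt continuousAt_const hneg)
    obtain ⟨δ, hδ, h2⟩ := Metric.eventually_nhds_iff.1 h1
    exact ⟨δ, hδ, fun x hx => h2 (by rwa [Real.dist_eq])⟩
  constructor
  · intro hneg ε hε
    obtain ⟨δ, hδ, hδ'⟩ := hnhd r hr hneg
    refine ⟨min δ ε, lt_min hδ hε, fun z hz hzd => ?_⟩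
    rw [hdist z hz, lt_min_iff] at hzd
    obtain ⟨γ, h1, h2, h3, h4⟩ := exists_solution_to_attractor
      (fun x hx => hfac x (hδ' x hx).1) (hr.mono fun x hx => (hδ' x hx).1)
      (fun x hx => (hδ' x hx).2) hzd.1
    have hin : ∀ t ∈ Ici (0 : ℝ), γ t ∈ S := fun t ht => (hδ' _ ((h3 t ht).trans_lt hzd.1)).1
    refine ⟨fun t => (γ t, 0), ⟨ordConnected_Ici, fun t ht => ?_⟩, ?_, fun t ht => ?_, ?_⟩
    · rw [hS]
      refine ⟨⟨rfl, hin t ht⟩, ?_⟩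
      rw [hf _ (hin t ht)]
      exact ((h1 t ht).prodMk (hasDerivAt_const t 0)).hasDerivWithinAt
    · exact Prod.ext h2 (Eq.symm hz)
    · rw [hdist _ (show ((γ t, 0) : ℝ × ℝ) ∈ switchingManifold from rfl)]
      exact (h3 t ht).trans_lt hzd.2
    · exact h4.prodMk_nhds tendsto_const_nhds
  · intro hpos ε hε
    obtain ⟨δ, hδ, hδ'⟩ := hnhd (fun x => -r x) hr.neg (by linarith)
    refine ⟨min δ ε, lt_min hδ hε, fun z hz hzd => ?_⟩
    rw [hdist z hz, lt_min_iff] at hzd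
    obtain ⟨γ, h1, h2, h3, h4⟩ := exists_solution_to_attractor (f := fun x => -f x)
      (r := fun x => -r x) (fun x hx => by rw [hfac x (hδ' x hx).1]; ring)
      (hr.neg.mono fun x hx => (hδ' x hx).1) (fun x hx => (hδ' x hx).2) hzd.1
    have hneg : ∀ {t : ℝ}, t ∈ Iic (0 : ℝ) → -t ∈ Ici (0 : ℝ) := fun ht => by
      simpa using ht
    have hin : ∀ t ∈ Iic (0 : ℝ), γ (-t) ∈ S := fun t ht =>
      (hδ' _ ((h3 _ (hneg ht)).trans_lt hzd.1)).1
    refine ⟨fun t => (γ (-t), 0), ⟨ordConnected_Iic, fun t ht => ?_⟩, ?_, fun t ht => ?_, ?_⟩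
    · rw [hS]
      refine ⟨⟨rfl, hin t ht⟩, ?_⟩
      rw [hf _ (hin t ht)]
      have h5 : HasDerivAt (fun t => γ (-t)) (-f (γ (-t)) * -1) t :=
        (h1 _ (hneg ht)).comp t (hasDerivAt_neg t)
      have h6 : -f (γ (-t)) * -1 = f (γ (-t)) := by ring
      rw [h6] at h5
      exact (h5.prodMk (hasDerivAt_const t 0)).hasDerivWithinAt
    · exact Prod.ext (by simpa using h2) (Eq.symm hz)
    · rw [hdist _ (show ((γ (-t), 0) : ℝ × ℝ) ∈ switchingManifold from rfl)]
      exact (h3 _ (hneg ht)).trans_lt hzd.2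
    · exact (h4.comp tendsto_neg_atBot_atTop).prodMk_nhds tendsto_const_nhds

namespace SlideRoots

variable {μ l β P Q : ℝ}

lemma Q_gt (h : SlideRoots μ l β P Q) : max l (tangencyY μ β) < Q := by
  have := h.l_lt
  have := h.t_lt
  have := h.hQ
  exact max_lt (by linarith) (by linarith)

lemma isPseudoEquilibrium_iff (h : SlideRoots μ l β P Q) (z : ℝ × ℝ) :
    (foldSaddleFamily .vis μ (l, β)).IsPseudoEquilibrium z ↔
      z = (Q, 0) ∨ P ∈ slideSet μ l β ∧ z = (P, 0) := by
  rw [FilippovSystem.IsPseudoEquilibrium, slide_union_eq l β h.hμ0]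
  obtain ⟨x, y⟩ := z
  have hμ : -μ / 2 ≠ 0 := by linarith [h.hμ0]
  constructor
  · rintro ⟨⟨hy, hx⟩, h0⟩
    obtain rfl : y = 0 := hy
    rw [slidingField_eq] at h0
    have h1 : slideNum μ l β x / slideDen μ l β x = 0 := congrArg Prod.fst h0
    rw [div_eq_zero_iff, or_iff_left (slideDen_ne_zero l β h.hμ0 hx), h.num_eq, mul_eq_zero,
      or_iff_right hμ, mul_eq_zero, sub_eq_zero, sub_eq_zero] at h1
    rcases h1 with rfl | rfl
    · exact Or.inr ⟨hx, rfl⟩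
    · exact Or.inl rfl
  · rintro (h1 | ⟨hx, h1⟩)
    · obtain ⟨rfl, rfl⟩ := Prod.mk.inj h1
      refine ⟨⟨rfl, Or.inr h.Q_gt⟩, ?_⟩
      rw [slidingField_eq, h.num_eq]
      simp
    · obtain ⟨rfl, rfl⟩ := Prod.mk.inj h1
      refine ⟨⟨rfl, hx⟩, ?_⟩
      rw [slidingField_eq, h.num_eq]
      simp

/-- The roots appear as `R` and `R'` so that the criterion can be applied to `P` and to `Q` alike.
-/
lemma stability (h : SlideRoots μ l β P Q) {R R' : ℝ}
    (hR : ∀ x, slideNum μ l β x = -μ / 2 * ((x - R) * (x - R'))) (hRS : R ∈ slideSet μ l β) :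
    ((R - R') * (-μ / 2 / slideDen μ l β R) < 0 →
      (foldSaddleFamily .vis μ (l, β)).IsSlidingAttractor (R, 0)) ∧
    (0 < (R - R') * (-μ / 2 / slideDen μ l β R) →
      (foldSaddleFamily .vis μ (l, β)).IsSlidingRepeller (R, 0)) := by
  refine isSlidingAttractor_of_factor (slide_union_eq l β h.hμ0)
    (f := fun x => slideNum μ l β x / slideDen μ l β x) (fun x _ => slidingField_eq l β x)
    (r := fun x => (x - R') * (-μ / 2 / slideDen μ l β x))
    (isOpen_slideSet μ l β) hRS (fun x _ => ?_) ?_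
  · rw [hR]; ring
  · have := continuous_slideDen (μ := μ) l β
    exact (by fun_prop : Continuous fun x => x - R').continuousOn.mul
      (continuousOn_const.div this.continuousOn fun x hx => slideDen_ne_zero l β h.hμ0 hx)

lemma isSigmaSaddle (h : SlideRoots μ l β P Q) :
    (foldSaddleFamily .vis μ (l, β)).IsSigmaSaddle (Q, 0) := by
  refine ⟨(h.isPseudoEquilibrium_iff _).2 (Or.inl rfl), Or.inl ⟨?_, ?_⟩⟩
  · rw [escapingRegion_eq l β h.hμ0]
    exact ⟨rfl, h.Q_gt⟩
  · refine (h.stability (R := Q) (R' := P) (fun x => by rw [h.num_eq]; ring)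
      (Or.inr h.Q_gt)).1 ?_
    exact mul_neg_of_pos_of_neg (by linarith [h.hP, h.hQ])
      (div_neg_of_pos_of_neg (by linarith [h.hμ0]) (slideDen_neg l β h.hμ0 h.Q_gt))

lemma isSigmaRepeller (h : SlideRoots μ l β P Q) (hβ : 0 < β) (hl : l < tangencyY μ β) :
    (foldSaddleFamily .vis μ (l, β)).IsSigmaRepeller (P, 0) := by
  have hP := h.t_lt_P hβ hl
  have hP' : max l (tangencyY μ β) < P := by rwa [max_eq_right hl.le]
  refine ⟨(h.isPseudoEquilibrium_iff _).2 (Or.inr ⟨Or.inr hP', rfl⟩), ?_, ?_⟩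
  · rw [escapingRegion_eq l β h.hμ0]
    exact ⟨rfl, hP'⟩
  · refine (h.stability (R := P) (R' := Q) h.num_eq (Or.inr hP')).2 ?_
    exact mul_pos_of_neg_of_neg (by linarith [h.hP, h.hQ])
      (div_neg_of_pos_of_neg (by linarith [h.hμ0]) (slideDen_neg l β h.hμ0 hP'))

lemma isSigmaAttractor (h : SlideRoots μ l β P Q) (hβ : 0 < β) (hl : tangencyY μ β < l) :
    (foldSaddleFamily .vis μ (l, β)).IsSigmaAttractor (P, 0) := by
  have hP := h.P_lt_t hβ hl
  have hP' : P < min l (tangencyY μ β) := by rwa [min_eq_right hl.le]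
  refine ⟨(h.isPseudoEquilibrium_iff _).2 (Or.inr ⟨Or.inl hP', rfl⟩), ?_, ?_⟩
  · rw [slidingRegion_eq l β h.hμ0]
    exact ⟨rfl, hP'⟩
  · refine (h.stability (R := P) (R' := Q) h.num_eq (Or.inl hP')).1 ?_
    exact mul_neg_of_neg_of_pos (by linarith [h.hP, h.hQ])
      (div_pos (by linarith [h.hμ0]) (slideDen_pos l β h.hμ0 hP'))

end SlideRoots

lemma sign_sub_of_strictMono {g : ℝ → ℝ} (hg : StrictMono g) (x a : ℝ) :
    SignType.sign (x - a) = SignType.sign (g x - g a) := by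
  rcases lt_trichotomy x a with h | rfl | h
  · rw [sign_neg (sub_neg.2 h), sign_neg (sub_neg.2 (hg h))]
  · simp
  · rw [sign_pos (sub_pos.2 h), sign_pos (sub_pos.2 (hg h))]

namespace SlideRoots

variable {μ l β P Q l' β' P' Q' : ℝ}

/-- This is the partial fraction decomposition of `slideDen / slideNum`, an affine function over a
quadratic. As `Real.log` is the logarithm of the absolute value, one formula serves on every
interval between the roots. -/
lemma hasDerivAt_time (h : SlideRoots μ l β P Q) {x : ℝ} (hx : slideNum μ l β x / slideDen μ l β x ≠ 0) :
    HasDerivAt (fun x => (slideDen μ l β P * Real.log (x - P) - slideDen μ l β Q * Real.log (x - Q)) /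
      (-μ / 2 * (P - Q))) (slideNum μ l β x / slideDen μ l β x)⁻¹ x := by
  have hμ : μ ≠ 0 := h.hμ0.ne
  have hPQ : P - Q ≠ 0 := by linarith [h.hP, h.hQ]
  obtain ⟨hn, hd⟩ := div_ne_zero_iff.1 hx
  have hxP : x - P ≠ 0 := by
    intro h0
    exact hn (by rw [h.num_eq, h0]; ring)
  have hxQ : x - Q ≠ 0 := by
    intro h0
    exact hn (by rw [h.num_eq, h0]; ring)
  have h1 := (((((hasDerivAt_id x).sub_const P).log hxP).const_mul (slideDen μ l β P)).sub
    ((((hasDerivAt_id x).sub_const Q).log hxQ).const_mul (slideDen μ l β Q))).div_const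
      (-μ / 2 * (P - Q))
  refine h1.congr_deriv ?_
  rw [inv_div, h.num_eq]
  simp only [id, slideDen]
  field_simp
  ring

lemma mapsTo_slideSet {g : ℝ → ℝ} (hg : StrictMono g) (gl : g l = l')
    (gt : g (tangencyY μ β) = tangencyY μ β') :
    MapsTo g (slideSet μ l β) (slideSet μ l' β') := by
  intro x hx
  rw [slideSet, ← gl, ← gt, ← hg.monotone.map_min, ← hg.monotone.map_max]
  exact hx.imp (fun h => hg h) (fun h => hg h)

lemma sendsArcs_sliding (h : SlideRoots μ l β P Q) (h' : SlideRoots μ l' β' P' Q') {g : ℝ → ℝ}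
    (hg : StrictMono g) (hgc : Continuous g) (gl : g l = l')
    (gt : g (tangencyY μ β) = tangencyY μ β') (gQ : g Q = Q')
    (hP : g P = P' ∨ P ∉ slideSet μ l β ∧ P' ∉ slideSet μ l' β')
    {H : ℝ × ℝ → ℝ × ℝ} (hH : ∀ x, H (x, 0) = (g x, 0)) :
    SendsArcs H (foldSaddleFamily .vis μ (l, β)).IsSlidingArc
      (foldSaddleFamily .vis μ (l', β')).IsSlidingArc := by
  have hμ := h.hμ0
  have hmaps := mapsTo_slideSet (μ := μ) hg gl gt
  have ha : -μ / 2 ≠ 0 := by linarith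
  have hfac : ∀ {l β P Q : ℝ}, SlideRoots μ l β P Q → ∀ x,
      slideNum μ l β x / slideDen μ l β x = (x - P) * (x - Q) * (-μ / 2 / slideDen μ l β x) := by
    intro l β P Q h x
    rw [h.num_eq]; ring
  refine _root_.sendsArcs_sliding (slide_union_eq l β hμ) (slide_union_eq l' β' hμ)
    (fun x _ => slidingField_eq l β x) (fun x _ => slidingField_eq l' β' x)
    (fun x _ => hfac h x)
    (continuousOn_const.div (continuous_slideDen l β).continuousOn
      fun x hx => slideDen_ne_zero l β hμ hx)
    (fun x hx => div_ne_zero ha (slideDen_ne_zero l β hμ hx))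
    (fun x _ hx => h'.hasDerivAt_time hx) hg hgc hmaps (fun x hx => ?_) hH
  rw [hfac h, hfac h']
  simp only [sign_mul]
  have e1 : SignType.sign (x - Q) = SignType.sign (g x - Q') := by
    rw [← gQ]; exact sign_sub_of_strictMono hg x Q
  have e2 : SignType.sign (x - P) = SignType.sign (g x - P') := by
    rcases hP with hP | ⟨hP, hP'⟩
    · rw [← hP]; exact sign_sub_of_strictMono hg x P
    -- Here `P` and `P'` lie between the two folds of their systems, so the signs of `x - P` and `g
    -- x - P'` depend only on whether `x` is a sliding or an escaping point.
    · simp only [slideSet, mem_ofPred_eq, not_or, not_lt] at hP hP'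
      have emin : g (min l (tangencyY μ β)) = min l' (tangencyY μ β') := by
        rw [hg.monotone.map_min, gl, gt]
      have emax : g (max l (tangencyY μ β)) = max l' (tangencyY μ β') := by
        rw [hg.monotone.map_max, gl, gt]
      rcases hx with hx | hx
      · have := hg hx
        rw [sign_neg (by linarith), sign_neg (by linarith)]
      · have := hg hx
        rw [sign_pos (by linarith), sign_pos (by linarith)]
  have e3 : SignType.sign (-μ / 2 / slideDen μ l β x) =
      SignType.sign (-μ / 2 / slideDen μ l' β' (g x)) := by
    have hpos : 0 < -μ / 2 := by linarith
    rcases hx with hx | hx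
    · have hx' : g x < min l' (tangencyY μ β') := by
        rw [← gl, ← gt, ← hg.monotone.map_min]; exact hg hx
      rw [sign_pos (div_pos hpos (slideDen_pos l β hμ hx)),
        sign_pos (div_pos hpos (slideDen_pos l' β' hμ hx'))]
    · have hx' : max l' (tangencyY μ β') < g x := by
        rw [← gl, ← gt, ← hg.monotone.map_max]; exact hg hx
      rw [sign_neg (div_neg_of_pos_of_neg hpos (slideDen_neg l β hμ hx)),
        sign_neg (div_neg_of_pos_of_neg hpos (slideDen_neg l' β' hμ hx'))]
  rw [e1, e2, e3]

/-- A conjugacy of the saddles that respects the folds and the pseudo equilibria extends to a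
`Σ`-equivalence. -/
theorem sigmaEquivalent (h : SlideRoots μ l β P Q) (h' : SlideRoots μ l' β' P' Q') {g : ℝ ≃o ℝ}
    (hg : SaddleConj (1 - μ) β β' g) (gl : g l = l')
    (gt : g (tangencyY μ β) = tangencyY μ β') (gQ : g Q = Q')
    (hP : g P = P' ∨ P ∉ slideSet μ l β ∧ P' ∉ slideSet μ l' β') :
    SigmaEquivalent (foldSaddleFamily .vis μ (l, β)) (foldSaddleFamily .vis μ (l', β')) := by
  refine sigmaEquivalent_of_halfConj (halfConj_upper gl) hg.halfConj
    (fun H hH => h.sendsArcs_sliding h' g.strictMono g.continuous gl gt gQ hP hH)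
    (fun H hH => h'.sendsArcs_sliding h g.symm.strictMono g.symm.continuous
      (by rw [← gl, g.symm_apply_apply]) (by rw [← gt, g.symm_apply_apply])
      (by rw [← gQ, g.symm_apply_apply]) (hP.imp (fun e => by rw [← e, g.symm_apply_apply])
        And.symm) hH)

end SlideRoots

/-! ### Moving marked points of the boundary. -/

lemma saddleFold_eq_tangencyY (μ β : ℝ) : saddleFold (1 - μ) β = tangencyY μ β := by
  rw [saddleFold, tangencyY, show β * (1 - (1 - μ)) = μ * β by ring, show 1 + (1 - μ) = 2 - μ by ring]

/-- A point of the base of the triangle has a lower level than the points on the other side of the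
fold which are at most half as far from the fold. -/
lemma triangleLevel_lt_of_half {c β s σ : ℝ} (hc : 1 ≤ c) (hc2 : c < 2) (hβ : 0 < β)
    (hσ : σ = 1 ∨ σ = -1) (hs : 0 < s) (hm : saddleFold c β + σ * s ∈ Ioo (-β) β) :
    saddleFold c β - σ * s / 2 ∈ Ioo (-β) β ∧
      triangleLevel c β (saddleFold c β + σ * s) < triangleLevel c β (saddleFold c β - σ * s / 2) := by
  have hf := saddleFold_mem (by linarith : 0 < c) hβ
  set t := saddleFold c β with ht
  -- With `A = β + t` one has `β - t = c A`. Up to a constant the logarithm of the level at the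
  -- offset `y` from the fold is then `log (A + y) + c log (c A - y)`, with derivative `-(1 + c) y /
  -- ((A + y) (c A - y))`.
  obtain ⟨A, hA⟩ : ∃ A, A = β + t := ⟨_, rfl⟩
  have hB : β - t = c * A := by
    rw [hA, ht, saddleFold]; field_simp; ring
  have hA0 : 0 < A := by linarith [hf.1]
  have hσ2 : σ ^ 2 = 1 := by rcases hσ with rfl | rfl <;> norm_num
  -- `c < 2` keeps the opposite point at half the distance inside the triangle. The last inequality
  -- compares the denominators at the two points and makes the difference of the logarithms increase
  -- with the offset.
  have hpos : ∀ x, 0 ≤ x → x ≤ s → 0 < A + σ * x ∧ 0 < c * A - σ * x ∧ 0 < A - σ * x / 2 ∧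
      0 < c * A + σ * x / 2 ∧
      (A + σ * x) * (c * A - σ * x) < 4 * ((A - σ * x / 2) * (c * A + σ * x / 2)) := by
    intro x hx hxs
    have h1 := hm.1
    have h2 := hm.2
    have h3 : A ≤ c * A := by nlinarith
    have h4 : c * A < 2 * A := by nlinarith
    rcases hσ with rfl | rfl
    · refine ⟨by linarith, by linarith, by linarith, by linarith, ?_⟩
      nlinarith [mul_pos hA0 (by linarith : 0 < 2 * A - c * A),
        mul_nonneg (by linarith : 0 ≤ c * A - x) (by linarith : 0 ≤ c * A - A)]
    · refine ⟨by linarith, by linarith, by linarith, by linarith, ?_⟩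
      nlinarith [mul_nonneg hx (by linarith : 0 ≤ c * A - A), mul_pos hA0 (by linarith : 0 < c * A)]
  have hder : ∀ x, 0 ≤ x → x ≤ s → HasDerivAt
      (fun x => (Real.log (A - σ * x / 2) + c * Real.log (c * A + σ * x / 2)) -
        (Real.log (A + σ * x) + c * Real.log (c * A - σ * x)))
      ((-(σ * 1 / 2) / (A - σ * x / 2) + c * ((σ * 1 / 2) / (c * A + σ * x / 2))) -
        ((σ * 1) / (A + σ * x) + c * (-(σ * 1) / (c * A - σ * x)))) x := by
    intro x hx hxs
    obtain ⟨h1, h2, h3, h4, -⟩ := hpos x hx hxs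
    have d := (hasDerivAt_id x).const_mul σ
    exact (((((d.div_const 2).const_sub A).log h3.ne').add
      ((((d.div_const 2).const_add (c * A)).log h4.ne').const_mul c))).sub
      (((d.const_add A).log h1.ne').add (((d.const_sub (c * A)).log h2.ne').const_mul c))
  have hmono := strictMonoOn_of_deriv_pos (convex_Icc 0 s)
    (fun x hx => (hder x hx.1 hx.2).continuousAt.continuousWithinAt) (fun x hx => by
      rw [interior_Icc] at hx
      obtain ⟨h1, h2, h3, h4, h5⟩ := hpos x hx.1.le hx.2.le
      rw [(hder x hx.1.le hx.2.le).deriv]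
      have e : ((-(σ * 1 / 2) / (A - σ * x / 2) + c * ((σ * 1 / 2) / (c * A + σ * x / 2))) -
        ((σ * 1) / (A + σ * x) + c * (-(σ * 1) / (c * A - σ * x)))) =
          σ ^ 2 * ((1 + c) * x * (1 / ((A + σ * x) * (c * A - σ * x)) -
            1 / (4 * ((A - σ * x / 2) * (c * A + σ * x / 2))))) := by
        have k : ∀ {p q r w : ℝ}, 0 < p → 0 < q → 0 < r → 0 < w →
            (-(σ * 1 / 2) / r + c * ((σ * 1 / 2) / w)) - ((σ * 1) / p + c * (-(σ * 1) / q)) =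
              σ * ((c * p - q) * (1 / (p * q)) + 2 * (c * r - w) * (1 / (4 * (r * w)))) := by
          intro p q r w hp hq hr hw
          field_simp
          ring
        rw [k h1 h2 h3 h4]
        ring
      rw [e, hσ2, one_mul]
      have h6 := one_div_lt_one_div_of_lt (mul_pos h1 h2) h5
      exact mul_pos (mul_pos (by linarith) hx.1) (by linarith))
  have hlt := hmono ⟨le_rfl, hs.le⟩ ⟨hs.le, le_rfl⟩ hs
  simp only [mul_zero, zero_div, sub_zero, add_zero, sub_self] at hlt
  obtain ⟨h1, h2, h3, h4, -⟩ := hpos s hs.le le_rfl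
  have hm' : t - σ * s / 2 ∈ Ioo (-β) β := ⟨by linarith, by linarith⟩
  refine ⟨hm', (Real.log_lt_log_iff (triangleLevel_pos hm) (triangleLevel_pos hm')).1 ?_⟩
  have hlog : ∀ x, x ∈ Ioo (-β) β → Real.log (triangleLevel c β x) =
      Real.log (β + x) - Real.log 2 + c * (Real.log (β - x) - Real.log 2) := by
    intro x hx
    have k1 : 0 < β + x := by linarith [hx.1]
    have k2 : 0 < β - x := by linarith [hx.2]
    rw [triangleLevel, Real.log_mul (by positivity) (by positivity), Real.log_rpow (by positivity),
      Real.log_div k1.ne' two_ne_zero, Real.log_div k2.ne' two_ne_zero]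
  rw [hlog _ hm, hlog _ hm']
  have e1 : β + (t + σ * s) = A + σ * s := by rw [hA]; ring
  have e2 : β - (t + σ * s) = c * A - σ * s := by rw [← hB]; ring
  have e3 : β + (t - σ * s / 2) = A - σ * s / 2 := by rw [hA]; ring
  have e4 : β - (t - σ * s / 2) = c * A + σ * s / 2 := by rw [← hB]; ring
  rw [e1, e2, e3, e4]
  linarith

lemma triangleLevel_smul {c β k x : ℝ} (hk : 0 < k) (hx : x ≤ β) :
    triangleLevel c (k * β) (k * x) = k ^ (1 + c) * triangleLevel c β x := by
  rw [triangleLevel, triangleLevel, show (k * β - k * x) / 2 = k * ((β - x) / 2) by ring,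
    Real.mul_rpow hk.le (by linarith), Real.rpow_add hk, Real.rpow_one]
  ring

lemma exists_rightMove {c β s a a' : ℝ} (hc : 0 < c) (hs : β ≤ s) (ht : β * (1 - c) ≤ (1 + c) * s)
    (ha : s < a) (ha' : s < a') :
    ∃ g : ℝ ≃o ℝ, SaddleConj c β β g ∧ (∀ x ≤ s, g x = x) ∧ g a = a' := by
  -- The stretching may start at any `r` between `s` and both points. The factor `(a' - r) / (a -
  -- r)` then takes `a` to `a'`.
  obtain ⟨r, hr, hr'⟩ := exists_between (lt_min ha ha')
  rw [lt_min_iff] at hr'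
  have hk : 0 < (a' - r) / (a - r) := div_pos (by linarith) (by linarith)
  refine ⟨stretchAfter r _ hk, saddleConj_stretchAfter hc (by linarith) (by nlinarith) hk,
    fun x hx => stretchAfter_of_le hk (by linarith), ?_⟩
  rw [stretchAfter_of_ge hk hr'.1.le, div_mul_cancel₀ _ (by linarith)]
  ring

lemma exists_rightMove_pair {c β s a a' b b' : ℝ} (hc : 0 < c) (hs : β ≤ s)
    (ht : β * (1 - c) ≤ (1 + c) * s) (ha : s < a) (ha' : s < a') (hab : a < b) (hab' : a' < b') :
    ∃ g : ℝ ≃o ℝ, SaddleConj c β β g ∧ (∀ x ≤ s, g x = x) ∧ g a = a' ∧ g b = b' := by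
  obtain ⟨g, h1, h2, h3⟩ := exists_rightMove hc hs ht ha ha'
  have h4 : a' < g b := by rw [← h3]; exact g.strictMono hab
  -- The second move starts at `a'` and so does not disturb the first marked point.
  obtain ⟨f, k1, k2, k3⟩ := exists_rightMove hc (hs.trans ha'.le) (by nlinarith) h4 hab'
  refine ⟨g.trans f, h1.trans k1, fun x hx => ?_, ?_, ?_⟩
  · rw [OrderIso.trans_apply, h2 x hx, k2 x (by linarith)]
  · rw [OrderIso.trans_apply, h3, k2 _ le_rfl]
  · rw [OrderIso.trans_apply, k3]

/-- The mirror image of `exists_rightMove` for the saddle with exponent `c⁻¹`, obtained with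
`SaddleConj.reflect`. -/
lemma exists_leftMove {c β s a a' : ℝ} (hc : 0 < c) (hs : s ≤ -β)
    (ht : (1 + c) * s ≤ β * (1 - c)) (ha : a < s) (ha' : a' < s) :
    ∃ g : ℝ ≃o ℝ, SaddleConj c β β g ∧ (∀ x, s ≤ x → g x = x) ∧ g a = a' := by
  have hc' := inv_pos.2 hc
  have ht' : β * (1 - c⁻¹) ≤ (1 + c⁻¹) * -s := by
    refine le_of_mul_le_mul_left ?_ hc
    have e1 : c * (β * (1 - c⁻¹)) = -(β * (1 - c)) := by field_simp; ring
    have e2 : c * ((1 + c⁻¹) * -s) = -((1 + c) * s) := by field_simp; ring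
    rw [e1, e2]
    linarith
  obtain ⟨g, h1, h2, h3⟩ := exists_rightMove hc' (by linarith : β ≤ -s) ht' (neg_lt_neg ha)
    (neg_lt_neg ha')
  refine ⟨negConj g, inv_inv c ▸ h1.reflect hc', fun x hx => ?_, ?_⟩
  · rw [negConj_apply, h2 _ (neg_le_neg hx), neg_neg]
  · rw [negConj_apply, h3, neg_neg]

/-- Two marked points in the base of the triangle can be moved if they stay on their sides of the
fold and keep the order of their levels. -/
lemma exists_triangleMove_pair {c β a b a' b' : ℝ} (hc : 0 < c) (hβ : 0 < β)
    (ha : a ∈ Ioo (-β) β) (hb : b ∈ Ioo (-β) β) (ha' : a' ∈ Ioo (-β) β) (hb' : b' ∈ Ioo (-β) β)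
    (hlt : triangleLevel c β b < triangleLevel c β a)
    (hlt' : triangleLevel c β b' < triangleLevel c β a')
    (hsa : a < saddleFold c β ∧ a' < saddleFold c β ∨ saddleFold c β < a ∧ saddleFold c β < a')
    (hsb : b < saddleFold c β ∧ b' < saddleFold c β ∨ saddleFold c β < b ∧ saddleFold c β < b') :
    ∃ g : ℝ ≃o ℝ, SaddleConj c β β g ∧ (∀ x, x ≤ -β ∨ β ≤ x → g x = x) ∧
      g (saddleFold c β) = saddleFold c β ∧ g a = a' ∧ g b = b' := by
  obtain ⟨e, he⟩ := exists_saddleDepth_iso (c := c) hc hβ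
  have hf := saddleFold_mem hc hβ
  have e0 : e (saddleFold c β) = 0 := by
    rw [he, saddleDepth_of_le_fold hβ hc hf.1.le le_rfl, sub_self]
  have hlev : ∀ {x}, x ∈ Ioo (-β) β → |e x| = triangleLevel c β (saddleFold c β) -
      triangleLevel c β x := fun hx => by
    rw [triangleLevel_eq hc hβ (Ioo_subset_Icc_self hx), he]; ring
  have hne : ∀ {x}, x ≠ saddleFold c β → 0 < |e x| := fun hx => by
    rw [abs_pos, ← e0]; exact fun h => hx (e.injective h)
  have ha0 : a ≠ saddleFold c β := by rcases hsa with h | h; exacts [h.1.ne, h.1.ne']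
  have ha0' : a' ≠ saddleFold c β := by rcases hsa with h | h; exacts [h.2.ne, h.2.ne']
  -- A higher level is a smaller depth, so `a` is the marked point closer to depth `0`. The sides of
  -- the fold take care of themselves, as `θ` is odd and increasing.
  obtain ⟨θ, d, hd0, hd, h1, h2, hodd, hfix⟩ := exists_odd_iso (a := |e a|) (b := |e b|)
    (a' := |e a'|) (b' := |e b'|) (M := triangleLevel c β (saddleFold c β)) (hne ha0)
    (by rw [hlev ha, hlev hb]; linarith) (by rw [hlev hb]; linarith [triangleLevel_pos (c := c) hb])
    (hne ha0') (by rw [hlev ha', hlev hb']; linarith)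
    (by rw [hlev hb']; linarith [triangleLevel_pos (c := c) hb'])
  have hshift : DepthShift c β e θ d := ⟨hc, hβ, he, hodd, hd0, hd, hfix⟩
  have hmark : ∀ {x x'}, (x < saddleFold c β ∧ x' < saddleFold c β ∨
      saddleFold c β < x ∧ saddleFold c β < x') → θ |e x| = |e x'| → depthConj e θ x = x' := by
    intro x x' hs h
    apply e.injective
    rw [apply_depthConj]
    rcases hs with ⟨h3, h4⟩ | ⟨h3, h4⟩
    · have h3 := e.strictMono h3
      have h4 := e.strictMono h4
      rw [e0] at h3 h4
      rw [abs_of_neg h3, abs_of_neg h4, hodd] at h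
      linarith
    · have h3 := e.strictMono h3
      have h4 := e.strictMono h4
      rw [e0] at h3 h4
      rwa [abs_of_pos h3, abs_of_pos h4] at h
  refine ⟨depthConj e θ, hshift.saddleConj, fun x hx => hshift.depthConj_outside hx, ?_,
    hmark hsa h1, hmark hsb h2⟩
  apply e.injective
  rw [apply_depthConj, e0]
  have := hodd 0
  rw [neg_zero] at this
  linarith

/-- The second marked point of `exists_triangleMove_pair` is taken so close to `-β` that its level
lies below those of `a` and `a'`, and it is left in place. -/
lemma exists_triangleMove {c β a a' : ℝ} (hc : 0 < c) (hβ : 0 < β)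
    (ha : a ∈ Ioo (-β) β) (ha' : a' ∈ Ioo (-β) β)
    (hsa : a < saddleFold c β ∧ a' < saddleFold c β ∨ saddleFold c β < a ∧ saddleFold c β < a') :
    ∃ g : ℝ ≃o ℝ, SaddleConj c β β g ∧ (∀ x, x ≤ -β ∨ β ≤ x → g x = x) ∧
      g (saddleFold c β) = saddleFold c β ∧ g a = a' := by
  have hf := saddleFold_mem hc hβ
  have hm := lt_min (triangleLevel_pos (c := c) ha) (triangleLevel_pos (c := c) ha')
  have hev : ∀ᶠ x in 𝓝[>] (-β), triangleLevel c β x <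
      min (triangleLevel c β a) (triangleLevel c β a') := by
    have := (continuous_triangleLevel (β := β) hc).continuousAt (x := -β)
    refine nhdsWithin_le_nhds (this.eventually_lt continuousAt_const ?_)
    rwa [triangleLevel_left]
  obtain ⟨b, hb, hb1⟩ := (hev.and (Ioo_mem_nhdsGT hf.1)).exists
  rw [lt_min_iff] at hb
  have hb2 : b ∈ Ioo (-β) β := ⟨hb1.1, hb1.2.trans hf.2⟩
  obtain ⟨g, h1, h2, h3, h4, -⟩ := exists_triangleMove_pair hc hβ ha hb2 ha' hb2 hb.1 hb.2 hsa
    (Or.inl ⟨hb1.2, hb1.2⟩)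
  exact ⟨g, h1, h2, h3, h4⟩

lemma SaddleConj.refl (c β : ℝ) : SaddleConj c β β (OrderIso.refl ℝ) := by
  have h := saddleConj_smul (c := c) (β := β) one_pos
  have := h.trans h.symm
  rwa [OrderIso.self_trans_symm] at this

/-- Moving points outside of an interval that contains the fold and the separatrices. -/
lemma exists_outerMove {c β lo hi p p' q q' : ℝ} (hc : 0 < c) (h1 : lo ≤ -β)
    (h2 : (1 + c) * lo ≤ β * (1 - c)) (h3 : β ≤ hi) (h4 : β * (1 - c) ≤ (1 + c) * hi)
    (hlohi : lo ≤ hi) (hq : hi < q) (hq' : hi < q') (hpq : p < q) (hpq' : p' < q')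
    (hp : p < lo ∧ p' < lo ∨ lo ≤ p ∧ p ≤ hi ∧ p = p' ∨ hi < p ∧ hi < p') :
    ∃ g : ℝ ≃o ℝ, SaddleConj c β β g ∧ (∀ x, lo ≤ x → x ≤ hi → g x = x) ∧ g p = p' ∧ g q = q' := by
  rcases hp with ⟨h5, h6⟩ | ⟨h5, h6, h7⟩ | ⟨h5, h6⟩
  · obtain ⟨f, k1, k2, k3⟩ := exists_leftMove hc h1 h2 h5 h6
    obtain ⟨g, m1, m2, m3⟩ := exists_rightMove hc h3 h4 hq hq'
    refine ⟨f.trans g, k1.trans m1, fun x hx hx' => ?_, ?_, ?_⟩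
    · rw [OrderIso.trans_apply, k2 x hx, m2 x hx']
    · rw [OrderIso.trans_apply, k3, m2 _ (by linarith)]
    · rw [OrderIso.trans_apply, k2 q (by linarith), m3]
  · obtain ⟨g, m1, m2, m3⟩ := exists_rightMove hc h3 h4 hq hq'
    exact ⟨g, m1, fun x _ hx => m2 x hx, by rw [m2 p h6, h7], m3⟩
  · obtain ⟨g, m1, m2, m3, m4⟩ := exists_rightMove_pair hc h3 h4 h5 h6 hpq hpq'
    exact ⟨g, m1, fun x _ hx => m2 x hx, m3, m4⟩

lemma tangencyY_mul (μ k β : ℝ) : tangencyY μ (k * β) = k * tangencyY μ β := by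
  rw [tangencyY, tangencyY]; ring

lemma tangencyY_spec {μ : ℝ} (hμ : μ < 0) (β : ℝ) :
    (1 + (1 - μ)) * tangencyY μ β = β * (1 - (1 - μ)) := by
  have : 2 - μ ≠ 0 := by linarith
  rw [tangencyY]
  field_simp
  ring

/-! ### Equivalence of systems with parameters in the same region. -/

namespace SlideRoots

variable {μ l β P Q l' β' P' Q' : ℝ}

/-- After a scaling and a move of the interval `[lo, hi]`, which contains the fold and the
separatrices, the remaining points can be moved outside of this interval. -/
theorem sigmaEquivalent_of_scaled (h : SlideRoots μ l β P Q) (h' : SlideRoots μ l' β' P' Q')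
    {k lo hi : ℝ} (hk : 0 < k) (hβ : β' = k * β) (h1 : lo ≤ -β')
    (h2 : lo ≤ tangencyY μ β') (h3 : β' ≤ hi) (h4 : tangencyY μ β' ≤ hi) (hhi : hi < 10)
    (hhi' : hi < k * 10) {g : ℝ ≃o ℝ} (hg : SaddleConj (1 - μ) β' β' g)
    (hfix : ∀ x, x ≤ lo ∨ hi ≤ x → g x = x) (gt : g (tangencyY μ β') = tangencyY μ β')
    (hl : k * l < lo ∧ l' < lo ∨ lo ≤ l' ∧ l' ≤ hi ∧ g (k * l) = l' ∨ hi < k * l ∧ hi < l')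
    (hP : g (k * P) = P' ∧ lo ≤ P' ∧ P' ≤ hi ∨ P ∉ slideSet μ l β ∧ P' ∉ slideSet μ l' β') :
    SigmaEquivalent (foldSaddleFamily .vis μ (l, β)) (foldSaddleFamily .vis μ (l', β')) := by
  have hμ0 := h.hμ0
  have ht := tangencyY_spec hμ0 β'
  have hQ : hi < k * Q := hhi'.trans (mul_lt_mul_of_pos_left h.hQ hk)
  have hlQ : k * l < k * Q := mul_lt_mul_of_pos_left (by linarith [h.hQ, h.l_lt]) hk
  have gQ : g (k * Q) = k * Q := hfix _ (Or.inr hQ.le)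
  obtain ⟨f, f1, f2, f3, f4⟩ := exists_outerMove (c := 1 - μ) (β := β') (p := g (k * l)) (p' := l')
    (q := k * Q) (q' := Q') (by linarith) h1 (by rw [← ht]; nlinarith) h3 (by rw [← ht]; nlinarith)
    (h2.trans h4) hQ (by linarith [h'.hQ]) (by rw [← gQ]; exact g.strictMono hlQ)
    (by linarith [h'.hQ, h'.l_lt]) (by
      rcases hl with ⟨a, b⟩ | ⟨a, b, c⟩ | ⟨a, b⟩
      · exact Or.inl ⟨by rwa [hfix _ (Or.inl a.le)], b⟩
      · exact Or.inr (Or.inl ⟨by rwa [c], by rwa [c], c⟩)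
      · exact Or.inr (Or.inr ⟨by rwa [hfix _ (Or.inr a.le)], b⟩))
  have hs := saddleConj_smul (c := 1 - μ) (β := β) hk
  rw [← hβ] at hs
  refine h.sigmaEquivalent h' ((hs.trans hg).trans f1) f3 ?_ ?_ ?_
  · change f (g (k * tangencyY μ β)) = _
    rw [← tangencyY_mul, ← hβ, gt, f2 _ h2 h4]
  · change f (g (k * Q)) = _
    rw [gQ, f4]
  · refine hP.imp (fun ⟨e, e1, e2⟩ => ?_) id
    change f (g (k * P)) = _
    rw [e, f2 _ e1 e2]

lemma notMem_slideSet (h : SlideRoots μ l β P Q) (hb : β ≤ 0 ∨ l = tangencyY μ β) :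
    P ∉ slideSet μ l β := by
  obtain ⟨h1, h2⟩ := h.P_mem_crossing hb
  rintro (h3 | h3) <;> linarith

lemma abs_tangency_le_abs (h : SlideRoots μ l β P Q) : |tangencyY μ β| ≤ |β| / 1000 := by
  have hμ0 := h.hμ0
  rw [tangencyY, abs_div, abs_mul, abs_of_neg hμ0, abs_of_pos (by linarith : 0 < 2 - μ),
    div_le_iff₀ (by linarith)]
  nlinarith [h.hμ, abs_nonneg β]

/-- For `β ≤ 0` there is no triangle, so the interval to be preserved shrinks to the tangency. The
smaller root imposes no condition, being neither a sliding nor an escaping point. -/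
lemma sigmaEquivalent_of_nonpos (h : SlideRoots μ l β P Q) (h' : SlideRoots μ l' β' P' Q')
    {k : ℝ} (hk : 0 < k) (hβ : β' = k * β) (h0 : β ≤ 0)
    (hl : l < tangencyY μ β ∧ l' < tangencyY μ β' ∨ l = tangencyY μ β ∧ l' = tangencyY μ β' ∨
      tangencyY μ β < l ∧ tangencyY μ β' < l') :
    SigmaEquivalent (foldSaddleFamily .vis μ (l, β)) (foldSaddleFamily .vis μ (l', β')) := by
  have h0' : β' ≤ 0 := by rw [hβ]; exact mul_nonpos_of_nonneg_of_nonpos hk.le h0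
  have ht := abs_le.1 h'.abs_tangency_le_abs
  rw [abs_of_nonpos h0'] at ht
  have et : k * tangencyY μ β = tangencyY μ β' := by rw [hβ, tangencyY_mul]
  have tl := h'.t_lt
  refine h.sigmaEquivalent_of_scaled h' hk hβ (lo := tangencyY μ β') (hi := tangencyY μ β')
    (by linarith) le_rfl (by linarith) le_rfl (by linarith)
    (by rw [← et]; exact mul_lt_mul_of_pos_left (by linarith [h.t_lt]) hk)
    (SaddleConj.refl _ _) (fun x _ => rfl) rfl ?_
    (Or.inr ⟨h.notMem_slideSet (Or.inl h0), h'.notMem_slideSet (Or.inl h0')⟩)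
  rcases hl with ⟨a, b⟩ | ⟨a, b⟩ | ⟨a, b⟩
  · exact Or.inl ⟨by rw [← et]; exact mul_lt_mul_of_pos_left a hk, b⟩
  · exact Or.inr (Or.inl ⟨b.ge, b.le, by rw [a, et, b]; rfl⟩)
  · exact Or.inr (Or.inr ⟨by rw [← et]; exact mul_lt_mul_of_pos_left a hk, b⟩)

/-- For `β > 0`, the interval between the separatrices is moved first. -/
lemma sigmaEquivalent_of_pos (h : SlideRoots μ l β P Q) (h' : SlideRoots μ l' β' P' Q')
    {k : ℝ} (hk : 0 < k) (hβ : β' = k * β) (h0 : 0 < β) {g : ℝ ≃o ℝ}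
    (hg : SaddleConj (1 - μ) β' β' g) (hfix : ∀ x, x ≤ -β' ∨ β' ≤ x → g x = x)
    (gt : g (tangencyY μ β') = tangencyY μ β')
    (hl : l < -β ∧ l' < -β' ∨ -β' ≤ l' ∧ l' ≤ β' ∧ g (k * l) = l' ∨ β < l ∧ β' < l')
    (hP : g (k * P) = P' ∧ -β' ≤ P' ∧ P' ≤ β' ∨ P ∉ slideSet μ l β ∧ P' ∉ slideSet μ l' β') :
    SigmaEquivalent (foldSaddleFamily .vis μ (l, β)) (foldSaddleFamily .vis μ (l', β')) := by
  have h0' : 0 < β' := by rw [hβ]; exact mul_pos hk h0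
  have ht := abs_le.1 h'.abs_tangency_le_abs
  rw [abs_of_pos h0'] at ht
  have hb := (abs_lt.1 h.hβ).2
  have hb' := (abs_lt.1 h'.hβ).2
  refine h.sigmaEquivalent_of_scaled h' hk hβ (lo := -β') (hi := β') le_rfl (by linarith)
    le_rfl (by linarith) (by linarith) (by rw [hβ]; exact mul_lt_mul_of_pos_left (by linarith) hk)
    hg hfix gt ?_ hP
  rcases hl with ⟨a, b⟩ | a | ⟨a, b⟩
  · refine Or.inl ⟨?_, b⟩
    rw [hβ, ← mul_neg]
    exact mul_lt_mul_of_pos_left a hk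
  · exact Or.inr (Or.inl a)
  · refine Or.inr (Or.inr ⟨?_, b⟩)
    rw [hβ]
    exact mul_lt_mul_of_pos_left a hk

/-- At `β` the numerator has the sign opposite to `1 - β + l`. This factor can become negative on
the whole parameter range, but not near the origin. -/
lemma P_lt_beta (h : SlideRoots μ l β P Q) (h0 : 0 < β) (hb : β < 1 / 10) (hl : |l| < 1 / 10) :
    P < β := by
  obtain ⟨h1, h2⟩ := abs_lt.1 hl
  refine h.P_lt (by linarith) ?_
  have e : slideNum μ l β β = -((1 - μ) * (β * (1 - β + l))) := by rw [slideNum]; ring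
  rw [e]
  have := mul_pos (by linarith [h.hμ0] : 0 < 1 - μ) (mul_pos h0 (by linarith : 0 < 1 - β + l))
  linarith

lemma neg_beta_lt_P (h : SlideRoots μ l β P Q) (h0 : 0 < β) (hb : β < 1 / 10)
    (hl : |l| < 1 / 10) : -β < P := by
  obtain ⟨h1, h2⟩ := abs_lt.1 hl
  refine h.lt_P (by linarith) ?_
  have e : slideNum μ l β (-β) = β * (1 - β - l) := by rw [slideNum]; ring
  rw [e]
  exact mul_pos h0 (by linarith)

/-- The test point lies opposite to `l` at half its distance from the tangency. The second factor is
about `1 - 3 β`, hence positive for `β < 1 / 10`, so the smaller root is closer to the tangency than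
the test point. -/
lemma slideNum_half (hμ : μ < 0) (l β : ℝ) :
    slideNum μ l β (tangencyY μ β - (l - tangencyY μ β) / 2) = (l - tangencyY μ β) / 2 *
      ((2 - μ) / 2 + 3 * (μ / 2 * (tangencyY μ β - (l - tangencyY μ β) / 2) - (2 - μ) / 2 * β)) := by
  have := tangencyY_spec hμ β
  rw [slideNum]
  linear_combination (-1 / 2) * this

lemma half_factor_pos (h : SlideRoots μ l β P Q) (h0 : 0 < β) (hb : β < 1 / 10)
    (hl : |l| < 1 / 10) : 0 < (2 - μ) / 2 +
      3 * (μ / 2 * (tangencyY μ β - (l - tangencyY μ β) / 2) - (2 - μ) / 2 * β) := by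
  obtain ⟨h1, h2⟩ := abs_lt.1 hl
  obtain ⟨h3, h4⟩ := abs_le.1 h.toSmallParams.abs_tangency_le
  have hμ := h.hμ
  have hμ0 := h.hμ0
  nlinarith

lemma P_lt_half (h : SlideRoots μ l β P Q) (h0 : 0 < β) (hb : β < 1 / 10) (hl : |l| < 1 / 10)
    (hlt : l < tangencyY μ β) : P < tangencyY μ β - (l - tangencyY μ β) / 2 := by
  obtain ⟨h1, h2⟩ := abs_lt.1 hl
  have := h.t_lt
  refine h.P_lt (by linarith) ?_
  rw [slideNum_half h.hμ0]
  exact mul_neg_of_neg_of_pos (by linarith) (h.half_factor_pos h0 hb hl)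

lemma half_lt_P (h : SlideRoots μ l β P Q) (h0 : 0 < β) (hb : β < 1 / 10) (hl : |l| < 1 / 10)
    (hlt : tangencyY μ β < l) : tangencyY μ β - (l - tangencyY μ β) / 2 < P := by
  obtain ⟨h1, h2⟩ := abs_lt.1 hl
  have := h.t_lt
  refine h.lt_P (by linarith) ?_
  rw [slideNum_half h.hμ0]
  exact mul_pos (by linarith) (h.half_factor_pos h0 hb hl)

/-- Between the separatrices, the fold of `X` has a lower level than the pseudo equilibrium. -/
lemma triangleLevel_lt (h : SlideRoots μ l β P Q) (h0 : 0 < β) (hb : β < 1 / 10)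
    (hl : |l| < 1 / 10) (hm : l ∈ Ioo (-β) β) (hne : l ≠ tangencyY μ β) :
    P ∈ Ioo (-β) β ∧ triangleLevel (1 - μ) β l < triangleLevel (1 - μ) β P := by
  have hμ := h.hμ
  have hμ0 := h.hμ0
  have hPm : P ∈ Ioo (-β) β := ⟨h.neg_beta_lt_P h0 hb hl, h.P_lt_beta h0 hb hl⟩
  refine ⟨hPm, ?_⟩
  have et := saddleFold_eq_tangencyY μ β
  rcases lt_or_gt_of_ne hne with hlt | hlt
  · have hP1 := h.t_lt_P h0 hlt
    have hP2 := h.P_lt_half h0 hb hl hlt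
    obtain ⟨k1, k2⟩ := triangleLevel_lt_of_half (c := 1 - μ) (β := β) (s := tangencyY μ β - l)
      (by linarith) (by linarith) h0 (Or.inr rfl) (by linarith) (by rw [et]; simpa using hm)
    rw [et] at k1 k2
    rw [show tangencyY μ β + -1 * (tangencyY μ β - l) = l by ring] at k2
    refine k2.trans (strictAntiOn_triangleLevel (by linarith) ⟨?_, hPm.2.le⟩ ⟨?_, k1.2.le⟩ ?_)
    · rw [et]; exact hP1.le
    · rw [et]; linarith
    · linarith
  · have hP1 := h.P_lt_t h0 hlt
    have hP2 := h.half_lt_P h0 hb hl hlt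
    obtain ⟨k1, k2⟩ := triangleLevel_lt_of_half (c := 1 - μ) (β := β) (s := l - tangencyY μ β)
      (by linarith) (by linarith) h0 (Or.inl rfl) (by linarith) (by rw [et]; simpa using hm)
    rw [et] at k1 k2
    rw [show tangencyY μ β + 1 * (l - tangencyY μ β) = l by ring] at k2
    refine k2.trans (strictMonoOn_triangleLevel (by linarith) h0 ⟨k1.1.le, ?_⟩ ⟨hPm.1.le, ?_⟩ ?_)
    · rw [et]; linarith
    · rw [et]; exact hP1.le
    · linarith

lemma smul_mem_Ioo {k x : ℝ} (hk : 0 < k) (hx : x ∈ Ioo (-β) β) : k * x ∈ Ioo (-(k * β)) (k * β) :=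
  ⟨by nlinarith [hx.1], by nlinarith [hx.2]⟩

/-- The case where the folds coincide. -/
lemma sigmaEquivalent_of_eq (h : SlideRoots μ l β P Q) (h' : SlideRoots μ l' β' P' Q')
    {k : ℝ} (hk : 0 < k) (hβ : β' = k * β) (h0 : 0 < β) (hl : l = tangencyY μ β)
    (hl' : l' = tangencyY μ β') :
    SigmaEquivalent (foldSaddleFamily .vis μ (l, β)) (foldSaddleFamily .vis μ (l', β')) := by
  have h0' : 0 < β' := by rw [hβ]; exact mul_pos hk h0
  have ht := abs_le.1 h'.abs_tangency_le_abs
  rw [abs_of_pos h0'] at ht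
  refine h.sigmaEquivalent_of_pos h' hk hβ h0 (SaddleConj.refl _ _) (fun x _ => rfl) rfl
    (Or.inr (Or.inl ⟨by linarith, by linarith, ?_⟩))
    (Or.inr ⟨h.notMem_slideSet (Or.inr hl), h'.notMem_slideSet (Or.inr hl')⟩)
  rw [hl, hl', hβ, tangencyY_mul]
  rfl

/-- The case where the fold of `X` lies between the separatrices. -/
lemma sigmaEquivalent_of_inside (h : SlideRoots μ l β P Q) (h' : SlideRoots μ l' β' P' Q')
    {k : ℝ} (hk : 0 < k) (hβ : β' = k * β) (h0 : 0 < β)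
    (hb : β < 1 / 10) (hl : |l| < 1 / 10) (hb' : β' < 1 / 10) (hl' : |l'| < 1 / 10)
    (hm : l ∈ Ioo (-β) β) (hm' : l' ∈ Ioo (-β') β')
    (hs : l < tangencyY μ β ∧ l' < tangencyY μ β' ∨ tangencyY μ β < l ∧ tangencyY μ β' < l') :
    SigmaEquivalent (foldSaddleFamily .vis μ (l, β)) (foldSaddleFamily .vis μ (l', β')) := by
  have h0' : 0 < β' := by rw [hβ]; exact mul_pos hk h0
  have hne : l ≠ tangencyY μ β := by rcases hs with h | h; exacts [h.1.ne, h.1.ne']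
  have hne' : l' ≠ tangencyY μ β' := by rcases hs with h | h; exacts [h.2.ne, h.2.ne']
  obtain ⟨k1, k2⟩ := h.triangleLevel_lt h0 hb hl hm hne
  obtain ⟨k3, k4⟩ := h'.triangleLevel_lt h0' hb' hl' hm' hne'
  have et : k * tangencyY μ β = tangencyY μ β' := by rw [hβ, tangencyY_mul]
  have hkP := smul_mem_Ioo hk k1
  have hkl := smul_mem_Ioo hk hm
  rw [← hβ] at hkP hkl
  have hlev : triangleLevel (1 - μ) β' (k * l) < triangleLevel (1 - μ) β' (k * P) := by
    rw [hβ, triangleLevel_smul hk hm.2.le, triangleLevel_smul hk k1.2.le]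
    exact mul_lt_mul_of_pos_left k2 (Real.rpow_pos_of_pos hk _)
  have hsl : k * l < tangencyY μ β' ∧ l' < tangencyY μ β' ∨
      tangencyY μ β' < k * l ∧ tangencyY μ β' < l' := by
    rw [← et] at hs ⊢
    exact hs.imp (fun a => ⟨mul_lt_mul_of_pos_left a.1 hk, a.2⟩)
      (fun a => ⟨mul_lt_mul_of_pos_left a.1 hk, a.2⟩)
  have hsP : k * P < tangencyY μ β' ∧ P' < tangencyY μ β' ∨
      tangencyY μ β' < k * P ∧ tangencyY μ β' < P' := by
    rcases hs with ⟨a, b⟩ | ⟨a, b⟩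
    · refine Or.inr ⟨?_, h'.t_lt_P h0' b⟩
      rw [← et]; exact mul_lt_mul_of_pos_left (h.t_lt_P h0 a) hk
    · refine Or.inl ⟨?_, h'.P_lt_t h0' b⟩
      rw [← et]; exact mul_lt_mul_of_pos_left (h.P_lt_t h0 a) hk
  have ef := saddleFold_eq_tangencyY μ β'
  -- The pseudo equilibrium has the higher level and takes the role of `a`; the fold of `X` takes
  -- that of `b`.
  obtain ⟨g, g1, g2, g3, g4, g5⟩ := exists_triangleMove_pair (c := 1 - μ) (by linarith [h.hμ0]) h0'
    hkP hkl k3 hm' hlev k4 (by rwa [ef]) (by rwa [ef])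
  rw [ef] at g3
  exact h.sigmaEquivalent_of_pos h' hk hβ h0 g1 g2 g3
    (Or.inr (Or.inl ⟨hm'.1.le, hm'.2.le, g5⟩)) (Or.inl ⟨g4, k3.1.le, k3.2.le⟩)

/-- The case where the fold of `X` does not lie between the separatrices. -/
lemma sigmaEquivalent_of_outside (h : SlideRoots μ l β P Q) (h' : SlideRoots μ l' β' P' Q')
    {k : ℝ} (hk : 0 < k) (hβ : β' = k * β) (h0 : 0 < β)
    (hb : β < 1 / 10) (hl : |l| < 1 / 10) (hb' : β' < 1 / 10) (hl' : |l'| < 1 / 10)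
    (hs : l < -β ∧ l' < -β' ∨ l = -β ∧ l' = -β' ∨ l = β ∧ l' = β' ∨ β < l ∧ β' < l') :
    SigmaEquivalent (foldSaddleFamily .vis μ (l, β)) (foldSaddleFamily .vis μ (l', β')) := by
  have h0' : 0 < β' := by rw [hβ]; exact mul_pos hk h0
  have ht := abs_le.1 h.abs_tangency_le_abs
  rw [abs_of_pos h0] at ht
  have ht' := abs_le.1 h'.abs_tangency_le_abs
  rw [abs_of_pos h0'] at ht'
  have et : k * tangencyY μ β = tangencyY μ β' := by rw [hβ, tangencyY_mul]
  have k1 : P ∈ Ioo (-β) β := ⟨h.neg_beta_lt_P h0 hb hl, h.P_lt_beta h0 hb hl⟩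
  have k3 : P' ∈ Ioo (-β') β' := ⟨h'.neg_beta_lt_P h0' hb' hl', h'.P_lt_beta h0' hb' hl'⟩
  have hkP := smul_mem_Ioo hk k1
  rw [← hβ] at hkP
  have ef := saddleFold_eq_tangencyY μ β'
  have hsP : k * P < tangencyY μ β' ∧ P' < tangencyY μ β' ∨
      tangencyY μ β' < k * P ∧ tangencyY μ β' < P' := by
    have hs' : l < tangencyY μ β ∧ l' < tangencyY μ β' ∨
        tangencyY μ β < l ∧ tangencyY μ β' < l' := by
      rcases hs with ⟨a, b⟩ | ⟨a, b⟩ | ⟨a, b⟩ | ⟨a, b⟩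
      · exact Or.inl ⟨by linarith, by linarith⟩
      · exact Or.inl ⟨by linarith, by linarith⟩
      · exact Or.inr ⟨by linarith, by linarith⟩
      · exact Or.inr ⟨by linarith, by linarith⟩
    rcases hs' with ⟨a, b⟩ | ⟨a, b⟩
    · refine Or.inr ⟨?_, h'.t_lt_P h0' b⟩
      rw [← et]; exact mul_lt_mul_of_pos_left (h.t_lt_P h0 a) hk
    · refine Or.inl ⟨?_, h'.P_lt_t h0' b⟩
      rw [← et]; exact mul_lt_mul_of_pos_left (h.P_lt_t h0 a) hk
  obtain ⟨g, g1, g2, g3, g4⟩ := exists_triangleMove (c := 1 - μ) (by linarith [h.hμ0]) h0'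
    hkP k3 (by rwa [ef])
  rw [ef] at g3
  refine h.sigmaEquivalent_of_pos h' hk hβ h0 g1 g2 g3 ?_ (Or.inl ⟨g4, k3.1.le, k3.2.le⟩)
  rcases hs with hs | ⟨a, b⟩ | ⟨a, b⟩ | hs
  · exact Or.inl hs
  · refine Or.inr (Or.inl ⟨b.ge, by linarith, ?_⟩)
    rw [a, b, mul_neg, ← hβ, g2 _ (Or.inl le_rfl)]
  · refine Or.inr (Or.inl ⟨by linarith, b.le, ?_⟩)
    rw [a, b, ← hβ, g2 _ (Or.inr le_rfl)]
  · exact Or.inr (Or.inr hs)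

end SlideRoots

/-- The regions of the diagram in terms of the parameters. -/
lemma mem_diagramRegion_iff (μ : ℝ) (k : Fin 13) (p : ℝ × ℝ) : p ∈ diagramRegion μ k ↔
    (k = 0 ∧ p.2 < 0 ∧ p.1 < tangencyY μ p.2) ∨ (k = 1 ∧ p.2 < 0 ∧ p.1 = tangencyY μ p.2) ∨
    (k = 2 ∧ p.2 < 0 ∧ tangencyY μ p.2 < p.1) ∨ (k = 3 ∧ p.2 = 0 ∧ p.1 < 0) ∨
    (k = 4 ∧ p.2 = 0 ∧ p.1 = 0) ∨ (k = 5 ∧ p.2 = 0 ∧ 0 < p.1) ∨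
    (k = 6 ∧ 0 < p.2 ∧ p.1 < -p.2) ∨ (k = 7 ∧ 0 < p.2 ∧ p.1 = -p.2) ∨
    (k = 8 ∧ 0 < p.2 ∧ -p.2 < p.1 ∧ p.1 < tangencyY μ p.2) ∨
    (k = 9 ∧ 0 < p.2 ∧ p.1 = tangencyY μ p.2) ∨
    (k = 10 ∧ 0 < p.2 ∧ tangencyY μ p.2 < p.1 ∧ p.1 < p.2) ∨
    (k = 11 ∧ 0 < p.2 ∧ p.1 = p.2) ∨ (k = 12 ∧ 0 < p.2 ∧ p.2 < p.1) := by
  fin_cases k <;> simp [diagramRegion]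

lemma tangencyY_zero (μ : ℝ) : tangencyY μ 0 = 0 := by simp [tangencyY]

/-- Parameters in the same region give equivalent systems. -/
theorem sigmaEquivalent_of_mem_region {μ : ℝ} {k : Fin 13} {p q : ℝ × ℝ}
    (hp : SmallParams μ p.1 p.2) (hq : SmallParams μ q.1 q.2) (hpk : p ∈ diagramRegion μ k)
    (hqk : q ∈ diagramRegion μ k)
    (hsmall : p.2 ≤ 0 ∨ p.1 = tangencyY μ p.2 ∨
      ((|p.1| < 1 / 10 ∧ |p.2| < 1 / 10) ∧ |q.1| < 1 / 10 ∧ |q.2| < 1 / 10)) :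
    SigmaEquivalent (foldSaddleFamily .vis μ p) (foldSaddleFamily .vis μ q) := by
  obtain ⟨P, Q, h⟩ := hp.exists_roots
  obtain ⟨P', Q', h'⟩ := hq.exists_roots
  obtain ⟨l, β⟩ := p
  obtain ⟨l', β'⟩ := q
  simp only at h h' hsmall
  have scale_neg : β < 0 → β' < 0 → ∃ k, 0 < k ∧ β' = k * β := fun a b =>
    ⟨β' / β, div_pos_of_neg_of_neg b a, (div_mul_cancel₀ _ a.ne).symm⟩
  have scale_pos : 0 < β → 0 < β' → ∃ k, 0 < k ∧ β' = k * β := fun a b =>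
    ⟨β' / β, div_pos b a, (div_mul_cancel₀ _ a.ne').symm⟩
  have scale_zero : β = 0 → β' = 0 → ∃ k, 0 < k ∧ β' = k * β := fun a b =>
    ⟨1, one_pos, by rw [a, b, mul_zero]⟩
  -- Since `|t| ≤ β / 1000`, a fold of `X` that is not strictly between the separatrices differs
  -- from the tangency, so in these regions smallness of the parameters is at hand.
  have hout : 0 < β → (l < -β ∨ l = -β ∨ l = β ∨ β < l) → l ≠ tangencyY μ β := by
    intro a b hc
    have ht := abs_le.1 h.abs_tangency_le_abs
    rw [abs_of_pos a] at ht
    rcases b with b | b | b | b <;> linarith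
  have hbig : 0 < β → l ≠ tangencyY μ β → (|l| < 1 / 10 ∧ β < 1 / 10) ∧ |l'| < 1 / 10 ∧
      β' < 1 / 10 := by
    intro a b
    rcases hsmall with c | c | ⟨⟨c1, c2⟩, c3, c4⟩
    · linarith
    · exact absurd c b
    · exact ⟨⟨c1, (abs_lt.1 c2).2⟩, c3, (abs_lt.1 c4).2⟩
  rw [mem_diagramRegion_iff] at hpk
  simp only at hpk
  rcases hpk with ⟨rfl, a, b⟩ | ⟨rfl, a, b⟩ | ⟨rfl, a, b⟩ | ⟨rfl, a, b⟩ | ⟨rfl, a, b⟩ |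
    ⟨rfl, a, b⟩ | ⟨rfl, a, b⟩ | ⟨rfl, a, b⟩ | ⟨rfl, a, b, c⟩ | ⟨rfl, a, b⟩ | ⟨rfl, a, b, c⟩ |
    ⟨rfl, a, b⟩ | ⟨rfl, a, b⟩
  · obtain ⟨a', b'⟩ : β' < 0 ∧ l' < tangencyY μ β' := hqk
    obtain ⟨k, hk, e⟩ := scale_neg a a'
    exact h.sigmaEquivalent_of_nonpos h' hk e a.le (Or.inl ⟨b, b'⟩)
  · obtain ⟨a', b'⟩ : β' < 0 ∧ l' = tangencyY μ β' := hqk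
    obtain ⟨k, hk, e⟩ := scale_neg a a'
    exact h.sigmaEquivalent_of_nonpos h' hk e a.le (Or.inr (Or.inl ⟨b, b'⟩))
  · obtain ⟨a', b'⟩ : β' < 0 ∧ tangencyY μ β' < l' := hqk
    obtain ⟨k, hk, e⟩ := scale_neg a a'
    exact h.sigmaEquivalent_of_nonpos h' hk e a.le (Or.inr (Or.inr ⟨b, b'⟩))
  · obtain ⟨a', b'⟩ : β' = 0 ∧ l' < 0 := hqk
    obtain ⟨k, hk, e⟩ := scale_zero a a'
    refine h.sigmaEquivalent_of_nonpos h' hk e a.le (Or.inl ?_)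
    rw [a, a', tangencyY_zero]; exact ⟨b, b'⟩
  · obtain ⟨a', b'⟩ : β' = 0 ∧ l' = 0 := hqk
    obtain ⟨k, hk, e⟩ := scale_zero a a'
    refine h.sigmaEquivalent_of_nonpos h' hk e a.le (Or.inr (Or.inl ?_))
    rw [a, a', tangencyY_zero]; exact ⟨b, b'⟩
  · obtain ⟨a', b'⟩ : β' = 0 ∧ 0 < l' := hqk
    obtain ⟨k, hk, e⟩ := scale_zero a a'
    refine h.sigmaEquivalent_of_nonpos h' hk e a.le (Or.inr (Or.inr ?_))
    rw [a, a', tangencyY_zero]; exact ⟨b, b'⟩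
  · obtain ⟨a', b'⟩ : 0 < β' ∧ l' < -β' := hqk
    obtain ⟨k, hk, e⟩ := scale_pos a a'
    obtain ⟨⟨c1, c2⟩, c3, c4⟩ := hbig a (hout a (Or.inl b))
    exact h.sigmaEquivalent_of_outside h' hk e a c2 c1 c4 c3 (Or.inl ⟨b, b'⟩)
  · obtain ⟨a', b'⟩ : 0 < β' ∧ l' = -β' := hqk
    obtain ⟨k, hk, e⟩ := scale_pos a a'
    obtain ⟨⟨c1, c2⟩, c3, c4⟩ := hbig a (hout a (Or.inr (Or.inl b)))
    exact h.sigmaEquivalent_of_outside h' hk e a c2 c1 c4 c3 (Or.inr (Or.inl ⟨b, b'⟩))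
  · obtain ⟨a', b', d'⟩ : 0 < β' ∧ -β' < l' ∧ l' < tangencyY μ β' := hqk
    obtain ⟨k, hk, e⟩ := scale_pos a a'
    obtain ⟨⟨c1, c2⟩, c3, c4⟩ := hbig a c.ne
    have ht := (abs_le.1 h.abs_tangency_le_abs).2
    have ht' := (abs_le.1 h'.abs_tangency_le_abs).2
    rw [abs_of_pos a] at ht
    rw [abs_of_pos a'] at ht'
    exact h.sigmaEquivalent_of_inside h' hk e a c2 c1 c4 c3 ⟨b, by linarith⟩ ⟨b', by linarith⟩
      (Or.inl ⟨c, d'⟩)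
  · obtain ⟨a', b'⟩ : 0 < β' ∧ l' = tangencyY μ β' := hqk
    obtain ⟨k, hk, e⟩ := scale_pos a a'
    exact h.sigmaEquivalent_of_eq h' hk e a b b'
  · obtain ⟨a', b', d'⟩ : 0 < β' ∧ tangencyY μ β' < l' ∧ l' < β' := hqk
    obtain ⟨k, hk, e⟩ := scale_pos a a'
    obtain ⟨⟨c1, c2⟩, c3, c4⟩ := hbig a b.ne'
    have ht := (abs_le.1 h.abs_tangency_le_abs).1
    have ht' := (abs_le.1 h'.abs_tangency_le_abs).1
    rw [abs_of_pos a] at ht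
    rw [abs_of_pos a'] at ht'
    exact h.sigmaEquivalent_of_inside h' hk e a c2 c1 c4 c3 ⟨by linarith, c⟩ ⟨by linarith, d'⟩
      (Or.inr ⟨b, b'⟩)
  · obtain ⟨a', b'⟩ : 0 < β' ∧ l' = β' := hqk
    obtain ⟨k, hk, e⟩ := scale_pos a a'
    obtain ⟨⟨c1, c2⟩, c3, c4⟩ := hbig a (hout a (Or.inr (Or.inr (Or.inl b))))
    exact h.sigmaEquivalent_of_outside h' hk e a c2 c1 c4 c3 (Or.inr (Or.inr (Or.inl ⟨b, b'⟩)))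
  · obtain ⟨a', b'⟩ : 0 < β' ∧ β' < l' := hqk
    obtain ⟨k, hk, e⟩ := scale_pos a a'
    obtain ⟨⟨c1, c2⟩, c3, c4⟩ := hbig a (hout a (Or.inr (Or.inr (Or.inr b))))
    exact h.sigmaEquivalent_of_outside h' hk e a c2 c1 c4 c3 (Or.inr (Or.inr (Or.inr ⟨b, b'⟩)))

/-! ### Invariants of `Σ`-equivalence. -/

/-- A nonnegative function that vanishes at `a` has a nonnegative derivative from the right. -/
lemma deriv_nonneg_of_right {φ : ℝ → ℝ} {d a b : ℝ} {I : Set ℝ} (hI : I.OrdConnected) (ha : a ∈ I)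
    (hb : b ∈ I) (hab : a < b) (h0 : ∀ t ∈ I, 0 ≤ φ t) (hφ : φ a = 0)
    (hd : HasDerivWithinAt φ d I a) : 0 ≤ d := by
  have h1 := hd.mono (hI.out ha hb)
  rw [hasDerivWithinAt_iff_tendsto_slope, Icc_sdiff_left] at h1
  have := left_nhdsWithin_Ioc_neBot hab
  refine ge_of_tendsto h1 ?_
  filter_upwards [self_mem_nhdsWithin] with t ht
  rw [slope_def_field, hφ, sub_zero]
  exact div_nonneg (h0 t (hI.out ha hb ⟨ht.1.le, ht.2⟩)) (by linarith [ht.1])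

/-- A nonnegative function that vanishes at `a` has a nonpositive derivative from the left. -/
lemma deriv_nonpos_of_left {φ : ℝ → ℝ} {d a b : ℝ} {I : Set ℝ} (hI : I.OrdConnected) (ha : a ∈ I)
    (hb : b ∈ I) (hab : b < a) (h0 : ∀ t ∈ I, 0 ≤ φ t) (hφ : φ a = 0)
    (hd : HasDerivWithinAt φ d I a) : d ≤ 0 := by
  have h1 := hd.mono (hI.out hb ha)
  rw [hasDerivWithinAt_iff_tendsto_slope, Icc_sdiff_right] at h1
  have := right_nhdsWithin_Ico_neBot hab
  refine le_of_tendsto h1 ?_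
  filter_upwards [self_mem_nhdsWithin] with t ht
  rw [slope_def_field, hφ, sub_zero]
  exact div_nonpos_of_nonneg_of_nonpos (h0 t (hI.out hb ha ⟨ht.1, ht.2.le⟩)) (by linarith [ht.2])

namespace IsOrbitArc

variable {W : ℝ × ℝ → ℝ × ℝ} {C : Set (ℝ × ℝ)} {I : Set ℝ} {γ : ℝ → ℝ × ℝ}

lemma hasDerivWithinAt_fst (h : IsOrbitArc W C I γ) {t : ℝ} (ht : t ∈ I) :
    HasDerivWithinAt (fun t => (γ t).1) (W (γ t)).1 I t :=
  (hasFDerivAt_fst (𝕜 := ℝ) (p := γ t)).comp_hasDerivWithinAt t (h.2 t ht).2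

lemma hasDerivWithinAt_snd (h : IsOrbitArc W C I γ) {t : ℝ} (ht : t ∈ I) :
    HasDerivWithinAt (fun t => (γ t).2) (W (γ t)).2 I t :=
  (hasFDerivAt_snd (𝕜 := ℝ) (p := γ t)).comp_hasDerivWithinAt t (h.2 t ht).2

/-- An arc that continues after a point of `Σ` inside a half-plane cannot have a velocity pointing
out of it. The time `b` provides the continuation, without which the derivative would say nothing.
-/
lemma snd_nonneg (h : IsOrbitArc W upperHalf I γ) {a b : ℝ} (ha : a ∈ I) (hb : b ∈ I) (hab : a < b)
    (h0 : (γ a).2 = 0) : 0 ≤ (W (γ a)).2 :=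
  deriv_nonneg_of_right h.1 ha hb hab (fun t ht => (h.2 t ht).1) h0 (h.hasDerivWithinAt_snd ha)

lemma snd_nonpos_of_left (h : IsOrbitArc W upperHalf I γ) {a b : ℝ} (ha : a ∈ I) (hb : b ∈ I)
    (hab : b < a) (h0 : (γ a).2 = 0) : (W (γ a)).2 ≤ 0 :=
  deriv_nonpos_of_left h.1 ha hb hab (fun t ht => (h.2 t ht).1) h0 (h.hasDerivWithinAt_snd ha)

lemma snd_nonpos (h : IsOrbitArc W lowerHalf I γ) {a b : ℝ} (ha : a ∈ I) (hb : b ∈ I) (hab : a < b)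
    (h0 : (γ a).2 = 0) : (W (γ a)).2 ≤ 0 := by
  have := deriv_nonneg_of_right h.1 ha hb hab (φ := fun t => -(γ t).2)
    (fun t ht => neg_nonneg.2 (h.2 t ht).1) (by simp [h0]) (h.hasDerivWithinAt_snd ha).neg
  linarith

/-- The field vanishes along a constant arc. -/
lemma eq_zero_of_const (h : IsOrbitArc W C I γ) {a b : ℝ} (ha : a ∈ I) (hb : b ∈ I) (hab : a < b)
    (hconst : ∀ t ∈ I, γ t = γ a) : W (γ a) = 0 := by
  have key : ∀ {φ : ℝ → ℝ} {d : ℝ}, (∀ t ∈ I, φ t = φ a) → HasDerivWithinAt φ d I a → d = 0 := by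
    intro φ d hφ hd
    have h1 := deriv_nonneg_of_right h.1 ha hb hab (φ := fun t => φ t - φ a)
      (fun t ht => (sub_eq_zero.2 (hφ t ht)).ge) (sub_self _) (hd.sub_const _)
    have h2 := deriv_nonneg_of_right h.1 ha hb hab (φ := fun t => -(φ t - φ a))
      (fun t ht => by simp [hφ t ht]) (by simp) (hd.sub_const _).neg
    linarith
  exact Prod.ext (key (fun t ht => by rw [hconst t ht]) (h.hasDerivWithinAt_fst ha))
    (key (fun t ht => by rw [hconst t ht]) (h.hasDerivWithinAt_snd ha))

/-- One-point arcs carry no condition on the derivative. They turn a statement about arcs into one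
about membership of points. -/
lemma singleton (W : ℝ × ℝ → ℝ × ℝ) {C : Set (ℝ × ℝ)} {z : ℝ × ℝ} (hz : z ∈ C) :
    IsOrbitArc W C {0} fun _ => z := by
  refine ⟨ordConnected_singleton, fun t ht => ⟨hz, ?_⟩⟩
  obtain rfl : t = 0 := ht
  rw [hasDerivWithinAt_iff_tendsto_slope]
  simp

end IsOrbitArc

/-- Maps that send sliding arcs to sliding arcs send sliding or escaping points to such points. -/
lemma SendsArcs.mem_of_mem {h : ℝ × ℝ → ℝ × ℝ} {Z Z' : FilippovSystem}
    (hs : SendsArcs h Z.IsSlidingArc Z'.IsSlidingArc) {z : ℝ × ℝ}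
    (hz : z ∈ Z.escapingRegion ∪ Z.slidingRegion) :
    h z ∈ Z'.escapingRegion ∪ Z'.slidingRegion := by
  obtain ⟨s, η, -, -, hB, he⟩ := hs {0} (fun _ => z) (IsOrbitArc.singleton _ hz)
  rw [he 0 rfl]
  exact (hB.2 (s 0) ⟨0, rfl, rfl⟩).1

/-- The arc of the orbit of `X` through `(x, 0)`. -/
lemma isOrbitArc_parabola (μ l β x : ℝ) {I : Set ℝ} (hI : I.OrdConnected)
    (h : ∀ τ ∈ I, 0 ≤ τ * (2 * (x - l) + τ)) :
    IsOrbitArc (foldSaddleFamily .vis μ (l, β)).X upperHalf I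
      fun τ => (x + τ, τ * (2 * (x - l) + τ) / 2) := by
  refine ⟨hI, fun τ hτ => ⟨?_, ?_⟩⟩
  · exact div_nonneg (h τ hτ) zero_le_two
  · rw [vis_X]
    have h1 : HasDerivAt (fun τ : ℝ => x + τ) 1 τ := (hasDerivAt_id τ).const_add x
    have h2 : HasDerivAt (fun τ : ℝ => τ * (2 * (x - l) + τ) / 2)
        ((1 * (2 * (x - l) + τ) + τ * 1) / 2) τ :=
      ((hasDerivAt_id τ).mul ((hasDerivAt_id τ).const_add (2 * (x - l)))).div_const 2
    have e : (1 * (2 * (x - l) + τ) + τ * 1) / 2 = x + τ - l := by ring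
    rw [e] at h2
    exact (h1.prodMk h2).hasDerivWithinAt

/-- An escaping point is not sent to a sliding point. -/
lemma SendsArcs.not_sliding_of_escaping {h : ℝ × ℝ → ℝ × ℝ} {μ l β : ℝ} {Z' : FilippovSystem}
    (hs : SendsArcs h (foldSaddleFamily .vis μ (l, β)).IsArc Z'.IsArc) {x : ℝ} (hx : l < x) :
    h (x, 0) ∉ Z'.slidingRegion := by
  rintro ⟨h0, h1, h2⟩
  -- From a point to the right of the fold an orbit of `X` leaves `Σ` forward in time. Its image
  -- would have to leave a sliding point forward in time, but there both fields point towards `Σ`.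
  obtain ⟨s, η, hmono, -, hB, he⟩ := hs (Icc 0 1) _ (Or.inl (isOrbitArc_parabola μ l β x
    ordConnected_Icc fun τ hτ => mul_nonneg hτ.1 (by linarith [hτ.1])))
  have m0 : (0 : ℝ) ∈ Icc (0 : ℝ) 1 := ⟨le_rfl, zero_le_one⟩
  have m1 : (1 : ℝ) ∈ Icc (0 : ℝ) 1 := ⟨zero_le_one, le_rfl⟩
  have e0 := he 0 m0
  simp only [add_zero, zero_mul, zero_div] at e0
  rw [e0] at h0 h1 h2
  rcases hB with hB | hB
  · exact absurd (hB.snd_nonneg ⟨0, m0, rfl⟩ ⟨1, m1, rfl⟩ (hmono m0 m1 one_pos) h0) h1.not_ge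
  · exact absurd (hB.snd_nonpos ⟨0, m0, rfl⟩ ⟨1, m1, rfl⟩ (hmono m0 m1 one_pos) h0) h2.not_ge

/-- The data of a `Σ`-equivalence between two systems of the family: it acts on `Σ` by the
increasing map `g` and preserves the open half-planes and the ends of the crossing region. -/
structure SigmaMatching (μ l β l' β' : ℝ) (h : (ℝ × ℝ) ≃ₜ (ℝ × ℝ)) (g : ℝ ≃o ℝ) : Prop where
  arcs : SendsArcs h (foldSaddleFamily .vis μ (l, β)).IsArc (foldSaddleFamily .vis μ (l', β')).IsArc
  arcs_symm : SendsArcs h.symm (foldSaddleFamily .vis μ (l', β')).IsArc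
    (foldSaddleFamily .vis μ (l, β)).IsArc
  boundary : ∀ x, h (x, 0) = (g x, 0)
  up : ∀ z : ℝ × ℝ, 0 < z.2 → 0 < (h z).2
  low : ∀ z : ℝ × ℝ, z.2 < 0 → (h z).2 < 0
  max_eq : g (max l (tangencyY μ β)) = max l' (tangencyY μ β')
  min_eq : g (min l (tangencyY μ β)) = min l' (tangencyY μ β')

lemma mem_range_of_ne_zero {u : (ℝ × ℝ) → ℝ} (hu : Continuous u) {H : Set (ℝ × ℝ)}
    (hH : Convex ℝ H) (hne : ∀ z ∈ H, u z ≠ 0) : (∀ z ∈ H, 0 < u z) ∨ ∀ z ∈ H, u z < 0 := by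
  by_contra! hcon
  obtain ⟨⟨a, ha, ha'⟩, b, hb, hb'⟩ := hcon
  obtain ⟨z, hz, h0⟩ := hH.isPreconnected.intermediate_value ha hb hu.continuousOn ⟨ha', hb'⟩
  exact hne z hz h0

/-- An orientation preserving homeomorphism that acts on `Σ` by an increasing map preserves the
open half-planes. -/
lemma preserves_halves {h : (ℝ × ℝ) ≃ₜ (ℝ × ℝ)} (ho : PreservesOrientation h) {g : ℝ ≃o ℝ}
    (hg : ∀ x, h (x, 0) = (g x, 0)) :
    (∀ z : ℝ × ℝ, 0 < z.2 → 0 < (h z).2) ∧ ∀ z : ℝ × ℝ, z.2 < 0 → (h z).2 < 0 := by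
  have hne : ∀ z : ℝ × ℝ, z.2 ≠ 0 → (h z).2 ≠ 0 := by
    intro z hz h0
    apply hz
    have : z = (g.symm (h z).1, 0) := by
      apply h.injective
      rw [hg, g.apply_symm_apply]
      exact Prod.ext rfl h0
    rw [this]
  have hu : Continuous fun z => (h z).2 := continuous_snd.comp h.continuous
  have cu : Convex ℝ {z : ℝ × ℝ | 0 < z.2} := (convex_Ioi (0 : ℝ)).linear_preimage (LinearMap.snd ℝ ℝ ℝ)
  have cl : Convex ℝ {z : ℝ × ℝ | z.2 < 0} := (convex_Iio (0 : ℝ)).linear_preimage (LinearMap.snd ℝ ℝ ℝ)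
  have hsurj : ∀ y : ℝ, ∃ z : ℝ × ℝ, (h z).2 = y := fun y => ⟨h.symm (0, y), by simp⟩
  rcases mem_range_of_ne_zero hu cu (fun z hz => hne z (ne_of_gt hz)) with h1 | h1 <;>
    rcases mem_range_of_ne_zero hu cl (fun z hz => hne z (ne_of_lt hz)) with h2 | h2
  · exfalso
    obtain ⟨z, hz⟩ := hsurj (-1)
    rcases lt_trichotomy z.2 0 with h3 | h3 | h3
    · linarith [h2 z h3]
    · have : z = (z.1, 0) := Prod.ext rfl h3
      rw [this, hg] at hz
      norm_num at hz
    · linarith [h1 z h3]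
  · exact ⟨h1, h2⟩
  · exact absurd ho (not_preservesOrientation_of_swap h g g.strictMono hg h1 h2)
  · exfalso
    obtain ⟨z, hz⟩ := hsurj 1
    rcases lt_trichotomy z.2 0 with h3 | h3 | h3
    · linarith [h2 z h3]
    · have : z = (z.1, 0) := Prod.ext rfl h3
      rw [this, hg] at hz
      norm_num at hz
    · linarith [h1 z h3]

/-- The sliding and escaping points are preserved as a set, and escaping points stay escaping. This
makes the map on `Σ` increasing and fixes the images of the ends of the crossing region.
Preservation of orientation then keeps each half-plane. -/
lemma exists_sigmaMatching {μ l β l' β' : ℝ} (hμ : μ < 0)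
    (h : SigmaEquivalent (foldSaddleFamily .vis μ (l, β)) (foldSaddleFamily .vis μ (l', β'))) :
    ∃ H g, SigmaMatching μ l β l' β' H g := by
  obtain ⟨h, ho, hS, a1, a2, s1, s2⟩ := h
  have hb : ∀ x, h (x, 0) = ((h (x, 0)).1, 0) := fun x => by
    have : h (x, 0) ∈ switchingManifold := by rw [← hS]; exact ⟨(x, 0), rfl, rfl⟩
    exact Prod.ext rfl this
  have hb' : ∀ x, h.symm (x, 0) = ((h.symm (x, 0)).1, 0) := fun x => by
    have : ((x, 0) : ℝ × ℝ) ∈ h '' switchingManifold := by rw [hS]; rfl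
    obtain ⟨z, hz, e⟩ := this
    rw [← e, h.symm_apply_apply]
    exact Prod.ext rfl hz
  have inv1 : ∀ x, (h.symm ((h (x, 0)).1, 0)).1 = x := fun x => by
    rw [← hb, h.symm_apply_apply]
  have inv2 : ∀ x, (h ((h.symm (x, 0)).1, 0)).1 = x := fun x => by
    rw [← hb', h.apply_symm_apply]
  have hcont : Continuous fun x : ℝ => (h (x, 0)).1 :=
    continuous_fst.comp (h.continuous.comp (by fun_prop))
  have hinj : Function.Injective fun x : ℝ => (h (x, 0)).1 := fun x y hxy => by
    have hxy : (h (x, 0)).1 = (h (y, 0)).1 := hxy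
    rw [← inv1 x, ← inv1 y, hxy]
  have hesc : ∀ {l β l' β' : ℝ} {h : ℝ × ℝ → ℝ × ℝ},
      SendsArcs h (foldSaddleFamily .vis μ (l, β)).IsArc
        (foldSaddleFamily .vis μ (l', β')).IsArc →
      SendsArcs h (foldSaddleFamily .vis μ (l, β)).IsSlidingArc
        (foldSaddleFamily .vis μ (l', β')).IsSlidingArc → (∀ x, h (x, 0) = ((h (x, 0)).1, 0)) →
      ∀ x, max l (tangencyY μ β) < x → max l' (tangencyY μ β') < (h (x, 0)).1 := by
    intro l β l' β' h a s hb x hx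
    have h1 := s.mem_of_mem (z := (x, 0)) (by
      rw [escapingRegion_eq l β hμ]; exact Or.inl ⟨rfl, hx⟩)
    have h2 := (h1.resolve_right (a.not_sliding_of_escaping ((le_max_left _ _).trans_lt hx)))
    rw [escapingRegion_eq l' β' hμ] at h2
    exact h2.2
  have hsl : ∀ {l β l' β' : ℝ} {h : ℝ × ℝ → ℝ × ℝ},
      SendsArcs h (foldSaddleFamily .vis μ (l, β)).IsSlidingArc
        (foldSaddleFamily .vis μ (l', β')).IsSlidingArc →
      (∀ x, max l' (tangencyY μ β') < (h (x, 0)).1 → max l (tangencyY μ β) < x) →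
      ∀ x, x < min l (tangencyY μ β) → (h (x, 0)).1 < min l' (tangencyY μ β') := by
    intro l β l' β' h s hm x hx
    have h1 := s.mem_of_mem (z := (x, 0)) (by
      rw [slidingRegion_eq l β hμ]; exact Or.inr ⟨rfl, hx⟩)
    rw [slidingRegion_eq l' β' hμ, escapingRegion_eq l' β' hμ] at h1
    rcases h1 with h1 | h1
    · have := hm x h1.2
      have := min_le_max (a := l) (b := tangencyY μ β)
      linarith
    · exact h1.2
  have e1 := hesc a1 s1 hb
  have e2 := hesc a2 s2 hb'
  have hmono : StrictMono fun x : ℝ => (h (x, 0)).1 := by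
    rcases hcont.strictMono_of_inj hinj with hm | hm
    · exact hm
    exfalso
    -- If the map were decreasing, a point with image far enough to the left would lie to the right
    -- of `M`. It would be an escaping point with an image that is not escaping.
    set M := max l (tangencyY μ β) + 1
    set x := (h.symm (min (max l' (tangencyY μ β')) ((h (M, 0)).1 - 1), 0)).1 with hx
    have h1 : (h (x, 0)).1 = min (max l' (tangencyY μ β')) ((h (M, 0)).1 - 1) := inv2 _
    have h2 : M < x := by
      by_contra hcon
      have h3 : (h (M, 0)).1 ≤ (h (x, 0)).1 := hm.antitone (not_lt.1 hcon)
      rw [h1] at h3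
      have := min_le_right (max l' (tangencyY μ β')) ((h (M, 0)).1 - 1)
      linarith
    have h3 := e1 x (by linarith)
    rw [h1] at h3
    exact absurd (min_le_left _ _) h3.not_ge
  let g : ℝ ≃o ℝ :=
    { toFun := fun x => (h (x, 0)).1
      invFun := fun x => (h.symm (x, 0)).1
      left_inv := inv1
      right_inv := inv2
      map_rel_iff' := hmono.le_iff_le }
  have hgb : ∀ x, h (x, 0) = (g x, 0) := hb
  have iff1 : ∀ x, max l (tangencyY μ β) < x ↔ max l' (tangencyY μ β') < g x := fun x =>
    ⟨e1 x, fun hx => by simpa [g, inv1] using e2 (g x) hx⟩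
  have iff1' : ∀ x, max l (tangencyY μ β) < (h.symm (x, 0)).1 → max l' (tangencyY μ β') < x :=
    fun x hx => by
      have := e1 _ hx
      rwa [inv2] at this
  have f1 := hsl s1 (fun x hx => (iff1 x).2 hx)
  have f2 := hsl s2 iff1'
  have iff2 : ∀ x, x < min l (tangencyY μ β) ↔ g x < min l' (tangencyY μ β') := fun x =>
    ⟨f1 x, fun hx => by simpa [g, inv1] using f2 (g x) hx⟩
  obtain ⟨hup, hlow⟩ := preserves_halves ho hgb
  refine ⟨h, g, a1, a2, hgb, hup, hlow, ?_, ?_⟩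
  · refine le_antisymm (not_lt.1 fun hc => ((iff1 _).2 hc).false) (not_lt.1 fun hc => ?_)
    have h1 : max l (tangencyY μ β) < g.symm (max l' (tangencyY μ β')) := by
      rwa [← g.lt_iff_lt, g.apply_symm_apply]
    have h2 := (iff1 _).1 h1
    rw [g.apply_symm_apply] at h2
    exact h2.false
  · refine le_antisymm (not_lt.1 fun hc => ?_) (not_lt.1 fun hc => ((iff2 _).2 hc).false)
    have h1 : g.symm (min l' (tangencyY μ β')) < min l (tangencyY μ β) := by
      rwa [← g.lt_iff_lt, g.apply_symm_apply]
    have h2 := (iff2 _).1 h1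
    rw [g.apply_symm_apply] at h2
    exact h2.false

namespace SigmaMatching

variable {μ l β l' β' : ℝ} {h : (ℝ × ℝ) ≃ₜ (ℝ × ℝ)} {g : ℝ ≃o ℝ}

lemma symm (m : SigmaMatching μ l β l' β' h g) : SigmaMatching μ l' β' l β h.symm g.symm where
  arcs := m.arcs_symm
  arcs_symm := m.arcs
  boundary x := by
    apply h.injective
    rw [h.apply_symm_apply, m.boundary, g.apply_symm_apply]
  up z hz := by
    by_contra hcon
    rcases (not_lt.1 hcon).lt_or_eq with h1 | h1
    · have := m.low _ h1
      rw [h.apply_symm_apply] at this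
      linarith
    · have h2 : h.symm z = ((h.symm z).1, 0) := Prod.ext rfl h1
      have h3 := m.boundary (h.symm z).1
      rw [← h2, h.apply_symm_apply] at h3
      rw [h3] at hz
      exact hz.false
  low z hz := by
    by_contra hcon
    rcases (not_lt.1 hcon).lt_or_eq with h1 | h1
    · have := m.up _ h1
      rw [h.apply_symm_apply] at this
      linarith
    · have h2 : h.symm z = ((h.symm z).1, 0) := Prod.ext rfl h1.symm
      have h3 := m.boundary (h.symm z).1
      rw [← h2, h.apply_symm_apply] at h3
      rw [h3] at hz
      exact hz.false
  max_eq := by rw [← m.max_eq, g.symm_apply_apply]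
  min_eq := by rw [← m.min_eq, g.symm_apply_apply]

/-- The fold of `X` is sent to the fold. -/
lemma map_fold (m : SigmaMatching μ l β l' β' h g) : g l = l' := by
  -- The orbit of the fold stays in the upper half-plane both before and after it touches `Σ`. For
  -- its image this forces the vertical component of the field to be nonnegative and nonpositive at
  -- once.
  obtain ⟨s, η, hmono, -, hB, he⟩ := m.arcs (Icc (-1) 1) _ (Or.inl (isOrbitArc_parabola μ l β l
    ordConnected_Icc fun τ _ => by rw [sub_self, mul_zero, zero_add]; exact mul_self_nonneg τ))
  have m0 : (0 : ℝ) ∈ Icc (-1 : ℝ) 1 := by constructor <;> norm_num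
  have m1 : (1 : ℝ) ∈ Icc (-1 : ℝ) 1 := by constructor <;> norm_num
  have m2 : (-1 : ℝ) ∈ Icc (-1 : ℝ) 1 := by constructor <;> norm_num
  have e0 := he 0 m0
  simp only [add_zero, zero_mul, zero_div] at e0
  rw [m.boundary] at e0
  rcases hB with hB | hB
  · have h1 := hB.snd_nonneg ⟨0, m0, rfl⟩ ⟨1, m1, rfl⟩ (hmono m0 m1 one_pos) (by rw [← e0])
    have h2 := hB.snd_nonpos_of_left ⟨0, m0, rfl⟩ ⟨-1, m2, rfl⟩ (hmono m2 m0 (by norm_num))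
      (by rw [← e0])
    rw [← e0, vis_X] at h1 h2
    simp only at h1 h2
    linarith
  · exfalso
    have h1 := m.up (l + 1, 1 * (2 * (l - l) + 1) / 2) (by norm_num)
    rw [he 1 m1] at h1
    have h2 : (η (s 1)).2 ≤ 0 := (hB.2 _ ⟨1, m1, rfl⟩).1
    linarith

/-- The folds of `X` and `Y` are the two ends of the crossing interval. As these ends and the fold
of `X` are preserved, so is the order of the two folds. -/
lemma fold_order (m : SigmaMatching μ l β l' β' h g) :
    (l < tangencyY μ β → l' < tangencyY μ β') ∧ (l = tangencyY μ β → l' = tangencyY μ β') ∧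
      (tangencyY μ β < l → tangencyY μ β' < l') := by
  have h1 := m.map_fold
  have h2 := m.max_eq
  have h3 := m.min_eq
  refine ⟨fun hl => ?_, fun hl => ?_, fun hl => ?_⟩
  · rw [max_eq_right hl.le] at h2
    have h4 := g.strictMono hl
    rw [h1, h2] at h4
    simpa using h4
  · rw [← hl, max_self, h1] at h2
    rw [← hl, min_self, h1] at h3
    exact le_antisymm (min_eq_left_iff.1 h3.symm) (max_eq_left_iff.1 h2.symm)
  · rw [min_eq_right hl.le] at h3
    have h4 := g.strictMono hl
    rw [h1, h3] at h4
    simpa using h4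

/-- The saddle is sent to the saddle. -/
lemma map_saddle (m : SigmaMatching μ l β l' β' h g) (hμ : μ < 0) (hβ : 0 ≤ β) :
    0 ≤ β' ∧ h (0, -β) = (0, -β') := by
  have hY : (foldSaddleFamily .vis μ (l, β)).Y (0, -β) = 0 := by
    simp [foldSaddleFamily]
  -- The constant arc must last for a positive time: its image then is a constant arc over more than
  -- one instant, so the field vanishes there. This excludes `X` and leaves only the saddle of `Y`.
  obtain ⟨s, η, hmono, -, hB, he⟩ := m.arcs (Icc 0 1) (fun _ => (0, -β)) (Or.inr
    ⟨ordConnected_Icc, fun t _ => ⟨by simpa [lowerHalf] using hβ, by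
      rw [hY]; exact hasDerivWithinAt_const _ _ _⟩⟩)
  have m0 : (0 : ℝ) ∈ Icc (0 : ℝ) 1 := ⟨le_rfl, zero_le_one⟩
  have m1 : (1 : ℝ) ∈ Icc (0 : ℝ) 1 := ⟨zero_le_one, le_rfl⟩
  have hconst : ∀ t ∈ s '' Icc 0 1, η t = η (s 0) := by
    rintro _ ⟨t, ht, rfl⟩
    rw [← he t ht, ← he 0 m0]
  have e0 := he 0 m0
  rcases hB with hB | hB
  · exfalso
    have h1 := hB.eq_zero_of_const ⟨0, m0, rfl⟩ ⟨1, m1, rfl⟩ (hmono m0 m1 one_pos) hconst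
    rw [vis_X] at h1
    exact one_ne_zero (congrArg Prod.fst h1)
  · have h1 := hB.eq_zero_of_const ⟨0, m0, rfl⟩ ⟨1, m1, rfl⟩ (hmono m0 m1 one_pos) hconst
    have h2 : (η (s 0)).2 ≤ 0 := (hB.2 _ ⟨0, m0, rfl⟩).1
    rw [← e0] at h1 h2
    have k1 := congrArg Prod.fst h1
    have k2 := congrArg Prod.snd h1
    simp only [foldSaddleFamily, Prod.fst_zero, Prod.snd_zero] at k1 k2
    have hμ1 : 1 - μ ≠ 0 := by linarith
    -- The linear system for the zero of `Y` is solved by Cramer's rule; its determinant is `-(1 -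
    -- μ)`.
    have k3 : (h (0, -β)).1 = 0 := by
      have : (1 - μ) * (h (0, -β)).1 = 0 := by
        linear_combination (-μ / 2) * k1 + (μ - 2) / 2 * k2
      exact (mul_eq_zero.1 this).resolve_left hμ1
    have k4 : (h (0, -β)).2 + β' = 0 := by
      have : (1 - μ) * ((h (0, -β)).2 + β') = 0 := by
        linear_combination (μ - 2) / 2 * k1 + (-μ / 2) * k2
      exact (mul_eq_zero.1 this).resolve_left hμ1
    exact ⟨by linarith, Prod.ext k3 (by simp only; linarith)⟩

/-- The saddle belongs to the closed lower half-plane exactly for `β ≥ 0` and to `Σ` exactly for `β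
= 0`. Both properties are preserved, in both directions. -/
lemma beta_sign (m : SigmaMatching μ l β l' β' h g) (hμ : μ < 0) :
    (β < 0 → β' < 0) ∧ (β = 0 → β' = 0) ∧ (0 < β → 0 < β') := by
  have hz : ∀ {l β l' β' : ℝ} {h : (ℝ × ℝ) ≃ₜ (ℝ × ℝ)} {g : ℝ ≃o ℝ},
      SigmaMatching μ l β l' β' h g → β = 0 → β' = 0 := by
    rintro l β l' β' h g m rfl
    have h1 := (m.map_saddle hμ le_rfl).2
    rw [neg_zero, m.boundary] at h1
    have := congrArg Prod.snd h1
    simp only at this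
    linarith
  refine ⟨fun hb => ?_, hz m, fun hb => ?_⟩
  · by_contra hcon
    exact absurd (m.symm.map_saddle hμ (not_lt.1 hcon)).1 hb.not_ge
  · rcases (m.map_saddle hμ hb.le).1.lt_or_eq with h1 | h1
    · exact h1
    · exact absurd (hz m.symm h1.symm) hb.ne'

/-- The image of an arc of `Y` with a point below `Σ`, in saddle coordinates. -/
lemma map_saddleArc (m : SigmaMatching μ l β l' β' h g) {I : Set ℝ} {z : ℝ × ℝ}
    (hI : I.OrdConnected) (hz : ∀ t ∈ I, saddleOrbit (1 - μ) z t ∈ saddleHalf β)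
    {a : ℝ} (ha : a ∈ I) (hlow : (ofSaddle β (saddleOrbit (1 - μ) z a)).2 < 0) :
    ∃ (s : ℝ → ℝ) (w : ℝ × ℝ), StrictMonoOn s I ∧ ∀ t ∈ I,
      toSaddle β' (h (ofSaddle β (saddleOrbit (1 - μ) z t))) = saddleOrbit (1 - μ) w (s t) := by
  obtain ⟨s, η, hmono, -, hB, he⟩ := m.arcs I (fun t => ofSaddle β (saddleOrbit (1 - μ) z t))
    (Or.inr (isOrbitArc_lower_iff.2 ⟨hI, z, fun t ht => by
      beta_reduce; rw [toSaddle_ofSaddle]; exact ⟨rfl, hz t ht⟩⟩))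
  rcases hB with hB | hB
  · exfalso
    have h1 := m.low _ hlow
    rw [he a ha] at h1
    exact absurd (hB.2 _ ⟨a, ha, rfl⟩).1 (not_le.2 h1)
  · obtain ⟨-, w, hw⟩ := isOrbitArc_lower_iff.1 hB
    refine ⟨s, w, hmono, fun t ht => ?_⟩
    have := (hw _ ⟨t, ht, rfl⟩).1
    rw [he t ht]
    exact this

lemma eq_zero_of_tendsto {ι : Type*} {F : Filter ι} [F.NeBot] {u : ι → ℝ} {a ε : ℝ} (hε : 0 < ε)
    (hu : ∀ᶠ i in F, ε ≤ u i) (h : Tendsto (fun i => a * u i) F (𝓝 0)) : a = 0 := by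
  have h1 : |a| * ε ≤ 0 := by
    have h2 := h.abs
    rw [abs_zero] at h2
    refine ge_of_tendsto h2 ?_
    filter_upwards [hu] with i hi
    rw [abs_mul, abs_of_pos (hε.trans_le hi)]
    exact mul_le_mul_of_nonneg_left hi (abs_nonneg a)
  by_contra ha
  have := mul_pos (abs_pos.2 ha) hε
  linarith

lemma tendsto_image (m : SigmaMatching μ l β l' β' h g) (hμ : μ < 0) (hβ : 0 < β) {F : Filter ℝ}
    {γ : ℝ → ℝ × ℝ} (hγ : Tendsto γ F (𝓝 0)) :
    Tendsto (fun t => toSaddle β' (h (ofSaddle β (γ t)))) F (𝓝 0) := by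
  have h1 : Continuous fun z => toSaddle β' (h (ofSaddle β z)) :=
    (continuous_toSaddle β').comp (h.continuous.comp (continuous_ofSaddle β))
  have h2 := (h1.tendsto 0).comp hγ
  have h3 : toSaddle β' (h (ofSaddle β 0)) = 0 := by
    have : ofSaddle β 0 = (0, -β) := by simp [ofSaddle]
    rw [this, (m.map_saddle hμ hβ.le).2]
    simp [toSaddle]
  rwa [h3] at h2

/-- The separatrices are sent to the separatrices. -/
lemma map_unstable (m : SigmaMatching μ l β l' β' h g) (hμ : μ < 0) (hβ : 0 < β) :
    g (-β) = -β' := by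
  have hz : ∀ t, saddleOrbit (1 - μ) (-β, 0) t = (-β * Real.exp t, 0) := fun t => by
    simp [saddleOrbit]
  obtain ⟨s, w, hs, hw⟩ := m.map_saddleArc (I := Iic 0) (z := (-β, 0)) (a := -1) ordConnected_Iic
    (fun t ht => by
      rw [hz]
      have := Real.exp_le_one_iff.2 (show t ≤ 0 from ht)
      simp only [saddleHalf, mem_ofPred_eq]
      nlinarith) (by norm_num) (by
      rw [hz]
      have := Real.exp_lt_one_iff.2 (show (-1 : ℝ) < 0 by norm_num)
      simp only [ofSaddle]
      nlinarith)
  have hlim : Tendsto (fun t => saddleOrbit (1 - μ) (-β, 0) t) atBot (𝓝 0) := by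
    have : Tendsto (fun t => (-β * Real.exp t, (0 : ℝ))) atBot (𝓝 (-β * 0, 0)) :=
      (Real.tendsto_exp_atBot.const_mul (-β)).prodMk_nhds tendsto_const_nhds
    rw [mul_zero] at this
    simp only [hz]
    exact this
  have h1 := m.tendsto_image hμ hβ hlim
  have h2 : Tendsto (fun t => w.2 * Real.exp (-(1 - μ) * s t)) atBot (𝓝 0) := by
    refine ((continuous_snd.tendsto _).comp h1).congr' ?_
    filter_upwards [eventually_le_atBot 0] with t ht
    simp only [Function.comp]
    rw [hw t ht]
    rfl
  -- In backward time the image tends to the saddle, whereas the new time stays below `s 0` and a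
  -- stable component would be bounded away from `0`. So this component vanishes and the image lies
  -- on the unstable axis.
  have hw2 : w.2 = 0 := by
    refine eq_zero_of_tendsto (Real.exp_pos (-(1 - μ) * s 0)) ?_ h2
    filter_upwards [eventually_le_atBot 0] with t ht
    have := hs.monotoneOn (show t ∈ Iic (0 : ℝ) from ht) (le_refl (0 : ℝ)) ht
    exact Real.exp_le_exp.2 (by nlinarith)
  have h3 := hw 0 (le_refl (0 : ℝ))
  have e : ofSaddle β (saddleOrbit (1 - μ) (-β, 0) 0) = (-β, 0) := by
    rw [hz]; simp [ofSaddle]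
  rw [e, m.boundary, toSaddle_boundary] at h3
  have h4 := congrArg Prod.snd h3
  simp only [saddleBoundary, saddleOrbit, hw2, zero_mul] at h4
  linarith

/-- The same argument in forward time, where a nonzero unstable component could not tend to `0`. -/
lemma map_stable (m : SigmaMatching μ l β l' β' h g) (hμ : μ < 0) (hβ : 0 < β) : g β = β' := by
  have hz : ∀ t, saddleOrbit (1 - μ) (0, β) t = (0, β * Real.exp (-(1 - μ) * t)) := fun t => by
    simp [saddleOrbit]
  have hc : 0 < 1 - μ := by linarith
  obtain ⟨s, w, hs, hw⟩ := m.map_saddleArc (I := Ici 0) (z := (0, β)) (a := 1) ordConnected_Ici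
    (fun t ht => by
      rw [hz]
      have ht : 0 ≤ t := ht
      have := Real.exp_le_one_iff.2 (show -(1 - μ) * t ≤ 0 by nlinarith)
      simp only [saddleHalf, mem_ofPred_eq]
      nlinarith) (by norm_num) (by
      rw [hz]
      have := Real.exp_lt_one_iff.2 (show -(1 - μ) * 1 < 0 by linarith)
      simp only [ofSaddle]
      nlinarith)
  have hlim : Tendsto (fun t => saddleOrbit (1 - μ) (0, β) t) atTop (𝓝 0) := by
    have h0 : Tendsto (fun t : ℝ => Real.exp (-(1 - μ) * t)) atTop (𝓝 0) :=
      Real.tendsto_exp_atBot.comp (tendsto_id.const_mul_atTop_of_neg (by linarith))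
    have : Tendsto (fun t => ((0 : ℝ), β * Real.exp (-(1 - μ) * t))) atTop (𝓝 (0, β * 0)) :=
      tendsto_const_nhds.prodMk_nhds (h0.const_mul β)
    rw [mul_zero] at this
    simp only [hz]
    exact this
  have h1 := m.tendsto_image hμ hβ hlim
  have h2 : Tendsto (fun t => w.1 * Real.exp (s t)) atTop (𝓝 0) := by
    refine ((continuous_fst.tendsto _).comp h1).congr' ?_
    filter_upwards [eventually_ge_atTop 0] with t ht
    simp only [Function.comp]
    rw [hw t ht]
    rfl
  have hw2 : w.1 = 0 := by
    refine eq_zero_of_tendsto (Real.exp_pos (s 0)) ?_ h2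
    filter_upwards [eventually_ge_atTop 0] with t ht
    exact Real.exp_le_exp.2 (hs.monotoneOn (le_refl (0 : ℝ)) (show t ∈ Ici (0 : ℝ) from ht) ht)
  have h3 := hw 0 (le_refl (0 : ℝ))
  have e : ofSaddle β (saddleOrbit (1 - μ) (0, β) 0) = (β, 0) := by
    rw [hz]; simp [ofSaddle]
  rw [e, m.boundary, toSaddle_boundary] at h3
  have h4 := congrArg Prod.fst h3
  simp only [saddleBoundary, saddleOrbit, hw2, zero_mul] at h4
  linarith

end SigmaMatching

/-- Equivalent systems have parameters in the same region. -/
theorem mem_region_of_sigmaEquivalent {μ : ℝ} (hμ : μ < 0) {p q : ℝ × ℝ}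
    (h : SigmaEquivalent (foldSaddleFamily .vis μ p) (foldSaddleFamily .vis μ q)) {k : Fin 13}
    (hp : p ∈ diagramRegion μ k) : q ∈ diagramRegion μ k := by
  obtain ⟨l, β⟩ := p
  obtain ⟨l', β'⟩ := q
  obtain ⟨H, g, m⟩ := exists_sigmaMatching hμ h
  obtain ⟨f1, f2, f3⟩ := m.fold_order
  obtain ⟨b1, b2, b3⟩ := m.beta_sign hμ
  have hl := m.map_fold
  have u : 0 < β → g (-β) = -β' := m.map_unstable hμ
  have v : 0 < β → g β = β' := m.map_stable hμ
  have t0 := tangencyY_zero μ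
  have hlt : ∀ {x y}, x < y → g x < g y := fun h => g.strictMono h
  rw [mem_diagramRegion_iff] at hp
  simp only at hp
  rcases hp with ⟨rfl, a, b⟩ | ⟨rfl, a, b⟩ | ⟨rfl, a, b⟩ | ⟨rfl, a, b⟩ | ⟨rfl, a, b⟩ |
    ⟨rfl, a, b⟩ | ⟨rfl, a, b⟩ | ⟨rfl, a, b⟩ | ⟨rfl, a, b, c⟩ | ⟨rfl, a, b⟩ | ⟨rfl, a, b, c⟩ |
    ⟨rfl, a, b⟩ | ⟨rfl, a, b⟩
  · exact ⟨b1 a, f1 b⟩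
  · exact ⟨b1 a, f2 b⟩
  · exact ⟨b1 a, f3 b⟩
  · refine ⟨b2 a, ?_⟩
    rw [a, b2 a, t0] at f1
    exact f1 b
  · refine ⟨b2 a, ?_⟩
    rw [a, b2 a, t0] at f2
    exact f2 b
  · refine ⟨b2 a, ?_⟩
    rw [a, b2 a, t0] at f3
    exact f3 b
  · refine ⟨b3 a, ?_⟩
    have := hlt b
    rwa [hl, u a] at this
  · refine ⟨b3 a, ?_⟩
    rw [b, u a] at hl
    exact hl.symm
  · refine ⟨b3 a, ?_, f1 c⟩
    have := hlt b
    rwa [hl, u a] at this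
  · exact ⟨b3 a, f2 b⟩
  · refine ⟨b3 a, f3 b, ?_⟩
    have := hlt c
    rwa [hl, v a] at this
  · refine ⟨b3 a, ?_⟩
    rw [b, v a] at hl
    exact hl.symm
  · refine ⟨b3 a, ?_⟩
    have := hlt b
    rwa [hl, v a] at this

/-! ### The partition of the parameters and the number of phase portraits. -/

/-- The tangency lies strictly between the separatrices. This separates the seven regions with `β >
0` from one another. -/
lemma tangencyY_bounds {μ β : ℝ} (hμ : -(1 / 1000) < μ) (hμ0 : μ < 0) (hβ : 0 < β) :
    -β < tangencyY μ β ∧ tangencyY μ β < 0 := by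
  have h : 0 < 2 - μ := by linarith
  constructor
  · rw [tangencyY, lt_div_iff₀ h]; nlinarith
  · rw [tangencyY, div_lt_iff₀ h]; nlinarith

lemma exists_mem_diagramRegion (μ : ℝ) (p : ℝ × ℝ) :
    ∃ k, p ∈ diagramRegion μ k := by
  obtain ⟨l, β⟩ := p
  rcases lt_trichotomy β 0 with hb | hb | hb
  · rcases lt_trichotomy l (tangencyY μ β) with h | h | h
    exacts [⟨0, hb, h⟩, ⟨1, hb, h⟩, ⟨2, hb, h⟩]
  · rcases lt_trichotomy l 0 with h | h | h
    exacts [⟨3, hb, h⟩, ⟨4, hb, h⟩, ⟨5, hb, h⟩]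
  · rcases lt_trichotomy l (tangencyY μ β) with h | h | h
    · rcases lt_trichotomy l (-β) with h' | h' | h'
      exacts [⟨6, hb, h'⟩, ⟨7, hb, h'⟩, ⟨8, hb, h', h⟩]
    · exact ⟨9, hb, h⟩
    · rcases lt_trichotomy l β with h' | h' | h'
      exacts [⟨10, hb, h, h'⟩, ⟨11, hb, h'⟩, ⟨12, hb, h'⟩]

lemma diagramRegion_disjoint {μ : ℝ} (hμ : -(1 / 1000) < μ) (hμ0 : μ < 0) {p : ℝ × ℝ}
    {k k' : Fin 13} (h : p ∈ diagramRegion μ k) (h' : p ∈ diagramRegion μ k') : k = k' := by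
  obtain ⟨l, β⟩ := p
  rw [mem_diagramRegion_iff] at h h'
  simp only at h h'
  rcases lt_trichotomy β 0 with hb | hb | hb
  · simp only [hb, hb.ne, hb.not_gt, true_and, false_and, and_false, or_false] at h h'
    rcases h with ⟨rfl, h⟩ | ⟨rfl, h⟩ | ⟨rfl, h⟩ <;>
      rcases h' with ⟨rfl, h'⟩ | ⟨rfl, h'⟩ | ⟨rfl, h'⟩ <;> first | rfl | (exfalso; linarith)
  · subst hb
    simp only [lt_irrefl, true_and, false_and, and_false, or_false, false_or] at h h'
    rcases h with ⟨rfl, h⟩ | ⟨rfl, h⟩ | ⟨rfl, h⟩ <;>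
      rcases h' with ⟨rfl, h'⟩ | ⟨rfl, h'⟩ | ⟨rfl, h'⟩ <;> first | rfl | (exfalso; linarith)
  · obtain ⟨t1, t2⟩ := tangencyY_bounds hμ hμ0 hb
    simp only [hb, hb.ne', hb.not_gt, true_and, false_and, and_false, false_or] at h h'
    rcases h with ⟨rfl, h⟩ | ⟨rfl, h⟩ | ⟨rfl, h, j⟩ | ⟨rfl, h⟩ | ⟨rfl, h, j⟩ | ⟨rfl, h⟩ | ⟨rfl, h⟩ <;>
      rcases h' with ⟨rfl, h'⟩ | ⟨rfl, h'⟩ | ⟨rfl, h', j'⟩ | ⟨rfl, h'⟩ | ⟨rfl, h', j'⟩ |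
        ⟨rfl, h'⟩ | ⟨rfl, h'⟩ <;> first | rfl | (exfalso; linarith)

lemma diagramRegion_inter_nonempty {μ : ℝ} (hμ : -(1 / 1000) < μ) (hμ0 : μ < 0) {r : ℝ}
    (hr : 0 < r) (k : Fin 13) : (diagramRegion μ k ∩ parameterSquare r).Nonempty := by
  -- All the witnesses have coordinates of absolute value at most `s`. The bound `s < 1 / 2` puts
  -- them in the parameter domain and `s < r` in the smaller square.
  obtain ⟨s, hs, hs'⟩ := exists_between (lt_min hr (by norm_num : (0 : ℝ) < 1 / 2))
  obtain ⟨hsr, hs2⟩ := lt_min_iff.1 hs'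
  have h3 : 1 / 2 < Real.sqrt 3 / 2 := by
    have : 1 < Real.sqrt 3 := by rw [Real.lt_sqrt one_pos.le]; norm_num
    linarith
  have hmem : ∀ l β : ℝ, |l| ≤ s → |β| ≤ s → (l, β) ∈ parameterSquare r := by
    intro l β h1 h2
    obtain ⟨h4, h5⟩ := abs_le.1 h1
    obtain ⟨h6, h7⟩ := abs_le.1 h2
    exact ⟨⟨⟨by simp only; linarith, by simp only; linarith⟩,
      ⟨by simp only; linarith, by simp only; linarith⟩⟩, h1.trans_lt hsr, h2.trans_lt hsr⟩
  obtain ⟨t1, t2⟩ := tangencyY_bounds hμ hμ0 hs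
  have tn : tangencyY μ (-s) = -tangencyY μ s := by rw [tangencyY, tangencyY]; ring
  suffices h : ∃ p, p ∈ diagramRegion μ k ∧ |p.1| ≤ s ∧ |p.2| ≤ s by
    obtain ⟨p, hp, h4, h5⟩ := h
    exact ⟨p, hp, hmem p.1 p.2 h4 h5⟩
  simp only [abs_le]
  fin_cases k
  · exact ⟨(-s, -s), ⟨by simp only; linarith, by simp only; linarith⟩,
      ⟨by simp, by simp only; linarith⟩, by simp, by simp only; linarith⟩
  · exact ⟨(tangencyY μ (-s), -s), ⟨by simp only; linarith, rfl⟩,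
      ⟨by simp only; linarith, by simp only; linarith⟩, by simp, by simp only; linarith⟩
  · exact ⟨(s, -s), ⟨by simp only; linarith, by simp only; linarith⟩,
      ⟨by simp only; linarith, by simp⟩, by simp, by simp only; linarith⟩
  · exact ⟨(-s, 0), ⟨rfl, by simp only; linarith⟩,
      ⟨by simp, by simp only; linarith⟩, by simp only; linarith, by simp only; linarith⟩
  · exact ⟨(0, 0), ⟨rfl, rfl⟩,
      ⟨by simp only; linarith, by simp only; linarith⟩, by simp only; linarith, by simp only; linarith⟩
  · exact ⟨(s, 0), ⟨rfl, hs⟩,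
      ⟨by simp only; linarith, by simp⟩, by simp only; linarith, by simp only; linarith⟩
  · exact ⟨(-s, s / 2), ⟨by simp only; linarith, by simp only; linarith⟩,
      ⟨by simp, by simp only; linarith⟩, by simp only; linarith, by simp only; linarith⟩
  · exact ⟨(-s, s), ⟨hs, rfl⟩,
      ⟨by simp, by simp only; linarith⟩, by simp only; linarith, by simp⟩
  · exact ⟨((-s + tangencyY μ s) / 2, s), ⟨hs, by simp only; linarith, by simp only; linarith⟩,
      ⟨by simp only; linarith, by simp only; linarith⟩, by simp only; linarith, by simp⟩
  · exact ⟨(tangencyY μ s, s), ⟨hs, rfl⟩,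
      ⟨by simp only; linarith, by simp only; linarith⟩, by simp only; linarith, by simp⟩
  · exact ⟨((s + tangencyY μ s) / 2, s), ⟨hs, by simp only; linarith, by simp only; linarith⟩,
      ⟨by simp only; linarith, by simp only; linarith⟩, by simp only; linarith, by simp⟩
  · exact ⟨(s, s), ⟨hs, rfl⟩,
      ⟨by simp only; linarith, by simp⟩, by simp only; linarith, by simp⟩
  · exact ⟨(s, s / 2), ⟨by simp only; linarith, by simp only; linarith⟩,
      ⟨by simp only; linarith, by simp⟩, by simp only; linarith, by simp only; linarith⟩

/-- The phase portraits are in bijection with the regions. -/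
lemma ncard_phasePortraits {Z : ℝ × ℝ → FilippovSystem} {R : Set (ℝ × ℝ)} {n : ℕ}
    {D : Fin n → Set (ℝ × ℝ)} (hex : ∀ p ∈ R, ∃ k, p ∈ D k)
    (hdisj : ∀ {p k k'}, p ∈ D k → p ∈ D k' → k = k') (hne : ∀ k, (D k ∩ R).Nonempty)
    (hsame : ∀ k, ∀ p ∈ D k ∩ R, ∀ q ∈ D k ∩ R, SigmaEquivalent (Z p) (Z q))
    (hdiff : ∀ p ∈ R, ∀ q ∈ R, SigmaEquivalent (Z p) (Z q) → ∀ k, p ∈ D k → q ∈ D k) :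
    (phasePortraits Z R).ncard = n := by
  have hclass : ∀ k, ∀ p ∈ D k ∩ R, {q | q ∈ R ∧ SigmaEquivalent (Z p) (Z q)} = D k ∩ R := by
    intro k p hp
    ext q
    exact ⟨fun hq => ⟨hdiff p hp.2 q hq.1 hq.2 k hp.1, hq.1⟩,
      fun hq => ⟨hq.2, hsame k p hp q hq⟩⟩
  have himage : phasePortraits Z R = (fun k => D k ∩ R) '' univ := by
    ext C
    constructor
    · rintro ⟨p, hp, rfl⟩
      obtain ⟨k, hk⟩ := hex p hp
      exact ⟨k, mem_univ k, (hclass k p ⟨hk, hp⟩).symm⟩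
    · rintro ⟨k, -, rfl⟩
      obtain ⟨p, hp⟩ := hne k
      exact ⟨p, hp.2, hclass k p hp⟩
  have hinj : Function.Injective fun k => D k ∩ R := by
    intro k k' h
    obtain ⟨p, hp⟩ := hne k
    have h : D k ∩ R = D k' ∩ R := h
    have hp' := hp
    rw [h] at hp'
    exact hdisj hp.1 hp'.1
  rw [himage, ncard_image_of_injective _ hinj, ncard_univ, Nat.card_eq_fintype_card,
    Fintype.card_fin]

theorem theorem6 :
    ∃ ε₀ > (0 : ℝ), ∃ ρ > (0 : ℝ), ∀ μ : ℝ, -ε₀ < μ → μ < 0 →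
      -- the thirteen regions partition the diagram and all of them reach the origin
      (∀ p ∈ parameterDomain, ∃! k, p ∈ diagramRegion μ k) ∧
      (∀ r > 0, ∀ k, (diagramRegion μ k ∩ parameterSquare r).Nonempty) ∧
      -- different regions have different phase portraits
      (∀ p ∈ parameterDomain, ∀ q ∈ parameterDomain,
        SigmaEquivalent (foldSaddleFamily .vis μ p) (foldSaddleFamily .vis μ q) →
          ∀ k, p ∈ diagramRegion μ k → q ∈ diagramRegion μ k) ∧
      -- near the origin, each region has a single phase portrait
      (∀ k, ∀ p ∈ diagramRegion μ k ∩ parameterSquare ρ,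
        ∀ q ∈ diagramRegion μ k ∩ parameterSquare ρ,
          SigmaEquivalent (foldSaddleFamily .vis μ p) (foldSaddleFamily .vis μ q)) ∧
      -- the regions with `β ≤ 0` or `d = i` have a single phase portrait on the whole range
      (∀ k, ∀ p ∈ diagramRegion μ k ∩ parameterDomain,
        ∀ q ∈ diagramRegion μ k ∩ parameterDomain,
          (p.2 ≤ 0 ∨ p.1 = tangencyY μ p.2) →
          SigmaEquivalent (foldSaddleFamily .vis μ p) (foldSaddleFamily .vis μ q)) ∧
      -- exactly thirteen phase portraits
      (∀ r, 0 < r → r ≤ ρ →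
        (phasePortraits (foldSaddleFamily .vis μ) (parameterSquare r)).ncard = 13) ∧
      -- the switching manifold, the saddle `Q` and the other pseudo equilibria
      (∀ lam β : ℝ, (lam, β) ∈ parameterDomain →
        (foldSaddleFamily .vis μ (lam, β)).slidingRegion =
          {z | z.2 = 0 ∧ z.1 < min lam (tangencyY μ β)} ∧
        (foldSaddleFamily .vis μ (lam, β)).crossingRegion =
          {z | z.2 = 0 ∧ min lam (tangencyY μ β) < z.1 ∧ z.1 < max lam (tangencyY μ β)} ∧
        (foldSaddleFamily .vis μ (lam, β)).escapingRegion =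
          {z | z.2 = 0 ∧ max lam (tangencyY μ β) < z.1} ∧
        ∃ q : ℝ, lam < q ∧ tangencyY μ β < q ∧ 0 < q ∧ (foldSaddleFamily .vis μ (lam, β)).IsSigmaSaddle (q, 0) ∧
          (β ≤ 0 ∨ lam = tangencyY μ β → ∀ z, (foldSaddleFamily .vis μ (lam, β)).IsPseudoEquilibrium z ↔ z = (q, 0)) ∧
          (0 < β → lam < tangencyY μ β → ∃ x : ℝ, x ≠ q ∧ (foldSaddleFamily .vis μ (lam, β)).IsSigmaRepeller (x, 0) ∧
            ∀ z, (foldSaddleFamily .vis μ (lam, β)).IsPseudoEquilibrium z ↔ z = (q, 0) ∨ z = (x, 0)) ∧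
          (0 < β → tangencyY μ β < lam → ∃ x : ℝ, x ≠ q ∧ (foldSaddleFamily .vis μ (lam, β)).IsSigmaAttractor (x, 0) ∧
            ∀ z, (foldSaddleFamily .vis μ (lam, β)).IsPseudoEquilibrium z ↔ z = (q, 0) ∨ z = (x, 0))) := by
  -- The bound `1 / 1000` for `|μ|` gives `P < 10 < Q` on the whole domain and `|t| ≤ |β| / 1000`.
  -- The radius `1 / 10` keeps `P` between the separatrices for `β > 0` and makes the comparison of
  -- the levels of `l` and `P` valid.
  refine ⟨1 / 1000, by norm_num, 1 / 10, by norm_num, fun μ hμ hμ0 => ?_⟩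
  have hdiff : ∀ p ∈ parameterDomain, ∀ q ∈ parameterDomain,
      SigmaEquivalent (foldSaddleFamily .vis μ p) (foldSaddleFamily .vis μ q) →
        ∀ k, p ∈ diagramRegion μ k → q ∈ diagramRegion μ k :=
    fun p _ q _ h k hp => mem_region_of_sigmaEquivalent hμ0 h hp
  have hsame : ∀ k, ∀ p ∈ diagramRegion μ k ∩ parameterSquare (1 / 10),
      ∀ q ∈ diagramRegion μ k ∩ parameterSquare (1 / 10),
        SigmaEquivalent (foldSaddleFamily .vis μ p) (foldSaddleFamily .vis μ q) :=
    fun k p hp q hq => sigmaEquivalent_of_mem_region (smallParams_of_mem hμ hμ0 hp.2.1)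
      (smallParams_of_mem hμ hμ0 hq.2.1) hp.1 hq.1 (Or.inr (Or.inr ⟨hp.2.2, hq.2.2⟩))
  have hmono : ∀ r, r ≤ 1 / 10 → parameterSquare r ⊆ parameterSquare (1 / 10) :=
    fun r hr p hp => ⟨hp.1, hp.2.1.trans_le hr, hp.2.2.trans_le hr⟩
  refine ⟨fun p _ => ?_, fun r hr k => diagramRegion_inter_nonempty hμ hμ0 hr k, hdiff, hsame,
    fun k p hp q hq h => sigmaEquivalent_of_mem_region (smallParams_of_mem hμ hμ0 hp.2)
      (smallParams_of_mem hμ hμ0 hq.2) hp.1 hq.1 (h.imp id Or.inl), fun r hr hr' => ?_,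
    fun lam β hp => ?_⟩
  · obtain ⟨k, hk⟩ := exists_mem_diagramRegion μ p
    exact ⟨k, hk, fun k' hk' => diagramRegion_disjoint hμ hμ0 hk' hk⟩
  · exact ncard_phasePortraits (fun p _ => exists_mem_diagramRegion μ p)
      (diagramRegion_disjoint hμ hμ0) (diagramRegion_inter_nonempty hμ hμ0 hr)
      (fun k p hp q hq => hsame k p ⟨hp.1, hmono r hr' hp.2⟩ q ⟨hq.1, hmono r hr' hq.2⟩)
      (fun p hp q hq => hdiff p hp.1 q hq.1)
  · obtain ⟨P, Q, h⟩ := (smallParams_of_mem hμ hμ0 hp).exists_roots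
    have hQ := max_lt_iff.1 h.Q_gt
    have hPQ : P ≠ Q := by linarith [h.hP, h.hQ]
    refine ⟨slidingRegion_eq lam β hμ0, crossingRegion_eq lam β hμ0, escapingRegion_eq lam β hμ0,
      Q, hQ.1, hQ.2, by linarith [h.hQ], h.isSigmaSaddle, fun hb z => ?_, fun hb hl => ?_,
      fun hb hl => ?_⟩
    · rw [h.isPseudoEquilibrium_iff]
      exact or_iff_left fun hz => h.notMem_slideSet hb hz.1
    · refine ⟨P, hPQ, h.isSigmaRepeller hb hl, fun z => ?_⟩
      rw [h.isPseudoEquilibrium_iff]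
      have hm : P ∈ slideSet μ lam β := Or.inr (by
        rw [max_eq_right hl.le]; exact h.t_lt_P hb hl)
      simp [hm]
    · refine ⟨P, hPQ, h.isSigmaAttractor hb hl, fun z => ?_⟩
      rw [h.isPseudoEquilibrium_iff]
      have hm : P ∈ slideSet μ lam β := Or.inl (by
        rw [min_eq_right hl.le]; exact h.P_lt_t hb hl)
      simp [hm]
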